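/- Let $d\in\{2,3\}$, let $\Omega\subset\mathbb R^d$ be a bounded domain with Lipschitz boundary $\Sigma=\partial\Omega$ and outer unit normal $\boldsymbol n$, and let $T>0$. For $t\in(0,T)$ let $\Gamma(t)\subset\Omega$ be a smoothly evolving closed hypersurface enclosing the region $\Omega_+(t)$, with $\overline{\Omega_+(t)}\subset\Omega$, $\Gamma(t)=\partial\Omega_+(t)$ and $\Omega_-(t)=\Omega\setminus\overline{\Omega_+(t)}$. Let $d(x,t)$ be the signed distance to $\Gamma(t)$, positive in $\Omega_+(t)$; let $\boldsymbol\nu=\nabla d$ be the unit normal pointing into $\Omega_+$, $\mathcal V=-\partial_t d$ the normal velocity and $\kappa=-\operatorname{div}\boldsymbol\nu$ the mean curvature of $\Gamma$. For a quantity $\omega$ with traces $\omega^\pm$ from $\Omega_\pm$ put $[\omega]=\omega^+-\omega^-$ on $\Gamma$. Let $\eta=\eta_\pm>0$ and $\sigma=\sigma_\pm>0$ be constant in each phase, $\hat\lambda>0$ and $m_0>0$ constants, $\boldsymbol B$ a given magnetic field (for $d=2$, perpendicular to the plane), and $D(\boldsymbol u)=\frac12(\nabla\boldsymbol u+\nabla\boldsymbol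 u^{T})$. Suppose that $\boldsymbol u,p,\boldsymbol J,\phi$ are sufficiently smooth in each phase up to its boundary, with $$\partial_t\boldsymbol u+(\boldsymbol u\cdot\nabla)\boldsymbol u-2\eta\operatorname{div}D(\boldsymbol u)+\nabla p-\boldsymbol J\times\boldsymbol B=0,\quad \operatorname{div}\boldsymbol u=0,\quad \sigma^{-1}\boldsymbol J+\nabla\phi-\boldsymbol u\times\boldsymbol B=0,\quad \operatorname{div}\boldsymbol J=0$$ in $\Omega_\pm(t)$; with $$[2\eta D(\boldsymbol u)\boldsymbol\nu-p\boldsymbol\nu]=-\hat\lambda\kappa\boldsymbol\nu,\qquad [\boldsymbol u]=0,\qquad [\boldsymbol J\cdot\boldsymbol\nu]=0,\qquad [\phi]=0\qquad\text{on }\Gamma(t);$$ and with $\boldsymbol u=0$, $\boldsymbol J\cdot\boldsymbol n=0$ on $\Sigma$. Suppose moreover one of the following. Case I (constant mobility): there is $\mu$, sufficiently smooth in each phase up to its boundary, with $\Delta\mu=0$ in $\Omega_\pm(t)$, $2(-\mathcal V+\boldsymbol u\cdot\boldsymbol\nu)=m_0[\nabla\mu]\cdot\boldsymbol\nu$ and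 $2\mu=\hat\lambda\kappa$ (from both sides) on $\Gamma(t)$, and $\partial_{\boldsymbol n}\mu=0$ on $\Sigma$. Cases II and III (vanishing or degenerate mobility): $\mathcal V=\boldsymbol u\cdot\boldsymbol\nu$ on $\Gamma(t)$. Then for every $t\in(0,T)$ all the integrals below are finite and $$\frac{d}{dt}\Big[\int_\Omega\tfrac12|\boldsymbol u|^2+\int_{\Gamma(t)}\hat\lambda\Big]=-\mathcal D\le 0,$$ where $$\text{Case I:}\quad \mathcal D=\int_\Omega 2\eta|D(\boldsymbol u)|^2+\int_\Omega\sigma^{-1}|\boldsymbol J|^2+\int_\Omega m_0|\nabla\mu|^2,$$ $$\text{Cases II and III:}\quad \mathcal D=\int_\Omega 2\eta|D(\boldsymbol u)|^2+\int_\Omega\sigma^{-1}|\boldsymbol J|^2 .$$ "Sufficiently smooth" may be read as: jointly in space and time, $d$ is $C^3$ near $\Gamma$, $\boldsymbol u$ and $\mu$ are $C^2$, and $p,\boldsymbol J,\phi$ are $C^1$ up to the boundary of each phase. -/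

import Mathlib

open Set Filter Topology MeasureTheory
open scoped InnerProductSpace NNReal Laplacian

noncomputable section

namespace SharpInterface

/-- Euclidean `n`-space; space-time is `ℝ × E n`, time first. -/
abbrev E (n : ℕ) : Type := EuclideanSpace ℝ (Fin n)

/-! ### Vector calculus -/

/-- The partial derivative `∂ⱼ f` of a scalar or vector field. -/
def partialD {n : ℕ} {F : Type*} [NormedAddCommGroup F] [NormedSpace ℝ F]
    (j : Fin n) (f : E n → F) (x : E n) : F :=
  fderiv ℝ f x (EuclideanSpace.single j 1)

/-- `div v`. -/
def div {n : ℕ} (v : E n → E n) (x : E n) : ℝ := ∑ i, partialD i v x i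

/-- The strain tensor `D(v) = (∇v + ∇vᵀ)/2`. -/
def strain {n : ℕ} (v : E n → E n) (x : E n) : Matrix (Fin n) (Fin n) ℝ :=
  Matrix.of fun i j => (partialD j v x i + partialD i v x j) / 2

/-- `|D(v)|² = ∑ᵢⱼ D(v)ᵢⱼ²`. -/
def strainSq {n : ℕ} (v : E n → E n) (x : E n) : ℝ := ∑ i, ∑ j, strain v x i j ^ 2

/-- `D(v) w`. -/
def strainApply {n : ℕ} (v : E n → E n) (x w : E n) : E n :=
  WithLp.toLp 2 fun i => ∑ j, strain v x i j * w j

/-- The row-wise divergence `div D(v)`. -/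
def divStrain {n : ℕ} (v : E n → E n) (x : E n) : E n :=
  WithLp.toLp 2 fun i => ∑ j, partialD j (fun y => strain v y i j) x

/-- A vector of `ℝ²` or `ℝ³` as a vector of `ℝ³` (planar vectors get third component `0`). -/
def toSpace {n : ℕ} (v : E n) : Fin 3 → ℝ :=
  fun k => if h : k.val < n then v ⟨k.val, h⟩ else 0

/-- The cross product `v × B` with a magnetic field vector `B ∈ ℝ³`. For `n = 3` this is the usual
cross product. For `n = 2`, `v` is the planar vector `(v₁, v₂, 0)` and the result is the planar part
of `v × B`; for a field `B = (0, 0, b)` perpendicular to the plane, as is customary for planar flow,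
this is all of `v × B`. -/
def crossB {n : ℕ} (v : E n) (B : Fin 3 → ℝ) : E n :=
  WithLp.toLp 2 fun i =>
    if h : i.val < 3 then crossProduct (toSpace v) B ⟨i.val, h⟩ else 0

/-! ### Lipschitz domains -/

/-- A bounded domain with Lipschitz boundary: near each boundary point, and for a suitable unit
vector `e`, the set is the part strictly below the graph (in direction `e`) of a Lipschitz function
of the component of `x` orthogonal to `e`. -/
structure IsBoundedLipschitzDomain {n : ℕ} (Ω : Set (E n)) : Prop where
  isOpen : IsOpen Ω
  isConnected : IsConnected Ω
  isBounded : Bornology.IsBounded Ω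
  lipschitz : ∀ x₀ ∈ frontier Ω, ∃ (e : E n) (K : ℝ≥0) (g : E n → ℝ),
    ‖e‖ = 1 ∧ LipschitzWith K g ∧
      ∀ᶠ x in 𝓝 x₀, (x ∈ Ω ↔ ⟪e, x⟫_ℝ < g (x - ⟪e, x⟫_ℝ • e))

/-- `m` is the outer unit normal of `Ω` at the boundary point `x`: to first order at `x`, the set
`Ω` is the half-space `{x + h | ⟪m, h⟫ < 0}`. For a local Lipschitz graph it exists exactly where
the graph function is differentiable, hence at almost every boundary point. -/
def IsOuterUnitNormal {n : ℕ} (Ω : Set (E n)) (x m : E n) : Prop :=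
  x ∈ frontier Ω ∧ ‖m‖ = 1 ∧ ∀ ε > 0, ∀ᶠ h in 𝓝 (0 : E n),
    (⟪m, h⟫_ℝ < -(ε * ‖h‖) → x + h ∈ Ω) ∧ (ε * ‖h‖ < ⟪m, h⟫_ℝ → x + h ∉ Ω)

/-! ### The evolving interface -/

/-- The signed distance to the boundary of `A`, positive inside `A`. -/
def signedDistance {n : ℕ} (A : Set (E n)) (x : E n) : ℝ :=
  open Classical in
  if x ∈ A then Metric.infDist x (frontier A) else -Metric.infDist x (frontier A)

/-- The interface `Γ(t)`, the boundary of `Ω₊(t)`. -/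
def interface {n : ℕ} (Ωp : ℝ → Set (E n)) (t : ℝ) : Set (E n) := frontier (Ωp t)

/-- The unit normal `ν = ∇d` of `Γ(t)`, pointing into `Ω₊(t)`. -/
def normal {n : ℕ} (Ωp : ℝ → Set (E n)) (t : ℝ) (x : E n) : E n :=
  gradient (signedDistance (Ωp t)) x

/-- The mean curvature `κ = -div ν` of `Γ(t)`. -/
def curvature {n : ℕ} (Ωp : ℝ → Set (E n)) (t : ℝ) (x : E n) : ℝ :=
  -div (normal Ωp t) x

/-- The normal velocity `V = -∂ₜd` of the interface, in direction `ν`. -/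
def normalVelocity {n : ℕ} (Ωp : ℝ → Set (E n)) (t : ℝ) (x : E n) : ℝ :=
  -deriv (fun τ => signedDistance (Ωp τ) x) t

/-- For `0 < t < T`, `Γ(t) = ∂Ω₊(t)` is a closed hypersurface in `Ω` which encloses `Ω₊(t)` and
evolves smoothly: the signed distance is `C³` in space-time near every point of the interface, and
`Ω₊(t)` and the complement of its closure sweep out open sets in space-time, so that no part of the
interface appears, disappears or jumps. -/
structure IsEvolvingInterface {n : ℕ} (Ω : Set (E n)) (T : ℝ) (Ωp : ℝ → Set (E n)) : Prop where
  inside : ∀ t ∈ Ioo 0 T, closure (Ωp t) ⊆ Ω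
  isOpen_inner : IsOpen {q : ℝ × E n | q.1 ∈ Ioo 0 T ∧ q.2 ∈ Ωp q.1}
  isOpen_outer : IsOpen {q : ℝ × E n | q.1 ∈ Ioo 0 T ∧ q.2 ∉ closure (Ωp q.1)}
  smooth : ∀ t ∈ Ioo 0 T, ∀ x ∈ interface Ωp t,
    ContDiffAt ℝ 3 (fun q : ℝ × E n => signedDistance (Ωp q.1) q.2) (t, x)

/-! ### The two-phase system -/

inductive Phase where
  | plus
  | minus

/-- The region `Ω₊(t)` or `Ω₋(t) = Ω \ (Ω₊(t) ∪ Γ(t))` of a phase. -/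
def region {n : ℕ} (Ω : Set (E n)) (Ωp : ℝ → Set (E n)) (t : ℝ) : Phase → Set (E n)
  | .plus => Ωp t
  | .minus => Ω \ closure (Ωp t)

/-- `f` is `Cᵏ` in space-time up to the boundary of phase `s`. -/
def SmoothUpTo {n : ℕ} {F : Type*} [NormedAddCommGroup F] [NormedSpace ℝ F] (k : ℕ)
    (Ω : Set (E n)) (T : ℝ) (Ωp : ℝ → Set (E n)) (s : Phase) (f : ℝ → E n → F) : Prop :=
  ∀ t ∈ Ioo 0 T, ∀ x ∈ closure (region Ω Ωp t s),
    ContDiffAt ℝ k (fun q : ℝ × E n => f q.1 q.2) (t, x)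

/-- Velocity, pressure, current density and electric potential. For each phase `s` the restriction
of a field to that phase is a function of its own, used only on the closure of the phase; its values
on the interface are the one-sided traces. -/
structure Fields (n : ℕ) where
  u : Phase → ℝ → E n → E n
  p : Phase → ℝ → E n → ℝ
  J : Phase → ℝ → E n → E n
  φ : Phase → ℝ → E n → ℝ

/-- The traction `2 η D(u) ν - p ν` on the interface, from the side of phase `s`. -/
def traction {n : ℕ} (η : Phase → ℝ) (Ωp : ℝ → Set (E n)) (w : Fields n) (s : Phase)
    (t : ℝ) (x : E n) : E n :=
  (2 * η s) • strainApply (w.u s t) x (normal Ωp t x) - w.p s t x • normal Ωp t x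

/-- The part of the sharp-interface system which is common to all mobilities: two-phase
inductionless magnetohydrodynamics in the bulk, the interface conditions for `u, p, J, φ`, and the
boundary conditions on `∂Ω`. -/
structure IsTwoPhaseMHD {n : ℕ} (Ω : Set (E n)) (T : ℝ) (η σ : Phase → ℝ) (lam : ℝ)
    (B : ℝ → E n → Fin 3 → ℝ) (Ωp : ℝ → Set (E n)) (w : Fields n) : Prop where
  smooth_u : ∀ s, SmoothUpTo 2 Ω T Ωp s (w.u s)
  smooth_p : ∀ s, SmoothUpTo 1 Ω T Ωp s (w.p s)
  smooth_J : ∀ s, SmoothUpTo 1 Ω T Ωp s (w.J s)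
  smooth_φ : ∀ s, SmoothUpTo 1 Ω T Ωp s (w.φ s)
  momentum : ∀ s, ∀ t ∈ Ioo 0 T, ∀ x ∈ region Ω Ωp t s,
    deriv (fun τ => w.u s τ x) t + fderiv ℝ (w.u s t) x (w.u s t x)
      - (2 * η s) • divStrain (w.u s t) x + gradient (w.p s t) x
      - crossB (w.J s t x) (B t x) = 0
  div_u : ∀ s, ∀ t ∈ Ioo 0 T, ∀ x ∈ region Ω Ωp t s, div (w.u s t) x = 0
  ohm : ∀ s, ∀ t ∈ Ioo 0 T, ∀ x ∈ region Ω Ωp t s,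
    (σ s)⁻¹ • w.J s t x + gradient (w.φ s t) x - crossB (w.u s t x) (B t x) = 0
  div_J : ∀ s, ∀ t ∈ Ioo 0 T, ∀ x ∈ region Ω Ωp t s, div (w.J s t) x = 0
  jump_stress : ∀ t ∈ Ioo 0 T, ∀ x ∈ interface Ωp t,
    traction η Ωp w .plus t x - traction η Ωp w .minus t x
      = -((lam * curvature Ωp t x) • normal Ωp t x)
  jump_u : ∀ t ∈ Ioo 0 T, ∀ x ∈ interface Ωp t, w.u .plus t x = w.u .minus t x
  jump_J : ∀ t ∈ Ioo 0 T, ∀ x ∈ interface Ωp t,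
    ⟪w.J .plus t x, normal Ωp t x⟫_ℝ = ⟪w.J .minus t x, normal Ωp t x⟫_ℝ
  jump_φ : ∀ t ∈ Ioo 0 T, ∀ x ∈ interface Ωp t, w.φ .plus t x = w.φ .minus t x
  no_slip : ∀ t ∈ Ioo 0 T, ∀ x ∈ frontier Ω, w.u .minus t x = 0
  insulating : ∀ t ∈ Ioo 0 T, ∀ x m, IsOuterUnitNormal Ω x m → ⟪w.J .minus t x, m⟫_ℝ = 0

/-- Constant mobility: a harmonic chemical potential `μ`, the Stefan-type condition
`2 (-V + u · ν) = m₀ [∇μ] · ν`, the Gibbs-Thomson condition `2 μ = λ κ` (for both one-sided traces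
of `μ`) and the no-flux condition on `∂Ω`. -/
structure IsStefanInterface {n : ℕ} (Ω : Set (E n)) (T m₀ lam : ℝ) (Ωp : ℝ → Set (E n))
    (w : Fields n) (μ : Phase → ℝ → E n → ℝ) : Prop where
  smooth_μ : ∀ s, SmoothUpTo 2 Ω T Ωp s (μ s)
  harmonic : ∀ s, ∀ t ∈ Ioo 0 T, ∀ x ∈ region Ω Ωp t s, Δ (μ s t) x = 0
  stefan : ∀ s, ∀ t ∈ Ioo 0 T, ∀ x ∈ interface Ωp t,
    2 * (-normalVelocity Ωp t x + ⟪w.u s t x, normal Ωp t x⟫_ℝ)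
      = m₀ * ⟪gradient (μ .plus t) x - gradient (μ .minus t) x, normal Ωp t x⟫_ℝ
  gibbs_thomson : ∀ s, ∀ t ∈ Ioo 0 T, ∀ x ∈ interface Ωp t,
    2 * μ s t x = lam * curvature Ωp t x
  no_flux : ∀ t ∈ Ioo 0 T, ∀ x m, IsOuterUnitNormal Ω x m →
    ⟪gradient (μ .minus t) x, m⟫_ℝ = 0

/-- Vanishing or degenerate mobility: the interface is material, `V = u · ν`. -/
def IsMaterialInterface {n : ℕ} (T : ℝ) (Ωp : ℝ → Set (E n)) (w : Fields n) : Prop :=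
  ∀ s, ∀ t ∈ Ioo 0 T, ∀ x ∈ interface Ωp t,
    normalVelocity Ωp t x = ⟪w.u s t x, normal Ωp t x⟫_ℝ

/-! ### Energy and dissipation -/

/-- `∫_Ω f`, for `f` given separately in each phase (the interface is a null set). -/
def phaseIntegral {n : ℕ} (Ω : Set (E n)) (Ωp : ℝ → Set (E n)) (t : ℝ)
    (f : Phase → E n → ℝ) : ℝ :=
  (∫ x in region Ω Ωp t .plus, f .plus x) + ∫ x in region Ω Ωp t .minus, f .minus x

/-- `f` is integrable over each phase. -/
def PhaseIntegrable {n : ℕ} (Ω : Set (E n)) (Ωp : ℝ → Set (E n)) (t : ℝ)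
    (f : Phase → E n → ℝ) : Prop :=
  ∀ s, IntegrableOn (f s) (region Ω Ωp t s)

/-- The kinetic energy density `|u|²/2`. -/
def kineticDensity {n : ℕ} (w : Fields n) (t : ℝ) (s : Phase) (x : E n) : ℝ :=
  1 / 2 * ‖w.u s t x‖ ^ 2

/-- The viscous dissipation density `2 η |D(u)|²`. -/
def viscousDensity {n : ℕ} (η : Phase → ℝ) (w : Fields n) (t : ℝ) (s : Phase) (x : E n) : ℝ :=
  2 * η s * strainSq (w.u s t) x

/-- The Ohmic dissipation density `σ⁻¹ |J|²`. -/
def ohmicDensity {n : ℕ} (σ : Phase → ℝ) (w : Fields n) (t : ℝ) (s : Phase) (x : E n) : ℝ :=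
  (σ s)⁻¹ * ‖w.J s t x‖ ^ 2

/-- The diffusive dissipation density `m₀ |∇μ|²`. -/
def diffusiveDensity {n : ℕ} (m₀ : ℝ) (μ : Phase → ℝ → E n → ℝ) (t : ℝ) (s : Phase)
    (x : E n) : ℝ :=
  m₀ * ‖gradient (μ s t) x‖ ^ 2

/-- The total energy `∫_Ω |u|²/2 + ∫_Γ λ`, with the `(n-1)`-dimensional surface measure on `Γ`. -/
def energy {n : ℕ} (Ω : Set (E n)) (lam : ℝ) (Ωp : ℝ → Set (E n)) (w : Fields n) (t : ℝ) : ℝ :=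
  phaseIntegral Ω Ωp t (kineticDensity w t) + ∫ _x in interface Ωp t, lam ∂μHE[n - 1]

/-- The quantities in the energy and in the viscous and Ohmic dissipation are finite at time `t`. -/
def FiniteEnergy {n : ℕ} (Ω : Set (E n)) (η σ : Phase → ℝ) (Ωp : ℝ → Set (E n))
    (w : Fields n) (t : ℝ) : Prop :=
  PhaseIntegrable Ω Ωp t (kineticDensity w t) ∧ μHE[n - 1] (interface Ωp t) < ⊤ ∧
    PhaseIntegrable Ω Ωp t (viscousDensity η w t) ∧ PhaseIntegrable Ω Ωp t (ohmicDensity σ w t)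

/-- The viscous and Ohmic dissipation `∫_Ω 2 η |D(u)|² + ∫_Ω σ⁻¹ |J|²`. -/
def dissipation {n : ℕ} (Ω : Set (E n)) (η σ : Phase → ℝ) (Ωp : ℝ → Set (E n))
    (w : Fields n) (t : ℝ) : ℝ :=
  phaseIntegral Ω Ωp t (viscousDensity η w t) + phaseIntegral Ω Ωp t (ohmicDensity σ w t)

end SharpInterface

end

open Set Filter Topology MeasureTheory
open scoped InnerProductSpace NNReal Laplacian

noncomputable section

namespace SharpInterface

section

/-! ### Cutoff functions and partitions of unity -/

/-! Test the momentum equation with u and Ohm's law with J. The Lorentz terms cancel because (J ×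
B)·u = -(u × B)·J, and in each phase u·∂ₜu + 2η|D(u)|² + σ⁻¹|J|² is the divergence of the flux
2ηD(u)u - pu - φJ - ½|u|²u. The normal component of this flux vanishes on Σ and jumps by -λκ u·ν
across Γ. Since u is continuous across Γ, the motion of Γ adds nothing to the derivative of the
kinetic energy, which is therefore minus the dissipation plus ∫_Γ λκ u·ν. The area changes at the
rate -∫_Γ κV, so ∫_Γ λκ(u·ν - V) is left over. It is zero for a material interface. In the Stefan
case 2μ = λκ and the Stefan condition make it ∫_Γ m₀μ[∇μ]·ν, which is -∫ m₀|∇μ|² because μ is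
harmonic.

Apart from the area itself, no surface integral is formed. A density g on Γ is represented by a C¹
field Y, supported near Γ, with Y·ν = g on Γ. As ν points into Ω₊, the volume integral ∫_{Ω₊} div Y
plays the role of -∫_Γ g. It depends only on g, because fields tangential to Γ have divergence of
integral zero (`IsEvolvingInterface.integral_div_eq_zero`). That fact and its analogue on the
Lipschitz domain (`integral_div_lipschitzDomain_eq_zero`) both come from
`integral_div_superlevel_eq_zero`, a divergence theorem without flux on {ρ > 0} for Lipschitz ρ.

Two phases are reduced to one domain by gluing. The field of each phase is smooth on a neighbourhood
of the closed phase, so the cut-off difference of the two fields near Γ can be subtracted from the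
inner one. The glued field is smooth on the closure of Ω, and the correction lives in Ω₊ near Γ.
This gives `IsEvolvingInterface.phaseIntegral_div` and, in space-time,
`IsEvolvingInterface.hasDerivAt_phaseIntegral`.

The Hausdorff measure enters through `lintegral_levelSet`: where |∇ρ| = 1, the surface integral of ζ
over {ρ = 0} is -∫_{ρ>0} div(ζ∇ρ). Both sides are limits of integrals over thin layers 0 < ρ < ε,
compared through almost isometric charts that straighten the level set. The area of Γ(t) thus
becomes a volume integral over Ω₊(t). The transport theorem
`IsEvolvingInterface.hasDerivAt_integral` differentiates it, and the eikonal equation |∇d| = 1 turns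
the result into the flux of a field v with v·ν = κV on Γ. -/

theorem contDiff_of_contDiffAt_tsupport {V F : Type*} [NormedAddCommGroup V] [NormedSpace ℝ V]
    [NormedAddCommGroup F] [NormedSpace ℝ F] {k : WithTop ℕ∞} {f : V → F}
    (h : ∀ x ∈ tsupport f, ContDiffAt ℝ k f x) : ContDiff ℝ k f := by
  rw [contDiff_iff_contDiffAt]
  intro x
  by_cases hx : x ∈ tsupport f
  · exact h x hx
  · exact contDiffAt_const.congr_of_eventuallyEq (notMem_tsupport_iff_eventuallyEq.1 hx)

/-- Being one on a neighbourhood of each point of `K`, not merely on `K`, makes the derivatives of a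
cut-off function agree there with those of the original. -/
theorem exists_cutoff {V : Type*} [NormedAddCommGroup V] [NormedSpace ℝ V]
    [FiniteDimensional ℝ V] {K O : Set V} (hK : IsCompact K) (hO : IsOpen O) (hKO : K ⊆ O) :
    ∃ θ : V → ℝ, ContDiff ℝ (⊤ : ℕ∞) θ ∧ HasCompactSupport θ ∧ tsupport θ ⊆ O ∧
      (∀ x ∈ K, ∀ᶠ y in 𝓝 x, θ y = 1) ∧ ∀ x, θ x ∈ Icc (0 : ℝ) 1 := by
  obtain ⟨L, hL, hKL, hLO⟩ := exists_compact_between hK hO hKO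
  obtain ⟨f, h1, h0, h01⟩ := exists_contMDiffMap_one_nhds_of_subset_interior (n := ⊤)
    (modelWithCornersSelf ℝ V) hK.isClosed hKL
  have hsub : tsupport f ⊆ L := closure_minimal
    (fun x hx => by by_contra hxL; exact hx (h0 x hxL)) hL.isClosed
  refine ⟨f, f.contMDiff.contDiff, ?_, hsub.trans hLO, ?_, h01⟩
  · exact hL.of_isClosed_subset (isClosed_tsupport _) hsub
  · intro x hx
    exact (Filter.Eventually.filter_mono (nhds_le_nhdsSet hx) h1)

/-- Indexing by the points of `K` lets neighbourhoods chosen point by point be used directly. The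
finite set consists of the indices whose function does not vanish identically on `K`. -/
theorem exists_partition {V : Type*} [NormedAddCommGroup V] [NormedSpace ℝ V]
    [FiniteDimensional ℝ V] {K : Set V} (hK : IsCompact K) (U : K → Set V)
    (hU : ∀ x : K, U x ∈ 𝓝 (x : V)) :
    ∃ (s : Finset K) (ζ : K → V → ℝ), (∀ i, ContDiff ℝ (⊤ : ℕ∞) (ζ i)) ∧
      (∀ i, tsupport (ζ i) ⊆ U i) ∧ (∀ i x, 0 ≤ ζ i x) ∧ ∀ x ∈ K, ∑ i ∈ s, ζ i x = 1 := by
  obtain ⟨f, hf⟩ := SmoothPartitionOfUnity.exists_isSubordinate (modelWithCornersSelf ℝ V)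
    hK.isClosed (fun i : K => interior (U i)) (fun i => isOpen_interior)
    (fun x hx => mem_iUnion.2 ⟨⟨x, hx⟩, mem_interior_iff_mem_nhds.2 (hU ⟨x, hx⟩)⟩)
  have hfin := f.locallyFinite.finite_nonempty_inter_compact hK
  refine ⟨hfin.toFinset, fun i => f i, fun i => (f i).contMDiff.contDiff,
    fun i => (hf i).trans interior_subset, fun i x => f.nonneg i x, fun x hx => ?_⟩
  · refine f.sum_finsupport' x hx fun i hi => ?_
    rw [SmoothPartitionOfUnity.mem_finsupport] at hi
    simp only [Finite.mem_toFinset, mem_ofPred_eq]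
    exact ⟨x, hi, hx⟩

/-! ### Divergence of products -/

variable {n : ℕ}

theorem eq_sum_single (v : E n) : v = ∑ i, v i • EuclideanSpace.single i (1 : ℝ) := by
  ext j
  simp [Finset.sum_apply, Pi.single_apply]

theorem fderiv_apply_eq_sum {F : Type*} [NormedAddCommGroup F] [NormedSpace ℝ F]
    (f : E n → F) (x v : E n) : fderiv ℝ f x v = ∑ i, v i • partialD i f x := by
  conv_lhs => rw [eq_sum_single v]
  simp [partialD]

theorem partialD_apply {v : E n → E n} {x : E n} (hv : DifferentiableAt ℝ v x) (i j : Fin n) :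
    partialD i v x j = partialD i (fun y => v y j) x := by
  have h := ((EuclideanSpace.proj (𝕜 := ℝ) j).hasFDerivAt (x := v x)).comp x hv.hasFDerivAt
  have h' : HasFDerivAt (fun y => v y j)
    ((EuclideanSpace.proj (𝕜 := ℝ) j : E n →L[ℝ] ℝ).comp (fderiv ℝ v x)) x := h
  simp [partialD, h'.fderiv]

theorem div_eq_sum {v : E n → E n} {x : E n} (hv : DifferentiableAt ℝ v x) :
    div v x = ∑ i, partialD i (fun y => v y i) x :=
  Finset.sum_congr rfl fun i _ => partialD_apply hv i i

theorem partialD_mul {f g : E n → ℝ} {x : E n} (hf : DifferentiableAt ℝ f x)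
    (hg : DifferentiableAt ℝ g x) (i : Fin n) :
    partialD i (fun y => f y * g y) x = f x * partialD i g x + partialD i f x * g x := by
  simp only [partialD]
  rw [fderiv_fun_mul hf hg]
  simp [mul_comm]

theorem partialD_add {F : Type*} [NormedAddCommGroup F] [NormedSpace ℝ F] {f g : E n → F}
    {x : E n} (hf : DifferentiableAt ℝ f x)
    (hg : DifferentiableAt ℝ g x) (i : Fin n) :
    partialD i (fun y => f y + g y) x = partialD i f x + partialD i g x := by
  simp only [partialD]
  rw [fderiv_fun_add hf hg]
  simp

theorem partialD_sub {F : Type*} [NormedAddCommGroup F] [NormedSpace ℝ F] {f g : E n → F}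
    {x : E n} (hf : DifferentiableAt ℝ f x)
    (hg : DifferentiableAt ℝ g x) (i : Fin n) :
    partialD i (fun y => f y - g y) x = partialD i f x - partialD i g x := by
  simp only [partialD]
  rw [fderiv_fun_sub hf hg]
  simp

theorem partialD_sum {ι : Type*} {s : Finset ι} {f : ι → E n → ℝ} {x : E n}
    (hf : ∀ j ∈ s, DifferentiableAt ℝ (f j) x) (i : Fin n) :
    partialD i (fun y => ∑ j ∈ s, f j y) x = ∑ j ∈ s, partialD i (f j) x := by
  simp only [partialD]
  rw [fderiv_fun_sum hf]
  simp

theorem div_add {v w : E n → E n} {x : E n} (hv : DifferentiableAt ℝ v x)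
    (hw : DifferentiableAt ℝ w x) : div (fun y => v y + w y) x = div v x + div w x := by
  simp only [div, partialD_add hv hw, PiLp.add_apply, Finset.sum_add_distrib]

theorem div_sub {v w : E n → E n} {x : E n} (hv : DifferentiableAt ℝ v x)
    (hw : DifferentiableAt ℝ w x) : div (fun y => v y - w y) x = div v x - div w x := by
  simp only [div, partialD_sub hv hw, PiLp.sub_apply, Finset.sum_sub_distrib]

theorem div_smul {f : E n → ℝ} {v : E n → E n} {x : E n} (hf : DifferentiableAt ℝ f x)
    (hv : DifferentiableAt ℝ v x) :
    div (fun y => f y • v y) x = f x * div v x + fderiv ℝ f x (v x) := by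
  rw [fderiv_apply_eq_sum]
  simp only [div, partialD]
  rw [fderiv_fun_smul hf hv, Finset.mul_sum, ← Finset.sum_add_distrib]
  simp [mul_comm]

theorem div_congr {v w : E n → E n} {x : E n} (h : v =ᶠ[𝓝 x] w) : div v x = div w x := by
  simp only [div, partialD, h.fderiv_eq]

theorem div_eq_zero_of_notMem_tsupport {v : E n → E n} {x : E n} (h : x ∉ tsupport v) :
    div v x = 0 := by
  rw [div_congr (notMem_tsupport_iff_eventuallyEq.1 h)]
  simp [div, partialD]

theorem continuousAt_partialD {F : Type*} [NormedAddCommGroup F] [NormedSpace ℝ F] {f : E n → F}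
    {x : E n} (hf : ContDiffAt ℝ 1 f x) (i : Fin n) : ContinuousAt (partialD i f) x :=
  (hf.continuousAt_fderiv (by norm_num)).clm_apply continuousAt_const

theorem contDiffAt_partialD {F : Type*} [NormedAddCommGroup F] [NormedSpace ℝ F] {f : E n → F}
    {x : E n} {k : ℕ} (hf : ContDiffAt ℝ (k + 1 : ℕ) f x) (i : Fin n) :
    ContDiffAt ℝ k (partialD i f) x :=
  (hf.fderiv_right (by norm_cast)).clm_apply contDiffAt_const

theorem continuousAt_div {v : E n → E n} {x : E n} (hv : ContDiffAt ℝ 1 v x) :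
    ContinuousAt (div v) x := by
  refine tendsto_finsetSum _ fun i _ => ?_
  exact ((EuclideanSpace.proj (𝕜 := ℝ) i).continuous.continuousAt).comp (continuousAt_partialD hv i)

theorem contDiffAt_coord {V : Type*} [NormedAddCommGroup V] [NormedSpace ℝ V] {k : WithTop ℕ∞}
    {v : V → E n} {x : V} (hv : ContDiffAt ℝ k v x) (i : Fin n) :
    ContDiffAt ℝ k (fun y => v y i) x :=
  (contDiffAt_piLp (p := 2)).1 hv i

theorem hasCompactSupport_div {v : E n → E n} (h : HasCompactSupport v) :
    HasCompactSupport (div v) :=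
  HasCompactSupport.intro' h (isClosed_tsupport v)
    fun _ hx => div_eq_zero_of_notMem_tsupport hx

theorem integrable_div {v : E n → E n} (hv : ContDiff ℝ 1 v) (h : HasCompactSupport v) :
    Integrable (div v) :=
  (continuous_iff_continuousAt.2 fun _ =>
    continuousAt_div hv.contDiffAt).integrable_of_hasCompactSupport (hasCompactSupport_div h)

/-- Integration by parts of a Lipschitz function against a compactly supported field. -/
theorem integral_lipschitz_mul_div {f : E n → ℝ} {C : ℝ≥0} (hf : LipschitzWith C f)
    {v : E n → E n} (hv : ContDiff ℝ 1 v) (h : HasCompactSupport v) :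
    ∫ x, f x * div v x = -∫ x, fderiv ℝ f x (v x) := by
  have hvi : ∀ i, ContDiff ℝ 1 (fun y => v y i) := fun i =>
    contDiff_iff_contDiffAt.2 fun _ => contDiffAt_coord hv.contDiffAt i
  have hci : ∀ i, HasCompactSupport (fun y => v y i) := fun i =>
    HasCompactSupport.intro' h (isClosed_tsupport v) fun _ hx => by
      simp [image_eq_zero_of_notMem_tsupport hx]
  have key : ∀ i, ∫ x, f x * partialD i (fun y => v y i) x
      = -∫ x, lineDeriv ℝ f x (EuclideanSpace.single i 1) * v x i := by
    intro i
    obtain ⟨D, hD⟩ := ContDiff.lipschitzWith_of_hasCompactSupport (hci i) (hvi i) (by norm_num)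
    -- Integration by parts for two Lipschitz functions moves the derivative to `v` in the reversed
    -- direction, which accounts for the sign.
    rw [hf.integral_lineDeriv_mul_eq hD (hci i), ← integral_neg]
    refine integral_congr_ae (Eventually.of_forall fun x => ?_)
    have hd : DifferentiableAt ℝ (fun y => v y i) x := (hvi i).differentiable (by norm_num) x
    simp only [hd.lineDeriv_eq_fderiv, partialD, map_neg]
    ring
  have hint : ∀ i, Integrable fun x => lineDeriv ℝ f x (EuclideanSpace.single i 1) * v x i :=
    fun i => ((hvi i).continuous.integrable_of_hasCompactSupport (hci i)).bdd_mul
      (measurable_lineDeriv hf.continuous).aestronglyMeasurable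
      (Eventually.of_forall fun _ => norm_lineDeriv_le_of_lipschitz ℝ hf)
  have hint' : ∀ i, Integrable fun x => f x * partialD i (fun y => v y i) x := fun i =>
    ((hf.continuous.mul (continuous_iff_continuousAt.2 fun x => continuousAt_partialD
      (hvi i).contDiffAt i))).integrable_of_hasCompactSupport
      (((hci i).fderiv_apply (𝕜 := ℝ) _).mul_left)
  calc ∫ x, f x * div v x = ∫ x, ∑ i, f x * partialD i (fun y => v y i) x := by
        congr 1; ext x; rw [div_eq_sum (hv.differentiable (by norm_num) x), Finset.mul_sum]
    _ = -∫ x, ∑ i, lineDeriv ℝ f x (EuclideanSpace.single i 1) * v x i := by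
        rw [integral_finsetSum _ fun i _ => hint' i, integral_finsetSum _ fun i _ => hint i,
          ← Finset.sum_neg_distrib]
        exact Finset.sum_congr rfl fun i _ => key i
    _ = _ := by
        congr 1
        refine integral_congr_ae ?_
        -- By Rademacher's theorem the line derivatives assemble into a Fréchet derivative almost
        -- everywhere.
        filter_upwards [hf.ae_differentiableAt] with x hx
        rw [fderiv_apply_eq_sum]
        refine Finset.sum_congr rfl fun i _ => ?_
        rw [hx.lineDeriv_eq_fderiv, partialD, smul_eq_mul, mul_comm]

theorem integral_div_eq_zero {v : E n → E n} (hv : ContDiff ℝ 1 v) (h : HasCompactSupport v) :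
    ∫ x, div v x = 0 := by
  have := integral_lipschitz_mul_div (LipschitzWith.const (α := E n) (1 : ℝ)) hv h
  simpa using this


end

section

/-! ### Smooth steps -/

/-- A smooth step from `0` (for `s ≤ 0`) to `1` (for `s ≥ ε`). -/
def step (ε s : ℝ) : ℝ := Real.smoothTransition (s / ε)

theorem contDiff_step (ε : ℝ) (k : ℕ) : ContDiff ℝ k (step ε) :=
  (Real.smoothTransition.contDiff (n := k)).comp (contDiff_id.div_const ε)

theorem step_mem_Icc (ε s : ℝ) : step ε s ∈ Icc (0 : ℝ) 1 :=
  ⟨Real.smoothTransition.nonneg _, Real.smoothTransition.le_one _⟩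

theorem step_of_nonpos {ε s : ℝ} (hε : 0 < ε) (hs : s ≤ 0) : step ε s = 0 :=
  Real.smoothTransition.zero_of_nonpos (div_nonpos_of_nonpos_of_nonneg hs hε.le)

theorem step_of_le {ε s : ℝ} (hε : 0 < ε) (hs : ε ≤ s) : step ε s = 1 :=
  Real.smoothTransition.one_of_one_le ((one_le_div hε).2 hs)

theorem deriv_smoothTransition_of_notMem {s : ℝ} (hs : s ∉ Ioo (0 : ℝ) 1) :
    deriv Real.smoothTransition s = 0 := by
  have hc : Continuous (deriv Real.smoothTransition) :=
    (Real.smoothTransition.contDiff (n := 1)).continuous_deriv (by norm_num)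
  have h0 : ∀ s < (0 : ℝ), deriv Real.smoothTransition s = 0 := fun s hs => by
    have : Real.smoothTransition =ᶠ[𝓝 s] fun _ => 0 := by
      filter_upwards [gt_mem_nhds hs] with x hx using Real.smoothTransition.zero_of_nonpos hx.le
    rw [this.deriv_eq]; simp
  have h1 : ∀ s > (1 : ℝ), deriv Real.smoothTransition s = 0 := fun s hs => by
    have : Real.smoothTransition =ᶠ[𝓝 s] fun _ => 1 := by
      filter_upwards [lt_mem_nhds hs] with x hx using Real.smoothTransition.one_of_one_le hx.le
    rw [this.deriv_eq]; simp
  have hcl : IsClosed {s | deriv Real.smoothTransition s = 0} := isClosed_eq hc continuous_const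
  rw [mem_Ioo, not_and_or, not_lt, not_lt] at hs
  rcases hs with hs | hs
  · have := hcl.closure_subset_iff.2 (fun s (hs : s ∈ Iio (0 : ℝ)) => h0 s hs)
    rw [closure_Iio] at this
    exact this hs
  · have := hcl.closure_subset_iff.2 (fun s (hs : s ∈ Ioi (1 : ℝ)) => h1 s hs)
    rw [closure_Ioi] at this
    exact this hs

theorem exists_bound_deriv_smoothTransition :
    ∃ C : ℝ≥0, ∀ s, ‖deriv Real.smoothTransition s‖ ≤ C := by
  have hc : Continuous (deriv Real.smoothTransition) :=
    (Real.smoothTransition.contDiff (n := 1)).continuous_deriv (by norm_num)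
  obtain ⟨C, hC⟩ := (isCompact_Icc (a := (0 : ℝ)) (b := 1)).exists_bound_of_continuousOn
    hc.continuousOn
  refine ⟨C.toNNReal, fun s => ?_⟩
  by_cases hs : s ∈ Ioo (0 : ℝ) 1
  · exact (hC s (Ioo_subset_Icc_self hs)).trans (Real.le_coe_toNNReal C)
  · rw [deriv_smoothTransition_of_notMem hs]; simp

theorem deriv_smoothTransition_nonneg (s : ℝ) : 0 ≤ deriv Real.smoothTransition s :=
  Real.smoothTransition.monotone.deriv_nonneg

theorem hasDerivAt_step (ε s : ℝ) :
    HasDerivAt (step ε) (deriv Real.smoothTransition (s / ε) / ε) s := by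
  have h1 := ((Real.smoothTransition.contDiff (n := 1)).differentiable (by norm_num)
    (s / ε)).hasDerivAt
  have h2 : HasDerivAt (fun s : ℝ => s / ε) (1 / ε) s := (hasDerivAt_id s).div_const ε
  simpa [div_eq_mul_inv] using! h1.comp s h2

theorem lipschitzWith_step {ε : ℝ} (hε : 0 < ε) : ∃ C : ℝ≥0, LipschitzWith C (step ε) := by
  obtain ⟨C, hC⟩ := exists_bound_deriv_smoothTransition
  refine ⟨C / ε.toNNReal, lipschitzWith_of_nnnorm_deriv_le
    (fun s => (hasDerivAt_step ε s).differentiableAt) fun s => ?_⟩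
  rw [(hasDerivAt_step ε s).deriv, ← NNReal.coe_le_coe, coe_nnnorm, norm_div]
  push_cast
  rw [Real.coe_toNNReal _ hε.le, Real.norm_of_nonneg hε.le]
  gcongr
  exact hC _

theorem tendsto_step (s : ℝ) :
    Tendsto (fun ε => step ε s) (𝓝[>] 0) (𝓝 (if 0 < s then 1 else 0)) := by
  refine tendsto_const_nhds.congr' ?_
  split_ifs with h
  · filter_upwards [Ioo_mem_nhdsGT h] with ε hε using (step_of_le hε.1 hε.2.le).symm
  · filter_upwards [self_mem_nhdsWithin] with ε hε using (step_of_nonpos hε (not_lt.1 h)).symm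

variable {n : ℕ}

theorem tendsto_integral_step {ρ f : E n → ℝ} (hρ : AEStronglyMeasurable ρ) (hf : Integrable f) :
    Tendsto (fun ε => ∫ x, step ε (ρ x) * f x) (𝓝[>] 0)
      (𝓝 (∫ x, if 0 < ρ x then f x else 0)) := by
  refine tendsto_integral_filter_of_dominated_convergence (fun x => ‖f x‖) ?_ ?_ hf.norm ?_
  · refine Eventually.of_forall fun ε => ?_
    exact ((contDiff_step ε 0).continuous.comp_aestronglyMeasurable hρ).mul hf.aestronglyMeasurable
  · refine Eventually.of_forall fun ε => Eventually.of_forall fun x => ?_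
    rw [norm_mul, Real.norm_of_nonneg (step_mem_Icc _ _).1]
    exact mul_le_of_le_one_left (norm_nonneg _) (step_mem_Icc _ _).2
  · refine Eventually.of_forall fun x => ?_
    have := (tendsto_step (ρ x)).mul_const (f x)
    simpa [ite_mul] using this

/-! ### Divergence theorems with vanishing flux -/

/-- Integrate `div v` against the smooth step of ρ and integrate by parts. The kernel has size at
most M/ε and lives on 0 < ρ < ε, where |∇ρ·v| ≤ |C|ε. The integrand is thus bounded by M|C| on the
support of `v`, and it tends to zero pointwise, so dominated convergence applies. -/
theorem integral_div_superlevel_eq_zero {ρ : E n → ℝ} {K : ℝ≥0} (hρ : LipschitzWith K ρ)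
    {v : E n → E n} (hv : ContDiff ℝ 1 v) (hc : HasCompactSupport v) {C : ℝ}
    (h : ∀ᵐ x, 0 < ρ x → |fderiv ℝ ρ x (v x)| ≤ C * ρ x) :
    ∫ x in {x | 0 < ρ x}, div v x = 0 := by
  obtain ⟨M, hM⟩ := exists_bound_deriv_smoothTransition
  have hlim := tendsto_integral_step hρ.continuous.aestronglyMeasurable (integrable_div hv hc)
  have hmeas : MeasurableSet {x | 0 < ρ x} :=
    measurableSet_lt measurable_const hρ.continuous.measurable
  have hset : ∫ x in {x | 0 < ρ x}, div v x = ∫ x, if 0 < ρ x then div v x else 0 := by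
    rw [← integral_indicator hmeas]
    rfl
  rw [hset]
  refine tendsto_nhds_unique hlim ?_
  have hzero : Tendsto (fun ε => ∫ x, -fderiv ℝ (fun y => step ε (ρ y)) x (v x)) (𝓝[>] 0)
      (𝓝 (∫ _x : E n, (0 : ℝ))) := by
    refine tendsto_integral_filter_of_dominated_convergence
      ((tsupport v).indicator fun _ => M * |C|) ?_ ?_ ?_ ?_
    · refine Eventually.of_forall fun ε => ?_
      have h1 : Continuous fun y => step ε (ρ y) :=
        (contDiff_step ε 0).continuous.comp hρ.continuous
      have h2 : (fun x => -fderiv ℝ (fun y => step ε (ρ y)) x (v x))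
          = fun x => -∑ i, v x i * fderiv ℝ (fun y => step ε (ρ y)) x (EuclideanSpace.single i 1) := by
        ext x; rw [fderiv_apply_eq_sum]; rfl
      rw [h2]
      refine (Finset.measurable_sum _ fun i _ => ?_).neg.aestronglyMeasurable
      refine Measurable.mul ?_ (measurable_fderiv_apply_const ℝ _ _)
      exact ((EuclideanSpace.proj (𝕜 := ℝ) i).continuous.comp hv.continuous).measurable
    · filter_upwards [self_mem_nhdsWithin] with ε hε
      filter_upwards [h, hρ.ae_differentiableAt] with x hx hd
      have hε : 0 < ε := hε
      by_cases hxs : x ∈ tsupport v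
      · rw [indicator_of_mem hxs]
        have hD := (hasDerivAt_step ε (ρ x)).comp_hasFDerivAt x hd.hasFDerivAt
        have hD' : fderiv ℝ (fun y => step ε (ρ y)) x
          = (deriv Real.smoothTransition (ρ x / ε) / ε) • fderiv ℝ ρ x := hD.fderiv
        rw [hD', norm_neg, smul_apply, norm_smul]
        by_cases hr : ρ x / ε ∈ Ioo (0 : ℝ) 1
        · have hpos : 0 < ρ x := by
            have := mul_pos hr.1 hε
            rwa [div_mul_cancel₀ _ hε.ne'] at this
          have hle : ρ x ≤ ε := ((div_lt_one hε).1 hr.2).le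
          rw [norm_div, Real.norm_of_nonneg hε.le, Real.norm_eq_abs (fderiv ℝ ρ x (v x))]
          calc ‖deriv Real.smoothTransition (ρ x / ε)‖ / ε * |fderiv ℝ ρ x (v x)|
              ≤ M / ε * (|C| * ε) := by
                gcongr
                · exact hM _
                · exact (hx hpos).trans (mul_le_mul (le_abs_self C) hle hpos.le (abs_nonneg C))
            _ = M * |C| := by field_simp
        · rw [deriv_smoothTransition_of_notMem hr]
          simp only [zero_div, norm_zero, zero_mul]
          positivity
      · rw [indicator_of_notMem hxs, image_eq_zero_of_notMem_tsupport hxs]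
        simp
    · exact (integrable_indicator_iff hc.isCompact.measurableSet).2
        (integrableOn_const hc.isCompact.measure_lt_top.ne)
    · filter_upwards [h, hρ.ae_differentiableAt] with x hx hd
      refine tendsto_const_nhds.congr' ?_
      -- A fixed point leaves the layer 0 < ρ < ε once ε is small.
      have hev : ∀ᶠ ε in 𝓝[>] (0 : ℝ), ρ x / ε ∉ Ioo (0 : ℝ) 1 := by
        rcases le_or_gt (ρ x) 0 with h0 | h0
        · filter_upwards [self_mem_nhdsWithin] with ε hε hmem
          exact absurd hmem.1 (not_lt.2 (div_nonpos_of_nonpos_of_nonneg h0 (le_of_lt hε)))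
        · filter_upwards [Ioo_mem_nhdsGT h0] with ε hε hmem
          exact absurd hmem.2 (not_lt.2 ((one_le_div hε.1).2 hε.2.le))
      filter_upwards [hev] with ε hε
      have hD := (hasDerivAt_step ε (ρ x)).comp_hasFDerivAt x hd.hasFDerivAt
      have hD' : fderiv ℝ (fun y => step ε (ρ y)) x
        = (deriv Real.smoothTransition (ρ x / ε) / ε) • fderiv ℝ ρ x := hD.fderiv
      rw [hD', deriv_smoothTransition_of_notMem hε]
      simp
  simp only [integral_zero] at hzero
  refine hzero.congr' ?_
  filter_upwards [self_mem_nhdsWithin] with ε hε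
  obtain ⟨L, hL⟩ := lipschitzWith_step hε
  rw [integral_neg, ← integral_lipschitz_mul_div (f := fun y => step ε (ρ y)) (hL.comp hρ) hv hc]


end

section

variable {n : ℕ}

/-! ### The divergence theorem on bounded Lipschitz domains -/

theorem setIntegral_eq_integral_of_eq_zero {α : Type*} [MeasurableSpace α] {μ : Measure α}
    {s : Set α} {f : α → ℝ} (h : ∀ x ∉ s, f x = 0) : ∫ x in s, f x ∂μ = ∫ x, f x ∂μ :=
  setIntegral_eq_integral_of_forall_compl_eq_zero h

/-- With ρ(x) the height of the graph above `x`, locally Ω = {ρ > 0}. At almost every `x` the flux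
∇ρ(x)·v vanishes at the vertical projection of `x` to the graph, because ∇ρ(x) is normal to the
boundary there. As `v` is Lipschitz and the projection is at distance ρ(x), the flux at `x` itself
is O(ρ(x)). -/
theorem integral_div_graph_eq_zero {Ω : Set (E n)} (hΩ : IsOpen Ω) {e : E n} (he : ‖e‖ = 1)
    {K : ℝ≥0} {g : E n → ℝ} (hg : LipschitzWith K g) {B : Set (E n)} (hB : IsOpen B)
    (hΩB : ∀ x ∈ B, (x ∈ Ω ↔ ⟪e, x⟫_ℝ < g (x - ⟪e, x⟫_ℝ • e)))
    {v : E n → E n} (hv : ContDiff ℝ 1 v) (hc : HasCompactSupport v) (hvB : tsupport v ⊆ B)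
    (hn : ∀ x m, IsOuterUnitNormal Ω x m → ⟪v x, m⟫_ℝ = 0) :
    ∫ x in Ω, div v x = 0 := by
  set ρ : E n → ℝ := fun x => g (x - ⟪e, x⟫_ℝ • e) - ⟪e, x⟫_ℝ with hρdef
  have hlin : ∃ L : ℝ≥0, LipschitzWith L fun x : E n => x - ⟪e, x⟫_ℝ • e :=
    ⟨_, (ContinuousLinearMap.id ℝ (E n)
      - (innerSL ℝ e).smulRight e : E n →L[ℝ] E n).lipschitz⟩
  obtain ⟨L₁, hL₁⟩ := hlin
  obtain ⟨K', hρ⟩ : ∃ K', LipschitzWith K' ρ :=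
    ⟨_, (hg.comp hL₁).sub (innerSL ℝ e : E n →L[ℝ] ℝ).lipschitz⟩
  have hee : ⟪e, e⟫_ℝ = 1 := by rw [real_inner_self_eq_norm_sq, he]; norm_num
  have hshift : ∀ x (s : ℝ), ρ (x + s • e) = ρ x - s := by
    intro x s
    have h1 : ⟪e, x + s • e⟫_ℝ = ⟪e, x⟫_ℝ + s := by
      rw [inner_add_right, inner_smul_right, hee, mul_one]
    have h2 : x + s • e - (⟪e, x⟫_ℝ + s) • e = x - ⟪e, x⟫_ℝ • e := by
      rw [add_smul]; abel
    simp only [hρdef, h1, h2]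
    ring
  have hΩρ : ∀ x ∈ B, (x ∈ Ω ↔ 0 < ρ x) := fun x hx => by
    rw [hΩB x hx, hρdef]; simp
  obtain ⟨L, hL⟩ := hv.lipschitzWith_of_hasCompactSupport hc (by norm_num)
  have hset : ∫ x in Ω, div v x = ∫ x in {x | 0 < ρ x}, div v x := by
    rw [← integral_indicator hΩ.measurableSet,
      ← integral_indicator (measurableSet_lt measurable_const hρ.continuous.measurable)]
    congr 1
    ext x
    by_cases hx : x ∈ tsupport v
    · by_cases hxΩ : x ∈ Ω
      · rw [indicator_of_mem hxΩ, indicator_of_mem]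
        exact (hΩρ x (hvB hx)).1 hxΩ
      · rw [indicator_of_notMem hxΩ, indicator_of_notMem]
        exact fun h => hxΩ ((hΩρ x (hvB hx)).2 h)
    · simp only [indicator, div_eq_zero_of_notMem_tsupport hx, ite_self]
  rw [hset]
  refine integral_div_superlevel_eq_zero hρ hv hc (C := K' * L) ?_
  filter_upwards [hρ.ae_differentiableAt] with x hd hpos
  -- The vertical projection of `x` to the graph. Translation along `e` changes ρ by a constant, so
  -- ρ is differentiable at `y` with the same differential; the null set that Rademacher excludes in
  -- space causes no trouble on the surface.
  set y := x + ρ x • e with hy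
  have hρy : ρ y = 0 := by rw [hy, hshift, sub_self]
  have hdy : HasFDerivAt ρ (fderiv ℝ ρ x) y := by
    have h1 : HasFDerivAt (fun z => ρ (z - ρ x • e) - ρ x) (fderiv ℝ ρ x) y := by
      have h2 : HasFDerivAt ρ (fderiv ℝ ρ x) (y - ρ x • e) := by
        rw [hy, add_sub_cancel_right]; exact hd.hasFDerivAt
      have h3 := h2.comp y ((hasFDerivAt_id y).sub_const (ρ x • e))
      exact (h3.sub_const (ρ x))
    have h4 : (fun z => ρ (z - ρ x • e) - ρ x) = ρ := by
      ext z
      have := hshift (z - ρ x • e) (ρ x)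
      rw [sub_add_cancel] at this
      exact this.symm
    rwa [h4] at h1
  have hzero : fderiv ℝ ρ x (v y) = 0 := by
    by_cases hyB : y ∈ B
    · set a : E n := (InnerProductSpace.toDual ℝ (E n)).symm (fderiv ℝ ρ x) with ha
      have hinner : ∀ z, ⟪a, z⟫_ℝ = fderiv ℝ ρ x z := fun z => by
        rw [ha, InnerProductSpace.toDual_symm_apply]
      -- The slope -1 along `e` keeps the gradient nonzero, so that it can be normalised to an outer
      -- normal.
      have hae : ⟪a, e⟫_ℝ = -1 := by
        rw [hinner]
        have h1 : HasDerivAt (fun s : ℝ => ρ (x + s • e)) (fderiv ℝ ρ x e) 0 := by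
          have h2 : HasFDerivAt ρ (fderiv ℝ ρ x) (x + (0 : ℝ) • e) := by
            rw [zero_smul, add_zero]; exact hd.hasFDerivAt
          have h3 : HasDerivAt (fun s : ℝ => x + s • e) e 0 := by
            simpa using ((hasDerivAt_id (0 : ℝ)).smul_const e).const_add x
          exact h2.comp_hasDerivAt 0 h3
        have h2 : HasDerivAt (fun s : ℝ => ρ (x + s • e)) (-1) 0 := by
          simp only [hshift]
          simpa using (hasDerivAt_id (0 : ℝ)).const_sub (ρ x)
        exact h1.unique h2
      have ha0 : a ≠ 0 := by
        rintro h; rw [h, inner_zero_left] at hae; norm_num at hae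
      have hna : 0 < ‖a‖ := norm_pos_iff.2 ha0
      have hm : IsOuterUnitNormal Ω y (-(‖a‖⁻¹ • a)) := by
        refine ⟨?_, ?_, ?_⟩
        · rw [hΩ.frontier_eq]
          refine ⟨?_, fun h => ?_⟩
          · have ht : Tendsto (fun s : ℝ => y + (-s) • e) (𝓝[>] 0) (𝓝 y) := by
              have : Continuous fun s : ℝ => y + (-s) • e := by fun_prop
              have h2 := (this.tendsto 0).mono_left (nhdsWithin_le_nhds (s := Ioi (0 : ℝ)))
              simpa using h2
            refine mem_closure_of_tendsto ht ?_
            filter_upwards [self_mem_nhdsWithin, ht.eventually (hB.mem_nhds hyB)] with s hs hsB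
            rw [hΩρ _ hsB, hshift, hρy]
            have : 0 < s := hs
            linarith
          · have := (hΩρ y hyB).1 h
            rw [hρy] at this
            exact lt_irrefl _ this
        · rw [norm_neg, norm_smul, norm_inv, norm_norm, inv_mul_cancel₀ hna.ne']
        · intro ε hε
          have ho := (hasFDerivAt_iff_isLittleO_nhds_zero.1 hdy).def (mul_pos hε hna)
          have hBe : ∀ᶠ h in 𝓝 (0 : E n), y + h ∈ B := by
            have : Tendsto (fun h : E n => y + h) (𝓝 0) (𝓝 y) := by
              have := (continuous_const_add y).tendsto (0 : E n)
              simpa using this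
            exact this.eventually (hB.mem_nhds hyB)
          filter_upwards [ho, hBe] with h hh hhB
          rw [hΩρ _ hhB]
          rw [hρy, sub_zero, Real.norm_eq_abs, abs_le, ← hinner] at hh
          have hmh : ⟪-(‖a‖⁻¹ • a), h⟫_ℝ = -(‖a‖⁻¹ * ⟪a, h⟫_ℝ) := by
            rw [inner_neg_left, real_inner_smul_left]
          rw [hmh]
          have hcancel : ‖a‖ * (‖a‖⁻¹ * ⟪a, h⟫_ℝ) = ⟪a, h⟫_ℝ := by
            rw [← mul_assoc, mul_inv_cancel₀ hna.ne', one_mul]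
          constructor
          · intro hlt
            have := mul_lt_mul_of_pos_left hlt hna
            nlinarith [hh.1, hh.2]
          · intro hlt
            have := mul_lt_mul_of_pos_left hlt hna
            have h5 : ρ (y + h) < 0 := by nlinarith [hh.1, hh.2]
            exact not_lt.2 h5.le
      have h0 := hn y _ hm
      rw [inner_neg_right, inner_smul_right, neg_eq_zero, mul_eq_zero] at h0
      rw [← hinner, real_inner_comm]
      exact h0.resolve_left (inv_ne_zero hna.ne')
    · rw [image_eq_zero_of_notMem_tsupport fun h => hyB (hvB h), map_zero]
  have hxy : ‖x - y‖ = ρ x := by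
    rw [hy, sub_add_cancel_left, norm_neg, norm_smul, he, mul_one, Real.norm_of_nonneg hpos.le]
  calc |fderiv ℝ ρ x (v x)| = ‖fderiv ℝ ρ x (v x - v y)‖ := by
        rw [map_sub, hzero, sub_zero, Real.norm_eq_abs]
    _ ≤ ‖fderiv ℝ ρ x‖ * ‖v x - v y‖ := ContinuousLinearMap.le_opNorm _ _
    _ ≤ K' * (L * ‖x - y‖) := by
        gcongr
        · exact norm_fderiv_le_of_lipschitz ℝ hρ
        · exact hL.norm_sub_le x y
    _ = K' * L * ρ x := by rw [hxy, mul_assoc]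

theorem isOpen_contDiffAt {V F : Type*} [NormedAddCommGroup V] [NormedSpace ℝ V]
    [NormedAddCommGroup F] [NormedSpace ℝ F] {k : WithTop ℕ∞}
    (hk : k ≠ (⊤ : ℕ∞)) (f : V → F) : IsOpen {x | ContDiffAt ℝ k f x} :=
  isOpen_iff_mem_nhds.2 fun _ hx => ContDiffAt.eventually hx hk

theorem contDiff_cutoff_smul {V F : Type*} [NormedAddCommGroup V] [NormedSpace ℝ V]
    [NormedAddCommGroup F] [NormedSpace ℝ F] {k : WithTop ℕ∞} {θ : V → ℝ} {f : V → F}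
    (hθ : ContDiff ℝ k θ) (hf : ∀ x ∈ tsupport θ, ContDiffAt ℝ k f x) :
    ContDiff ℝ k fun x => θ x • f x :=
  contDiff_of_contDiffAt_tsupport fun x hx => hθ.contDiffAt.smul
    (hf x (closure_mono (Function.support_smul_subset_left θ f) hx))

/-- The divergence theorem on a bounded Lipschitz domain for a field tangential to the boundary. -/
theorem integral_div_lipschitzDomain_eq_zero {Ω : Set (E n)} (hΩ : IsBoundedLipschitzDomain Ω)
    {v : E n → E n} (hv : ∀ x ∈ closure Ω, ContDiffAt ℝ 1 v x)
    (hn : ∀ x m, IsOuterUnitNormal Ω x m → ⟪v x, m⟫_ℝ = 0) :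
    ∫ x in Ω, div v x = 0 := by
  have hK : IsCompact (closure Ω) := hΩ.isBounded.isCompact_closure
  obtain ⟨θ, hθ, hθc, hθO, hθ1, -⟩ := exists_cutoff hK (isOpen_contDiffAt (k := 1) (by norm_num) v) hv
  -- The claim for fields supported near one point: interior points need no boundary information,
  -- and boundary points use their graph.
  have hU : ∀ x ∈ closure Ω, ∃ U ∈ 𝓝 x, ∀ w : E n → E n, ContDiff ℝ 1 w →
      HasCompactSupport w → tsupport w ⊆ U →
      (∀ x m, IsOuterUnitNormal Ω x m → ⟪w x, m⟫_ℝ = 0) → ∫ x in Ω, div w x = 0 := by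
    intro x hx
    by_cases hxΩ : x ∈ Ω
    · refine ⟨Ω, hΩ.isOpen.mem_nhds hxΩ, fun w hw hc hs _ => ?_⟩
      rw [setIntegral_eq_integral_of_eq_zero, integral_div_eq_zero hw hc]
      exact fun y hy => div_eq_zero_of_notMem_tsupport fun h => hy (hs h)
    · obtain ⟨e, K, g, he, hg, hev⟩ := hΩ.lipschitz x (by
        rw [hΩ.isOpen.frontier_eq]; exact ⟨hx, hxΩ⟩)
      obtain ⟨B, hBs, hB, hxB⟩ := mem_nhds_iff.1 hev
      exact ⟨B, hB.mem_nhds hxB, fun w hw hc hs hn' =>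
        integral_div_graph_eq_zero hΩ.isOpen he hg hB (fun y hy => hBs hy) hw hc hs hn'⟩
  choose U hUx hU' using fun x : closure Ω => hU x x.2
  obtain ⟨s, ζ, hζ, hζU, -, hζ1⟩ := exists_partition hK U hUx
  -- The field is smooth only near the closure of Ω; the cutoff makes it global without changing it
  -- there.
  have hG : ContDiff ℝ 1 fun x => θ x • v x :=
    contDiff_cutoff_smul (hθ.of_le (by norm_cast)) fun x hx => hθO hx
  have hGc : HasCompactSupport fun x => θ x • v x := hθc.smul_right
  have hζG : ∀ i, ContDiff ℝ 1 fun x => ζ i x • θ x • v x := fun i =>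
    ((hζ i).of_le (by norm_cast)).smul hG
  have hζGc : ∀ i, HasCompactSupport fun x => ζ i x • θ x • v x := fun i =>
    hGc.mono (Function.support_smul_subset_right (ζ i) _)
  have hpt : ∀ x ∈ Ω, div v x = ∑ i ∈ s, div (fun x => ζ i x • θ x • v x) x := by
    intro x hx
    have h1 : v =ᶠ[𝓝 x] fun x => ∑ i ∈ s, ζ i x • θ x • v x := by
      filter_upwards [hΩ.isOpen.mem_nhds hx, hθ1 x (subset_closure hx)] with y hy hθy
      rw [← Finset.sum_smul, hζ1 y (subset_closure hy), hθy, one_smul, one_smul]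
    rw [div_congr h1]
    simp only [div, partialD]
    rw [fderiv_fun_sum fun i _ => (hζG i).differentiable (by norm_num) x]
    simp only [sum_apply, WithLp.ofLp_sum, Finset.sum_apply]
    rw [Finset.sum_comm]
  rw [setIntegral_congr_fun hΩ.isOpen.measurableSet hpt,
    integral_finsetSum _ fun i _ => (integrable_div (hζG i) (hζGc i)).integrableOn]
  refine Finset.sum_eq_zero fun i _ => hU' i _ (hζG i) (hζGc i) ?_ fun x m hm => ?_
  · exact (closure_mono (Function.support_smul_subset_left (ζ i) _)).trans (hζU i)
  · rw [real_inner_smul_left, real_inner_smul_left, hn x m hm, mul_zero, mul_zero]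


end

section

variable {n : ℕ}

/-! ### Gradients -/

theorem gradient_apply (f : E n → ℝ) (x : E n) (i : Fin n) :
    gradient f x i = partialD i f x := by
  have h1 : ⟪gradient f x, EuclideanSpace.single i (1 : ℝ)⟫_ℝ
      = fderiv ℝ f x (EuclideanSpace.single i 1) := by
    rw [gradient, InnerProductSpace.toDual_symm_apply]
  rw [EuclideanSpace.inner_single_right] at h1
  simpa [partialD] using h1

theorem inner_gradient (f : E n → ℝ) (x v : E n) : ⟪gradient f x, v⟫_ℝ = fderiv ℝ f x v := by
  rw [gradient, InnerProductSpace.toDual_symm_apply]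

theorem inner_eq_sum (v w : E n) : ⟪v, w⟫_ℝ = ∑ i, v i * w i := by
  rw [PiLp.inner_apply]
  simp [mul_comm]

theorem norm_sq_eq_sum (v : E n) : ‖v‖ ^ 2 = ∑ i, v i ^ 2 := by
  rw [← real_inner_self_eq_norm_sq, inner_eq_sum]
  simp [sq]

theorem sum_partialD_sq (f : E n → ℝ) (x : E n) :
    ∑ i, partialD i f x ^ 2 = ‖fderiv ℝ f x‖ ^ 2 := by
  have : ‖gradient f x‖ = ‖fderiv ℝ f x‖ := by simp [gradient]
  rw [← this, norm_sq_eq_sum]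
  simp [gradient_apply]

/-! ### The signed distance -/

theorem abs_signedDistance (A : Set (E n)) (x : E n) :
    |signedDistance A x| = Metric.infDist x (frontier A) := by
  simp only [signedDistance]
  split_ifs
  · exact abs_of_nonneg Metric.infDist_nonneg
  · rw [abs_neg, abs_of_nonneg Metric.infDist_nonneg]

theorem signedDistance_of_mem {A : Set (E n)} {x : E n} (hx : x ∈ A) :
    signedDistance A x = Metric.infDist x (frontier A) := if_pos hx

theorem signedDistance_of_notMem {A : Set (E n)} {x : E n} (hx : x ∉ A) :
    signedDistance A x = -Metric.infDist x (frontier A) := if_neg hx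

theorem mem_of_signedDistance_pos {A : Set (E n)} {x : E n} (h : 0 < signedDistance A x) :
    x ∈ A := by
  by_contra hx
  rw [signedDistance_of_notMem hx] at h
  linarith [Metric.infDist_nonneg (x := x) (s := frontier A)]

theorem signedDistance_eq_zero_iff {A : Set (E n)} (hne : (frontier A).Nonempty) {x : E n} :
    signedDistance A x = 0 ↔ x ∈ frontier A := by
  rw [← abs_eq_zero, abs_signedDistance, isClosed_frontier.mem_iff_infDist_zero hne]

theorem signedDistance_pos_iff {A : Set (E n)} (hA : IsOpen A) (hne : (frontier A).Nonempty)
    {x : E n} : 0 < signedDistance A x ↔ x ∈ A := by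
  refine ⟨mem_of_signedDistance_pos, fun hx => ?_⟩
  have h0 : signedDistance A x ≠ 0 := by
    rw [Ne, signedDistance_eq_zero_iff hne, hA.frontier_eq]
    exact fun h => h.2 hx
  refine lt_of_le_of_ne ?_ h0.symm
  rw [signedDistance_of_mem hx]
  exact Metric.infDist_nonneg

theorem signedDistance_of_frontier_eq_empty {A : Set (E n)} (h : frontier A = ∅) :
    signedDistance A = fun _ => 0 := by
  ext x
  rw [← abs_eq_zero, abs_signedDistance, h, Metric.infDist_empty]

/-- The segment from `x` to `y` meets the frontier, and the meeting point splits its length. -/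
theorem infDist_frontier_add_le {A : Set (E n)} {x y : E n} (hx : x ∈ A) (hy : y ∉ A) :
    Metric.infDist x (frontier A) + Metric.infDist y (frontier A) ≤ dist x y := by
  have hseg : IsPreconnected (segment ℝ x y) := (convex_segment x y).isPreconnected
  obtain ⟨z, hz, hzA⟩ : (segment ℝ x y ∩ frontier A).Nonempty := by
    by_contra hemp
    rw [not_nonempty_iff_eq_empty, ← disjoint_iff_inter_eq_empty, disjoint_left] at hemp
    have hx' : x ∈ interior A := by
      by_contra h
      exact hemp (left_mem_segment ℝ x y) ⟨subset_closure hx, h⟩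
    have hy' : y ∈ (closure A)ᶜ := fun h =>
      hemp (right_mem_segment ℝ x y) ⟨h, fun h' => hy (interior_subset h')⟩
    obtain ⟨z, -, hz1, hz2⟩ := hseg _ _ isOpen_interior isClosed_closure.isOpen_compl
      (fun z hz => by
        by_contra h
        rw [mem_union, not_or, notMem_compl_iff] at h
        exact hemp hz ⟨h.2, h.1⟩)
      ⟨x, left_mem_segment ℝ x y, hx'⟩ ⟨y, right_mem_segment ℝ x y, hy'⟩
    exact hz2 (interior_subset_closure hz1)
  calc Metric.infDist x (frontier A) + Metric.infDist y (frontier A) ≤ dist x z + dist y z :=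
        add_le_add (Metric.infDist_le_dist_of_mem hzA) (Metric.infDist_le_dist_of_mem hzA)
    _ = dist x z + dist z y := by rw [dist_comm y z]
    _ = dist x y := dist_add_dist_of_mem_segment hz

theorem lipschitzWith_signedDistance (A : Set (E n)) : LipschitzWith 1 (signedDistance A) := by
  refine LipschitzWith.of_le_add fun x y => ?_
  by_cases hx : x ∈ A <;> by_cases hy : y ∈ A
  · rw [signedDistance_of_mem hx, signedDistance_of_mem hy]
    exact Metric.infDist_le_infDist_add_dist
  · rw [signedDistance_of_mem hx, signedDistance_of_notMem hy]
    linarith [infDist_frontier_add_le hx hy]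
  · rw [signedDistance_of_notMem hx, signedDistance_of_mem hy]
    linarith [Metric.infDist_nonneg (x := x) (s := frontier A),
      Metric.infDist_nonneg (x := y) (s := frontier A), dist_nonneg (x := x) (y := y)]
  · rw [signedDistance_of_notMem hx, signedDistance_of_notMem hy]
    have := Metric.infDist_le_infDist_add_dist (x := y) (y := x) (s := frontier A)
    rw [dist_comm] at this
    linarith

/-- Moving straight towards a nearest frontier point reduces the distance at unit speed, so the
gradient has norm at least one; the Lipschitz bound gives the converse. Only the motion towards that
point is controlled, which is why a one-sided derivative is compared with the differential. -/
theorem norm_fderiv_signedDistance_of_notMem {A : Set (E n)} (hA : IsOpen A)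
    (hne : (frontier A).Nonempty) {x : E n} (hx : x ∉ frontier A)
    (hd : DifferentiableAt ℝ (signedDistance A) x) : ‖fderiv ℝ (signedDistance A) x‖ = 1 := by
  refine le_antisymm ?_ ?_
  · exact norm_fderiv_le_of_lipschitz ℝ (lipschitzWith_signedDistance A)
  obtain ⟨q, hq, hxq⟩ := isClosed_frontier.exists_infDist_eq_dist hne x
  have hr : 0 < dist x q := dist_pos.2 fun h => hx (h ▸ hq)
  obtain ⟨σ, hσ, hev⟩ : ∃ σ : ℝ, |σ| = 1 ∧ ∀ᶠ y in 𝓝 x, signedDistance A y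
      = σ * Metric.infDist y (frontier A) := by
    by_cases hxA : x ∈ A
    · refine ⟨1, by simp, ?_⟩
      filter_upwards [hA.mem_nhds hxA] with y hy
      rw [signedDistance_of_mem hy, one_mul]
    · refine ⟨-1, by simp, ?_⟩
      have : x ∉ closure A := fun h => hx (by rw [hA.frontier_eq]; exact ⟨h, hxA⟩)
      filter_upwards [isClosed_closure.isOpen_compl.mem_nhds this] with y hy
      rw [signedDistance_of_notMem fun h => hy (subset_closure h), neg_one_mul]
  have hline : ContinuousAt (fun τ : ℝ => x + τ • (x - q)) 0 := by fun_prop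
  have h1 : HasDerivAt (fun τ : ℝ => signedDistance A (x + τ • (x - q)))
      (fderiv ℝ (signedDistance A) x (x - q)) 0 := by
    have h2 : HasFDerivAt (signedDistance A) (fderiv ℝ (signedDistance A) x)
        (x + (0 : ℝ) • (x - q)) := by rw [zero_smul, add_zero]; exact hd.hasFDerivAt
    have h3 : HasDerivAt (fun τ : ℝ => x + τ • (x - q)) (x - q) 0 := by
      simpa using ((hasDerivAt_id (0 : ℝ)).smul_const (x - q)).const_add x
    exact h2.comp_hasDerivAt 0 h3
  have h2 : HasDerivWithinAt (fun τ : ℝ => signedDistance A (x + τ • (x - q)))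
      (σ * dist x q) (Iic 0) 0 := by
    have h3 : HasDerivWithinAt (fun τ : ℝ => σ * ((1 + τ) * dist x q)) (σ * dist x q)
        (Iic 0) 0 := by
      simpa using ((((hasDerivAt_id (0 : ℝ)).const_add 1).mul_const (dist x q)).const_mul
        σ).hasDerivWithinAt (s := Iic 0)
    -- Along the segment to `q` the distance is exactly linear: `q` gives the upper bound, the
    -- triangle inequality from `x` the lower one.
    have hval : ∀ τ : ℝ, -1 < τ → τ ≤ 0 →
        Metric.infDist (x + τ • (x - q)) (frontier A) = (1 + τ) * dist x q := by
      intro τ h1 h0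
      refine le_antisymm ?_ ?_
      · refine (Metric.infDist_le_dist_of_mem hq).trans (le_of_eq ?_)
        rw [dist_eq_norm, dist_eq_norm, show x + τ • (x - q) - q = (1 + τ) • (x - q) by
          rw [add_smul, one_smul]; abel, norm_smul, Real.norm_of_nonneg (by linarith)]
      · have h5 := Metric.infDist_le_infDist_add_dist (x := x) (y := x + τ • (x - q))
          (s := frontier A)
        have h6 : dist x (x + τ • (x - q)) = -τ * dist x q := by
          rw [dist_eq_norm, dist_eq_norm, sub_add_cancel_left, norm_neg, norm_smul,
            Real.norm_of_nonpos h0]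
        rw [hxq, h6] at h5
        linarith
    refine h3.congr_of_eventuallyEq ?_ ?_
    · have hev' : ∀ᶠ τ in 𝓝 (0 : ℝ), signedDistance A (x + τ • (x - q))
          = σ * Metric.infDist (x + τ • (x - q)) (frontier A) := by
        have h0 : Tendsto (fun τ : ℝ => x + τ • (x - q)) (𝓝 0) (𝓝 x) := by
          simpa [ContinuousAt] using hline
        exact h0.eventually hev
      filter_upwards [nhdsWithin_le_nhds hev', self_mem_nhdsWithin,
        nhdsWithin_le_nhds (lt_mem_nhds (show (-1 : ℝ) < 0 by norm_num))] with τ h5 h6 h7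
      rw [h5, hval τ h7 h6]
    · have := hev.self_of_nhds
      simp only [zero_smul, add_zero]
      rw [this, hxq, one_mul]
  have h4 : fderiv ℝ (signedDistance A) x (x - q) = σ * dist x q :=
    (uniqueDiffWithinAt_Iic (0 : ℝ)).eq_deriv _ h1.hasDerivWithinAt h2
  have h5 := (fderiv ℝ (signedDistance A) x).le_opNorm (x - q)
  rw [h4, norm_mul, Real.norm_eq_abs σ, hσ, one_mul, Real.norm_of_nonneg hr.le,
    ← dist_eq_norm] at h5
  exact le_of_mul_le_mul_right (by simpa using h5) hr

/-- The frontier of an open set has empty interior, so the identity off the frontier extends to it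
by continuity of the gradient. -/
theorem norm_fderiv_signedDistance {A : Set (E n)} (hA : IsOpen A)
    (hne : (frontier A).Nonempty) {x : E n} (hd : ContDiffAt ℝ 1 (signedDistance A) x) :
    ‖fderiv ℝ (signedDistance A) x‖ = 1 := by
  have hdiff : ∀ᶠ y in 𝓝 x, DifferentiableAt ℝ (signedDistance A) y :=
    (hd.eventually (by norm_num)).mono fun y hy => hy.differentiableAt (by norm_num)
  have hcont : ContinuousAt (fun y => ‖fderiv ℝ (signedDistance A) y‖) x :=
    (hd.continuousAt_fderiv (by norm_num)).norm
  have hdense : x ∈ closure (frontier A)ᶜ := by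
    rw [closure_compl, ← frontier_compl, interior_frontier hA.isClosed_compl]
    simp
  have hfreq : ∃ᶠ y in 𝓝 x, ‖fderiv ℝ (signedDistance A) y‖ = 1 :=
    ((mem_closure_iff_frequently.1 hdense).and_eventually hdiff).mono fun y hy =>
      norm_fderiv_signedDistance_of_notMem hA hne hy.1 hy.2
  by_contra hne1
  exact hfreq (hcont.eventually (isOpen_ne.mem_nhds hne1))

/-! ### Space-time derivatives -/

/-- The time derivative of a space-time function. -/
def dt {F : Type*} [NormedAddCommGroup F] [NormedSpace ℝ F] (f : ℝ × E n → F)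
    (q : ℝ × E n) : F := fderiv ℝ f q (1, 0)

/-- The spatial partial derivatives of a space-time function. -/
def dx {F : Type*} [NormedAddCommGroup F] [NormedSpace ℝ F] (i : Fin n) (f : ℝ × E n → F)
    (q : ℝ × E n) : F := fderiv ℝ f q (0, EuclideanSpace.single i 1)

section
variable {F : Type*} [NormedAddCommGroup F] [NormedSpace ℝ F] {f : ℝ × E n → F} {t : ℝ} {x : E n}

theorem hasDerivAt_slice (hf : DifferentiableAt ℝ f (t, x)) :
    HasDerivAt (fun τ => f (τ, x)) (dt f (t, x)) t :=
  hf.hasFDerivAt.comp_hasDerivAt t ((hasDerivAt_id t).prodMk (hasDerivAt_const t x))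

theorem hasFDerivAt_slice (hf : DifferentiableAt ℝ f (t, x)) :
    HasFDerivAt (fun y => f (t, y)) ((fderiv ℝ f (t, x)).comp (ContinuousLinearMap.inr ℝ ℝ (E n)))
      x :=
  hf.hasFDerivAt.comp x (hasFDerivAt_prodMk_right t x)

theorem partialD_slice (hf : DifferentiableAt ℝ f (t, x)) (i : Fin n) :
    partialD i (fun y => f (t, y)) x = dx i f (t, x) := by
  rw [partialD, (hasFDerivAt_slice hf).fderiv]
  rfl

theorem contDiffAt_slice {k : WithTop ℕ∞} (hf : ContDiffAt ℝ k f (t, x)) :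
    ContDiffAt ℝ k (fun y => f (t, y)) x :=
  hf.comp x (contDiffAt_const.prodMk contDiffAt_id)

theorem contDiffAt_dt {q : ℝ × E n} {k m : WithTop ℕ∞} (hf : ContDiffAt ℝ k f q)
    (h : m + 1 ≤ k) : ContDiffAt ℝ m (dt f) q :=
  (hf.fderiv_right h).clm_apply contDiffAt_const

theorem contDiffAt_dx {q : ℝ × E n} {k m : WithTop ℕ∞} (hf : ContDiffAt ℝ k f q)
    (h : m + 1 ≤ k) (i : Fin n) : ContDiffAt ℝ m (dx i f) q :=
  (hf.fderiv_right h).clm_apply contDiffAt_const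

theorem dt_dx_comm {q : ℝ × E n} (hf : ContDiffAt ℝ 2 f q) (i : Fin n) :
    dt (dx i f) q = dx i (dt f) q := by
  have hsymm : IsSymmSndFDerivAt ℝ f q := hf.isSymmSndFDerivAt (by simp)
  have hd : DifferentiableAt ℝ (fderiv ℝ f) q :=
    (hf.fderiv_right (m := 1) (by norm_num)).differentiableAt (by norm_num)
  have h : ∀ v w, fderiv ℝ (fun p => fderiv ℝ f p v) q w = fderiv ℝ (fderiv ℝ f) q w v := by
    intro v w
    rw [fderiv_clm_apply hd (differentiableAt_const v)]
    simp
  unfold dt dx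
  rw [h, h]
  exact hsymm _ _

end


end

section

variable {n : ℕ}

/-! ### The tube around the evolving interface -/

/-- The signed distance to the interface as a function on space-time. -/
def levelFn (Ωp : ℝ → Set (E n)) (q : ℝ × E n) : ℝ := signedDistance (Ωp q.1) q.2

/-- The open space-time neighbourhood of the interface where the signed distance is `C³` and has
a unit gradient. -/
def tube (Ω : Set (E n)) (T : ℝ) (Ωp : ℝ → Set (E n)) : Set (ℝ × E n) :=
  {q | (q.1 ∈ Ioo 0 T ∧ q.2 ∈ Ω) ∧ ∀ᶠ p in 𝓝 q,
    ContDiffAt ℝ 3 (levelFn Ωp) p ∧ ∑ i, dx i (levelFn Ωp) p ^ 2 = 1}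

section
variable {Ω : Set (E n)} {T : ℝ} {Ωp : ℝ → Set (E n)} {q : ℝ × E n} {t : ℝ} {x : E n}

theorem isOpen_tube (hΩ : IsOpen Ω) : IsOpen (tube Ω T Ωp) :=
  (((isOpen_Ioo.preimage continuous_fst).inter (hΩ.preimage continuous_snd))).inter
    isOpen_setOfPred_eventually_nhds

theorem contDiffAt_levelFn (hq : q ∈ tube Ω T Ωp) : ContDiffAt ℝ 3 (levelFn Ωp) q :=
  hq.2.self_of_nhds.1

theorem sum_dx_levelFn_sq (hq : q ∈ tube Ω T Ωp) : ∑ i, dx i (levelFn Ωp) q ^ 2 = 1 :=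
  hq.2.self_of_nhds.2

theorem differentiableAt_levelFn (hq : q ∈ tube Ω T Ωp) :
    DifferentiableAt ℝ (levelFn Ωp) q :=
  (contDiffAt_levelFn hq).differentiableAt (by norm_num)

theorem partialD_signedDistance (hq : (t, x) ∈ tube Ω T Ωp) (i : Fin n) :
    partialD i (signedDistance (Ωp t)) x = dx i (levelFn Ωp) (t, x) :=
  partialD_slice (differentiableAt_levelFn hq) i

theorem nonempty_interface_of_tube (hq : (t, x) ∈ tube Ω T Ωp) :
    (frontier (Ωp t)).Nonempty := by
  by_contra h
  rw [not_nonempty_iff_eq_empty] at h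
  have h1 := sum_dx_levelFn_sq hq
  simp only [← partialD_signedDistance hq, signedDistance_of_frontier_eq_empty h] at h1
  simp [partialD] at h1

theorem IsEvolvingInterface.isOpen_phase (h : IsEvolvingInterface Ω T Ωp) (ht : t ∈ Ioo 0 T) :
    IsOpen (Ωp t) := by
  have h1 : Continuous fun x : E n => (t, x) := by fun_prop
  have h2 := h.isOpen_inner.preimage h1
  have h3 : (fun x : E n => (t, x)) ⁻¹' {q : ℝ × E n | q.1 ∈ Ioo 0 T ∧ q.2 ∈ Ωp q.1} = Ωp t := by
    ext x
    simp only [mem_preimage, mem_ofPred_eq, ht, true_and]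
  rwa [h3] at h2

theorem IsEvolvingInterface.levelFn_pos_iff (h : IsEvolvingInterface Ω T Ωp)
    (hq : q ∈ tube Ω T Ωp) : 0 < levelFn Ωp q ↔ q.2 ∈ Ωp q.1 :=
  signedDistance_pos_iff (h.isOpen_phase hq.1.1) (nonempty_interface_of_tube (t := q.1) hq)

theorem levelFn_eq_zero_iff (hq : q ∈ tube Ω T Ωp) :
    levelFn Ωp q = 0 ↔ q.2 ∈ interface Ωp q.1 :=
  signedDistance_eq_zero_iff (nonempty_interface_of_tube (t := q.1) hq)

theorem IsEvolvingInterface.interface_subset (h : IsEvolvingInterface Ω T Ωp) (ht : t ∈ Ioo 0 T) :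
    interface Ωp t ⊆ Ω := frontier_subset_closure.trans (h.inside t ht)

/-- The eikonal equation holds at nearby points whose time slice has a nonempty interface. A nearby
slice cannot have an empty one: distance to the empty set is zero by convention, so the spatial
gradient would vanish, while by continuity it is nonzero near (t, x). -/
theorem IsEvolvingInterface.mem_tube (h : IsEvolvingInterface Ω T Ωp)
    (ht : t ∈ Ioo 0 T) (hx : x ∈ interface Ωp t) : (t, x) ∈ tube Ω T Ωp := by
  refine ⟨⟨ht, h.interface_subset ht hx⟩, ?_⟩
  have hC : ContDiffAt ℝ 3 (levelFn Ωp) (t, x) := h.smooth t ht x hx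
  have hsum : ∀ p : ℝ × E n, p.1 ∈ Ioo 0 T → (frontier (Ωp p.1)).Nonempty →
      ContDiffAt ℝ 3 (levelFn Ωp) p → ∑ i, dx i (levelFn Ωp) p ^ 2 = 1 := by
    rintro ⟨s, y⟩ hs hne hp
    have h1 : ContDiffAt ℝ 1 (signedDistance (Ωp s)) y :=
      (contDiffAt_slice hp).of_le (by norm_num)
    have h2 := norm_fderiv_signedDistance (h.isOpen_phase hs) hne h1
    have h3 := sum_partialD_sq (signedDistance (Ωp s)) y
    rw [h2, one_pow] at h3
    rw [← h3]
    refine Finset.sum_congr rfl fun i _ => ?_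
    rw [← partialD_slice (hp.differentiableAt (by norm_num))]
    rfl
  have hcont : ContinuousAt (fun p => ∑ i, dx i (levelFn Ωp) p ^ 2) (t, x) :=
    tendsto_finsetSum _ fun i _ =>
      ((contDiffAt_dx (m := 2) hC (by norm_num) i).continuousAt).pow 2
  have h1 : ∑ i, dx i (levelFn Ωp) (t, x) ^ 2 = 1 := hsum (t, x) ht ⟨x, hx⟩ hC
  have hpos : ∀ᶠ p in 𝓝 (t, x), 0 < ∑ i, dx i (levelFn Ωp) p ^ 2 :=
    hcont.eventually (lt_mem_nhds (by
      change 0 < ∑ i, dx i (levelFn Ωp) (t, x) ^ 2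
      rw [h1]; exact one_pos))
  have hIoo : ∀ᶠ p : ℝ × E n in 𝓝 (t, x), p.1 ∈ Ioo 0 T :=
    (isOpen_Ioo.preimage continuous_fst).mem_nhds ht
  filter_upwards [hC.eventually (by norm_num), hpos, hIoo] with p hp1 hp2 hp3
  refine ⟨hp1, hsum p hp3 ?_ hp1⟩
  by_contra hemp
  rw [not_nonempty_iff_eq_empty] at hemp
  refine hp2.ne' (Finset.sum_eq_zero fun i _ => ?_)
  obtain ⟨s, y⟩ := p
  rw [← partialD_slice (hp1.differentiableAt (by norm_num))]
  have : (fun z => levelFn Ωp (s, z)) = fun _ => 0 := signedDistance_of_frontier_eq_empty hemp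
  rw [this]
  simp [partialD]

/-- The interface sweeps out a compact set in a compact time interval. -/
theorem IsEvolvingInterface.isCompact_track (hΩ : Bornology.IsBounded Ω)
    (h : IsEvolvingInterface Ω T Ωp) {a b : ℝ} (hab : Icc a b ⊆ Ioo 0 T) :
    IsCompact {q : ℝ × E n | q.1 ∈ Icc a b ∧ q.2 ∈ interface Ωp q.1} := by
  refine (isCompact_Icc.prod hΩ.isCompact_closure (s := Icc a b)).of_isClosed_subset ?_ ?_
  · have h1 : {q : ℝ × E n | q.1 ∈ Icc a b ∧ q.2 ∈ interface Ωp q.1}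
        = (Prod.fst ⁻¹' Icc a b ∩ {q : ℝ × E n | q.1 ∈ Ioo 0 T ∧ q.2 ∈ Ωp q.1}ᶜ)
          ∩ {q : ℝ × E n | q.1 ∈ Ioo 0 T ∧ q.2 ∉ closure (Ωp q.1)}ᶜ := by
      ext q
      simp only [mem_ofPred_eq, mem_inter_iff, mem_preimage, mem_compl_iff, not_and, not_not]
      constructor
      · rintro ⟨hq, hqi⟩
        rw [interface, (h.isOpen_phase (hab hq)).frontier_eq] at hqi
        exact ⟨⟨hq, fun _ => hqi.2⟩, fun _ => hqi.1⟩
      · rintro ⟨⟨hq, h2⟩, h3⟩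
        refine ⟨hq, ?_⟩
        rw [interface, (h.isOpen_phase (hab hq)).frontier_eq]
        exact ⟨h3 (hab hq), h2 (hab hq)⟩
    rw [h1]
    exact ((isClosed_Icc.preimage continuous_fst).inter h.isOpen_inner.isClosed_compl).inter
      h.isOpen_outer.isClosed_compl
  · rintro q ⟨hq, hqi⟩
    exact ⟨hq, subset_closure (h.interface_subset (hab hq) hqi)⟩

theorem IsEvolvingInterface.isCompact_interface (hΩ : Bornology.IsBounded Ω)
    (h : IsEvolvingInterface Ω T Ωp) (ht : t ∈ Ioo 0 T) : IsCompact (interface Ωp t) :=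
  hΩ.isCompact_closure.of_isClosed_subset isClosed_frontier
    ((h.interface_subset ht).trans subset_closure)

theorem isOpen_tube_slice (hΩ : IsOpen Ω) (t : ℝ) : IsOpen {x | (t, x) ∈ tube Ω T Ωp} :=
  (isOpen_tube hΩ).preimage (by fun_prop)

theorem normal_apply (hq : (t, x) ∈ tube Ω T Ωp) (i : Fin n) :
    normal Ωp t x i = dx i (levelFn Ωp) (t, x) := by
  rw [normal, gradient_apply, partialD_signedDistance hq]

theorem normalVelocity_eq (hq : (t, x) ∈ tube Ω T Ωp) :
    normalVelocity Ωp t x = -dt (levelFn Ωp) (t, x) := by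
  rw [normalVelocity]
  congr 1
  exact (hasDerivAt_slice (differentiableAt_levelFn hq)).deriv

theorem contDiffAt_normal (hΩ : IsOpen Ω) (hq : (t, x) ∈ tube Ω T Ωp) :
    ContDiffAt ℝ 2 (normal Ωp t) x := by
  rw [contDiffAt_piLp]
  intro i
  have h1 : ContDiffAt ℝ 2 (fun y => dx i (levelFn Ωp) (t, y)) x :=
    contDiffAt_slice (contDiffAt_dx (contDiffAt_levelFn hq) (by norm_num) i)
  refine h1.congr_of_eventuallyEq ?_
  filter_upwards [(isOpen_tube_slice hΩ t).mem_nhds hq] with y hy using normal_apply hy i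

theorem curvature_eq (hΩ : IsOpen Ω) (hq : (t, x) ∈ tube Ω T Ωp) :
    curvature Ωp t x = -∑ i, dx i (dx i (levelFn Ωp)) (t, x) := by
  rw [curvature, div_eq_sum ((contDiffAt_normal hΩ hq).differentiableAt (by norm_num))]
  congr 1
  refine Finset.sum_congr rfl fun i _ => ?_
  have h1 : (fun y => normal Ωp t y i) =ᶠ[𝓝 x] fun y => dx i (levelFn Ωp) (t, y) := by
    filter_upwards [(isOpen_tube_slice hΩ t).mem_nhds hq] with y hy using normal_apply hy i
  rw [partialD, h1.fderiv_eq]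
  exact partialD_slice ((contDiffAt_dx (m := 2) (contDiffAt_levelFn hq)
    (by norm_num) i).differentiableAt (by norm_num)) i

theorem contDiffAt_curvature (hΩ : IsOpen Ω) (hq : (t, x) ∈ tube Ω T Ωp) :
    ContDiffAt ℝ 1 (curvature Ωp t) x := by
  have h1 : ContDiffAt ℝ 1 (fun y => -∑ i, dx i (dx i (levelFn Ωp)) (t, y)) x := by
    refine (ContDiffAt.sum fun i _ => ?_).neg
    exact contDiffAt_slice (contDiffAt_dx (contDiffAt_dx (m := 2) (contDiffAt_levelFn hq)
      (by norm_num) i) (by norm_num) i)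
  refine h1.congr_of_eventuallyEq ?_
  filter_upwards [(isOpen_tube_slice hΩ t).mem_nhds hq] with y hy using curvature_eq hΩ hy

/-- This is the time derivative of the eikonal equation |∇d|² = 1. -/
theorem sum_dx_dt_mul_dx (hΩ : IsOpen Ω) (hq : q ∈ tube Ω T Ωp) :
    ∑ i, dx i (dt (levelFn Ωp)) q * dx i (levelFn Ωp) q = 0 := by
  have hC := contDiffAt_levelFn hq
  have hdi : ∀ i, DifferentiableAt ℝ (dx i (levelFn Ωp)) q := fun i =>
    (contDiffAt_dx (m := 2) hC (by norm_num) i).differentiableAt (by norm_num)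
  have h1 : (fun p => ∑ i, dx i (levelFn Ωp) p ^ 2) =ᶠ[𝓝 q] fun _ => (1 : ℝ) := by
    filter_upwards [(isOpen_tube hΩ).mem_nhds hq] with p hp using sum_dx_levelFn_sq hp
  have h2 : dt (fun p => ∑ i, dx i (levelFn Ωp) p ^ 2) q = 0 := by
    rw [dt, h1.fderiv_eq]; simp
  have h3 : dt (fun p => ∑ i, dx i (levelFn Ωp) p ^ 2) q
      = ∑ i, 2 * (dx i (dt (levelFn Ωp)) q * dx i (levelFn Ωp) q) := by
    rw [dt, fderiv_fun_sum (A := fun i p => dx i (levelFn Ωp) p ^ 2)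
      fun i _ => (hdi i).fun_pow 2, sum_apply]
    refine Finset.sum_congr rfl fun i _ => ?_
    rw [← dt_dx_comm (hC.of_le (by norm_num)), fderiv_fun_pow 2 (hdi i)]
    simp [dt]
    ring
  rw [h3, ← Finset.mul_sum] at h2
  linarith

/-- The divergence theorem in the inner phase for a field tangential to the interface. -/
theorem IsEvolvingInterface.integral_div_eq_zero (hΩ : IsOpen Ω)
    (h : IsEvolvingInterface Ω T Ωp) (ht : t ∈ Ioo 0 T) {v : E n → E n} (hv : ContDiff ℝ 1 v)
    (hc : HasCompactSupport v) (hvt : ∀ x ∈ tsupport v, (t, x) ∈ tube Ω T Ωp)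
    (hν : ∀ x ∈ interface Ωp t, ⟪v x, normal Ωp t x⟫_ℝ = 0) :
    ∫ x in Ωp t, div v x = 0 := by
  by_cases hne : (frontier (Ωp t)).Nonempty
  swap
  · have : ∀ x, div v x = 0 := fun x => div_eq_zero_of_notMem_tsupport fun hx =>
      hne (nonempty_interface_of_tube (hvt x hx))
    simp [this]
  have hset : Ωp t = {x | 0 < signedDistance (Ωp t) x} := by
    ext x
    exact (signedDistance_pos_iff (h.isOpen_phase ht) hne).symm
  have hf : ContDiff ℝ 1 fun x => ⟪v x, normal Ωp t x⟫_ℝ := by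
    refine contDiff_of_contDiffAt_tsupport fun x hx => ?_
    have hx' : x ∈ tsupport v := by
      refine closure_mono (fun y hy => ?_) hx
      rw [Function.mem_support] at hy ⊢
      rintro h0
      exact hy (by rw [h0, inner_zero_left])
    exact hv.contDiffAt.inner ℝ ((contDiffAt_normal hΩ (hvt x hx')).of_le (by norm_num))
  have hfc : HasCompactSupport fun x => ⟪v x, normal Ωp t x⟫_ℝ :=
    HasCompactSupport.intro' hc (isClosed_tsupport v) fun x hx => by
      rw [image_eq_zero_of_notMem_tsupport hx, inner_zero_left]
  obtain ⟨L, hL⟩ := hf.lipschitzWith_of_hasCompactSupport hfc (by norm_num)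
  rw [hset]
  refine integral_div_superlevel_eq_zero (lipschitzWith_signedDistance (Ωp t)) hv hc (C := L) ?_
  refine Eventually.of_forall fun x hx => ?_
  -- The function v·ν is Lipschitz and vanishes at the interface point nearest to `x`, so it is
  -- bounded by a multiple of the distance.
  obtain ⟨q, hq, hxq⟩ := isClosed_frontier.exists_infDist_eq_dist hne x
  have h1 := hL.norm_sub_le x q
  rw [hν q hq, sub_zero, ← dist_eq_norm, ← hxq, ← abs_signedDistance, abs_of_pos hx,
    real_inner_comm, normal, inner_gradient] at h1
  exact h1

end


end

section

variable {n : ℕ}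

/-! ### Thin layers around a level set -/

theorem hasDerivAt_arctan_div {ε : ℝ} (hε : 0 < ε) (s : ℝ) :
    HasDerivAt (fun s => Real.arctan (s / ε)) (ε / (ε ^ 2 + s ^ 2)) s := by
  have h2 : HasDerivAt (fun s : ℝ => s / ε) (1 / ε) s := (hasDerivAt_id s).div_const ε
  convert! h2.arctan using 1
  field_simp

theorem contDiffAt_gradient {ρ : E n → ℝ} {x : E n} {k m : WithTop ℕ∞}
    (h : ContDiffAt ℝ k ρ x) (hm : m + 1 ≤ k) : ContDiffAt ℝ m (gradient ρ) x := by
  rw [contDiffAt_piLp]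
  intro i
  simp only [gradient_apply]
  exact (h.fderiv_right hm).clm_apply contDiffAt_const

/-- Integrate `div (ζ∇ρ)` against arctan(ρ/ε), which is bounded by π/2. By parts and with |∇ρ| = 1
this is minus the integral of ζ against the kernel ε/(ε² + ρ²), which is at least 1/(2ε) on |ρ| ≤ ε.
The product 2ε · π/2 gives the constant. -/
theorem integral_layer_le {ρ : E n → ℝ} {K : ℝ≥0} (hρ : LipschitzWith K ρ) {ζ : E n → ℝ}
    (hζ : ContDiff ℝ 1 ζ) (hc : HasCompactSupport ζ) (h0 : ∀ x, 0 ≤ ζ x)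
    (hρC : ∀ x ∈ tsupport ζ, ContDiffAt ℝ 2 ρ x)
    (hρ1 : ∀ x ∈ tsupport ζ, ‖fderiv ℝ ρ x‖ = 1) {ε : ℝ} (hε : 0 < ε) :
    ∫ x, {x | |ρ x| ≤ ε}.indicator ζ x
      ≤ Real.pi * ε * ∫ x, |div (fun y => ζ y • gradient ρ y) x| := by
  have hv : ContDiff ℝ 1 fun y => ζ y • gradient ρ y :=
    contDiff_cutoff_smul hζ fun x hx => contDiffAt_gradient (hρC x hx) (by norm_num)
  have hvc : HasCompactSupport fun y => ζ y • gradient ρ y := hc.smul_right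
  have hf : LipschitzWith (1 / ε).toNNReal fun s : ℝ => Real.arctan (s / ε) := by
    refine lipschitzWith_of_nnnorm_deriv_le
      (fun s => (hasDerivAt_arctan_div hε s).differentiableAt) fun s => ?_
    rw [(hasDerivAt_arctan_div hε s).deriv, ← NNReal.coe_le_coe, coe_nnnorm,
      Real.coe_toNNReal _ (by positivity), Real.norm_of_nonneg (by positivity),
      div_le_div_iff₀ (by positivity) hε]
    nlinarith [sq_nonneg s]
  have hibp := integral_lipschitz_mul_div (hf.comp hρ) hv hvc
  have hder : ∀ x, fderiv ℝ ((fun s : ℝ => Real.arctan (s / ε)) ∘ ρ) x (ζ x • gradient ρ x)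
      = ε / (ε ^ 2 + ρ x ^ 2) * ζ x := by
    intro x
    by_cases hx : x ∈ tsupport ζ
    · have hd := ((hρC x hx).differentiableAt (by norm_num)).hasFDerivAt
      rw [((hasDerivAt_arctan_div hε (ρ x)).comp_hasFDerivAt x hd).fderiv, smul_apply, map_smul,
        ← inner_gradient, real_inner_self_eq_norm_sq]
      have : ‖gradient ρ x‖ = 1 := by rw [← hρ1 x hx]; simp [gradient]
      rw [this]
      simp
    · rw [image_eq_zero_of_notMem_tsupport hx]; simp
  have hdiv := integrable_div hv hvc
  have hcont : Continuous fun x => ε / (ε ^ 2 + ρ x ^ 2) * ζ x := by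
    refine Continuous.mul (Continuous.div continuous_const ?_ fun x => by positivity)
      hζ.continuous
    exact continuous_const.add (hρ.continuous.pow 2)
  have hint : Integrable fun x => ε / (ε ^ 2 + ρ x ^ 2) * ζ x :=
    hcont.integrable_of_hasCompactSupport hc.mul_left
  have h1 : ∫ x, ε / (ε ^ 2 + ρ x ^ 2) * ζ x
      ≤ Real.pi / 2 * ∫ x, |div (fun y => ζ y • gradient ρ y) x| := by
    simp only [hder] at hibp
    calc ∫ x, ε / (ε ^ 2 + ρ x ^ 2) * ζ x
        ≤ |∫ x, ((fun s : ℝ => Real.arctan (s / ε)) ∘ ρ) x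
            * div (fun y => ζ y • gradient ρ y) x| := by
          rw [hibp, abs_neg]; exact le_abs_self _
      _ ≤ ∫ x, |((fun s : ℝ => Real.arctan (s / ε)) ∘ ρ) x
            * div (fun y => ζ y • gradient ρ y) x| := abs_integral_le_integral_abs
      _ ≤ ∫ x, Real.pi / 2 * |div (fun y => ζ y • gradient ρ y) x| := by
          refine integral_mono_of_nonneg (Eventually.of_forall fun x => abs_nonneg _)
            (hdiv.abs.const_mul _) (Eventually.of_forall fun x => ?_)
          beta_reduce
          rw [abs_mul]
          refine mul_le_mul_of_nonneg_right ?_ (abs_nonneg _)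
          exact abs_le.2 ⟨(Real.neg_pi_div_two_lt_arctan _).le, (Real.arctan_lt_pi_div_two _).le⟩
      _ = _ := integral_const_mul _ _
  calc ∫ x, {x | |ρ x| ≤ ε}.indicator ζ x
      ≤ ∫ x, (2 * ε) * (ε / (ε ^ 2 + ρ x ^ 2) * ζ x) := by
        refine integral_mono_of_nonneg (Eventually.of_forall fun x =>
          indicator_nonneg (fun y _ => h0 y) x) (hint.const_mul _)
          (Eventually.of_forall fun x => ?_)
        by_cases hx : x ∈ {x | |ρ x| ≤ ε}
        · rw [indicator_of_mem hx]
          beta_reduce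
          rw [← mul_assoc]
          refine le_mul_of_one_le_left (h0 x) ?_
          have hx' : ρ x ^ 2 ≤ ε ^ 2 := by rw [← sq_abs]; gcongr; exact hx
          rw [← mul_div_assoc, one_le_div (by positivity)]
          nlinarith
        · rw [indicator_of_notMem hx]
          have := h0 x
          positivity
    _ = (2 * ε) * ∫ x, ε / (ε ^ 2 + ρ x ^ 2) * ζ x := integral_const_mul _ _
    _ ≤ (2 * ε) * (Real.pi / 2 * ∫ x, |div (fun y => ζ y • gradient ρ y) x|) := by gcongr
    _ = _ := by ring

/-! ### Differentiation of integrals over time slices -/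

theorem hasCompactSupport_slice {F : Type*} [Zero F] {f : ℝ × E n → F}
    (hc : HasCompactSupport f) (t : ℝ) : HasCompactSupport fun x => f (t, x) :=
  HasCompactSupport.intro (hc.isCompact.image continuous_snd) fun x hx =>
    image_eq_zero_of_notMem_tsupport fun h => hx ⟨(t, x), h, rfl⟩

theorem hasCompactSupport_dt {f : ℝ × E n → ℝ} (hc : HasCompactSupport f) :
    HasCompactSupport (dt f) := hc.fderiv_apply (𝕜 := ℝ) _

theorem exists_bound_integral_slice {f : ℝ × E n → ℝ} (hf : Continuous f)
    (hc : HasCompactSupport f) : ∃ C, ∀ t, ∫ x, |f (t, x)| ≤ C := by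
  obtain ⟨M, hM⟩ := hf.bounded_above_of_compact_support hc
  have hK : IsCompact (Prod.snd '' tsupport f) := hc.isCompact.image continuous_snd
  refine ⟨∫ x, (Prod.snd '' tsupport f).indicator (fun _ => M) x, fun t => ?_⟩
  refine integral_mono_of_nonneg (Eventually.of_forall fun x => abs_nonneg _)
    ((integrable_indicator_iff hK.measurableSet).2 (integrableOn_const hK.measure_lt_top.ne))
    (Eventually.of_forall fun x => ?_)
  by_cases hx : (t, x) ∈ tsupport f
  · rw [indicator_of_mem (mem_image_of_mem Prod.snd hx)]
    exact hM _
  · simp only [image_eq_zero_of_notMem_tsupport hx, abs_zero]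
    exact indicator_nonneg (fun _ _ => (norm_nonneg _).trans (hM (t, x))) x

/-- The measure is left general so that the restriction of volume to a fixed set is covered as well.
-/
theorem hasDerivAt_integral_slice {f : ℝ × E n → ℝ} (hf : ContDiff ℝ 1 f)
    (hc : HasCompactSupport f) {μ : Measure (E n)} [IsFiniteMeasureOnCompacts μ] (t : ℝ) :
    HasDerivAt (fun s => ∫ x, f (s, x) ∂μ) (∫ x, dt f (t, x) ∂μ) t := by
  have hdt : Continuous (dt f) := continuous_iff_continuousAt.2 fun q =>
    (contDiffAt_dt (m := 0) hf.contDiffAt (by norm_num)).continuousAt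
  obtain ⟨M, hM⟩ := hdt.bounded_above_of_compact_support (hasCompactSupport_dt hc)
  have hK : IsCompact (Prod.snd '' tsupport (dt f)) :=
    (hasCompactSupport_dt hc).isCompact.image continuous_snd
  refine (hasDerivAt_integral_of_dominated_loc_of_deriv_le (s := univ)
    (F := fun s x => f (s, x)) (F' := fun s x => dt f (s, x))
    (bound := (Prod.snd '' tsupport (dt f)).indicator fun _ => M) univ_mem ?_ ?_ ?_ ?_ ?_ ?_).2
  · exact Eventually.of_forall fun s => (hf.continuous.comp (by fun_prop)).aestronglyMeasurable
  · exact (hf.continuous.comp (by fun_prop)).integrable_of_hasCompactSupport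
      (hasCompactSupport_slice hc t)
  · exact (hdt.comp (by fun_prop)).aestronglyMeasurable
  · refine Eventually.of_forall fun x s _ => ?_
    by_cases hx : (s, x) ∈ tsupport (dt f)
    · rw [indicator_of_mem (mem_image_of_mem Prod.snd hx)]
      exact hM _
    · rw [image_eq_zero_of_notMem_tsupport hx, norm_zero]
      exact indicator_nonneg (fun _ _ => (norm_nonneg _).trans (hM (s, x))) x
  · exact (integrable_indicator_iff hK.measurableSet).2 (integrableOn_const hK.measure_lt_top.ne)
  · exact Eventually.of_forall fun x s _ =>
      hasDerivAt_slice (hf.differentiable (by norm_num) _)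

section
variable {Ω : Set (E n)} {T : ℝ} {Ωp : ℝ → Set (E n)}

theorem lipschitzWith_levelFn (t : ℝ) : LipschitzWith 1 fun x => levelFn Ωp (t, x) :=
  lipschitzWith_signedDistance (Ωp t)

theorem continuous_dx {f : ℝ × E n → ℝ} (hf : ContDiff ℝ 1 f) (i : Fin n) : Continuous (dx i f) :=
  continuous_iff_continuousAt.2 fun _ =>
    (contDiffAt_dx (m := 0) hf.contDiffAt (by norm_num) i).continuousAt

theorem div_slice {f : Fin n → ℝ × E n → ℝ} {t : ℝ} {x : E n}
    (hf : ∀ i, DifferentiableAt ℝ (f i) (t, x)) :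
    div (fun y => WithLp.toLp 2 fun i => f i (t, y)) x = ∑ i, dx i (f i) (t, x) := by
  rw [div_eq_sum]
  · exact Finset.sum_congr rfl fun i _ => partialD_slice (hf i) i
  · rw [differentiableAt_piLp]
    exact fun i => (hasFDerivAt_slice (hf i)).differentiableAt

theorem contDiff_mul_of_tsupport {V : Type*} [NormedAddCommGroup V] [NormedSpace ℝ V]
    {k : WithTop ℕ∞} {f g : V → ℝ} (hf : ContDiff ℝ k f)
    (hg : ∀ x ∈ tsupport f, ContDiffAt ℝ k g x) : ContDiff ℝ k fun x => f x * g x :=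
  contDiff_cutoff_smul hf hg

/-- The measure of thin layers around the interface, uniformly in time. -/
theorem exists_bound_layer {ζ : ℝ × E n → ℝ} (hζ : ContDiff ℝ 1 ζ)
    (hc : HasCompactSupport ζ) (h0 : ∀ q, 0 ≤ ζ q) (hζt : tsupport ζ ⊆ tube Ω T Ωp) :
    ∃ C, ∀ t, ∀ ε > 0,
      ∫ x, {x | |levelFn Ωp (t, x)| ≤ ε}.indicator (fun x => ζ (t, x)) x ≤ C * ε := by
  have hw : ∀ i, ContDiff ℝ 1 fun q => ζ q * dx i (levelFn Ωp) q := fun i =>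
    contDiff_mul_of_tsupport hζ fun q hq =>
      contDiffAt_dx (contDiffAt_levelFn (hζt hq)) (by norm_num) i
  have hwc : ∀ i, HasCompactSupport fun q => ζ q * dx i (levelFn Ωp) q := fun i => hc.mul_right
  -- The spatial divergence of ζ∇d is continuous with compact support in space-time, so its integral
  -- over slices is bounded uniformly in time.
  obtain ⟨C, hC⟩ := exists_bound_integral_slice
    (f := fun q => ∑ i, dx i (fun q => ζ q * dx i (levelFn Ωp) q) q)
    (continuous_finsetSum _ fun i _ => continuous_dx (hw i) i)
    (by
      refine HasCompactSupport.intro' hc (isClosed_tsupport ζ) fun q hq => ?_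
      refine Finset.sum_eq_zero fun i _ => ?_
      have : (fun q => ζ q * dx i (levelFn Ωp) q) =ᶠ[𝓝 q] fun _ => 0 := by
        filter_upwards [notMem_tsupport_iff_eventuallyEq.1 hq] with p hp
        simp [hp]
      rw [dx, this.fderiv_eq]
      simp)
  refine ⟨Real.pi * C, fun t ε hε => ?_⟩
  have hts : ∀ x ∈ tsupport (fun x => ζ (t, x)), (t, x) ∈ tsupport ζ := fun x hx => by
    have := (isClosed_tsupport ζ).preimage (show Continuous fun x : E n => (t, x) by fun_prop)
    have hsub : Function.support (fun x => ζ (t, x)) ⊆ (fun x : E n => (t, x)) ⁻¹' tsupport ζ :=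
      fun y hy => subset_tsupport ζ hy
    exact closure_minimal hsub this hx
  have hζs : ContDiff ℝ 1 fun x => ζ (t, x) :=
    contDiff_iff_contDiffAt.2 fun x => contDiffAt_slice hζ.contDiffAt
  refine (integral_layer_le (lipschitzWith_levelFn t) hζs (hasCompactSupport_slice hc t)
    (fun x => h0 _) (fun x hx => ?_) (fun x hx => ?_) hε).trans ?_
  · exact (contDiffAt_slice (contDiffAt_levelFn (hζt (hts x hx)))).of_le (by norm_num)
  · have h1 := sum_dx_levelFn_sq (hζt (hts x hx))
    simp only [← partialD_slice (differentiableAt_levelFn (hζt (hts x hx)))] at h1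
    rw [sum_partialD_sq] at h1
    exact (pow_eq_one_iff_of_nonneg (norm_nonneg _) two_ne_zero).1 h1
  · have h2 : ∀ x, div (fun y => ζ (t, y) • gradient (fun x => levelFn Ωp (t, x)) y) x
        = ∑ i, dx i (fun q => ζ q * dx i (levelFn Ωp) q) (t, x) := by
      intro x
      rw [← div_slice (f := fun i q => ζ q * dx i (levelFn Ωp) q)
        fun i => (hw i).differentiable (by norm_num) _]
      congr 1
      ext y i
      by_cases hy : (t, y) ∈ tsupport ζ
      · simp [gradient_apply, partialD_slice (differentiableAt_levelFn (hζt hy))]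
      · simp [image_eq_zero_of_notMem_tsupport hy]
    simp only [h2]
    rw [mul_assoc, mul_assoc, mul_comm C ε]
    have := hC t
    gcongr

end


end

section

variable {n : ℕ}

/-! ### The transport theorem -/

section
variable {Ω : Set (E n)} {T : ℝ} {Ωp : ℝ → Set (E n)}

/-- The interface lies in every layer |d| ≤ ε, whose volume near the interface is O(ε). -/
theorem volume_interface_eq_zero (hΩ : IsOpen Ω) (hΩb : Bornology.IsBounded Ω)
    (h : IsEvolvingInterface Ω T Ωp) {t : ℝ} (ht : t ∈ Ioo 0 T) :
    volume (interface Ωp t) = 0 := by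
  have hK : IsCompact (interface Ωp t) := h.isCompact_interface hΩb ht
  have hK' : IsCompact ((fun x : E n => (t, x)) '' interface Ωp t) :=
    hK.image (by fun_prop)
  obtain ⟨ζ, hζ, hζc, hζO, hζ1, hζ01⟩ := exists_cutoff hK' (isOpen_tube (T := T) (Ωp := Ωp) hΩ) (by
    rintro _ ⟨x, hx, rfl⟩
    exact h.mem_tube ht hx)
  obtain ⟨C, hC⟩ := exists_bound_layer (hζ.of_le (by norm_cast)) hζc (fun q => (hζ01 q).1) hζO
  have hle : ∀ ε > 0, (volume (interface Ωp t)).toReal ≤ C * ε := by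
    intro ε hε
    refine le_trans ?_ (hC t ε hε)
    have h1 : (volume (interface Ωp t)).toReal
        = ∫ x, (interface Ωp t).indicator (fun _ => (1 : ℝ)) x := by
      rw [integral_indicator hK.measurableSet]
      simp [Measure.real]
    rw [h1]
    have hmeas : MeasurableSet {x : E n | |levelFn Ωp (t, x)| ≤ ε} :=
      measurableSet_le (lipschitzWith_levelFn t).continuous.abs.measurable measurable_const
    refine integral_mono_of_nonneg (Eventually.of_forall fun x =>
      indicator_nonneg (fun _ _ => zero_le_one) x) ?_ (Eventually.of_forall fun x => ?_)
    · refine Integrable.indicator ?_ hmeas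
      exact (hζ.continuous.comp (by fun_prop)).integrable_of_hasCompactSupport
        (hasCompactSupport_slice hζc t)
    · by_cases hx : x ∈ interface Ωp t
      · have h2 : levelFn Ωp (t, x) = 0 := (levelFn_eq_zero_iff (h.mem_tube ht hx)).2 hx
        have hx' : x ∈ {x : E n | |levelFn Ωp (t, x)| ≤ ε} := by
          rw [mem_ofPred_eq, h2, abs_zero]; exact hε.le
        rw [indicator_of_mem hx, indicator_of_mem hx',
          (hζ1 (t, x) (mem_image_of_mem _ hx)).self_of_nhds]
      · rw [indicator_of_notMem hx]
        exact indicator_nonneg (fun _ _ => (hζ01 _).1) x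
  have h0 : (volume (interface Ωp t)).toReal ≤ 0 := by
    have ht0 : Tendsto (fun ε : ℝ => C * ε) (𝓝[>] 0) (𝓝 0) := by
      have : Continuous fun ε : ℝ => C * ε := by fun_prop
      have := (this.tendsto 0).mono_left (nhdsWithin_le_nhds (s := Ioi (0 : ℝ)))
      simpa using this
    exact ge_of_tendsto ht0 (by filter_upwards [self_mem_nhdsWithin] with ε hε using hle ε hε)
  have h1 := le_antisymm h0 ENNReal.toReal_nonneg
  rcases (ENNReal.toReal_eq_zero_iff _).1 h1 with h2 | h2
  · exact h2
  · exact absurd h2 hK.measure_lt_top.ne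

/-- The rate of change of `f`, transported with the interface. -/
def transported (Ωp : ℝ → Set (E n)) (f : ℝ × E n → ℝ) (q : ℝ × E n) : ℝ :=
  dt f q - ∑ i, dx i (fun p => f p * (dt (levelFn Ωp) p * dx i (levelFn Ωp) p)) q

theorem dx_eq_zero {f : ℝ × E n → ℝ} {q : ℝ × E n} (h : f =ᶠ[𝓝 q] fun _ => 0) (i : Fin n) :
    dx i f q = 0 := by
  rw [dx, h.fderiv_eq]
  simp

theorem contDiff_mul_velocity {f : ℝ × E n → ℝ} (hf : ContDiff ℝ 1 f)
    (hft : tsupport f ⊆ tube Ω T Ωp) (i : Fin n) :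
    ContDiff ℝ 1 fun p => f p * (dt (levelFn Ωp) p * dx i (levelFn Ωp) p) :=
  contDiff_mul_of_tsupport hf fun q hq =>
    (contDiffAt_dt (contDiffAt_levelFn (hft hq)) (by norm_num)).mul
      (contDiffAt_dx (contDiffAt_levelFn (hft hq)) (by norm_num) i)

theorem transported_eq_zero {f : ℝ × E n → ℝ} {q : ℝ × E n} (hq : q ∉ tsupport f) :
    transported Ωp f q = 0 := by
  have h0 := notMem_tsupport_iff_eventuallyEq.1 hq
  have h1 : ∀ i, (fun p => f p * (dt (levelFn Ωp) p * dx i (levelFn Ωp) p)) =ᶠ[𝓝 q]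
      fun _ => 0 := fun i => by
    filter_upwards [h0] with p hp
    simp [hp]
  rw [transported, dt, h0.fderiv_eq, Finset.sum_eq_zero fun i _ => dx_eq_zero (h1 i) i]
  simp

theorem continuous_transported {f : ℝ × E n → ℝ} (hf : ContDiff ℝ 1 f)
    (hft : tsupport f ⊆ tube Ω T Ωp) : Continuous (transported Ωp f) :=
  (continuous_iff_continuousAt.2 fun _ =>
    (contDiffAt_dt (m := 0) hf.contDiffAt (by norm_num)).continuousAt).sub
    (continuous_finsetSum _ fun i _ => continuous_dx (contDiff_mul_velocity hf hft i) i)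

theorem hasCompactSupport_transported {f : ℝ × E n → ℝ} (hc : HasCompactSupport f) :
    HasCompactSupport (transported Ωp f) :=
  HasCompactSupport.intro' hc (isClosed_tsupport f) fun _ hq => transported_eq_zero hq

/-- The interface moves with the field Vν = -∂ₜd ∇d. A function of d is carried along by it, since
∂ₜd - ∂ₜd|∇d|² = 0. Hence the derivative of the step cancels, and only the transported rate and a
divergence remain. -/
theorem dt_step_mul {f : ℝ × E n → ℝ} (hf : ContDiff ℝ 1 f)
    (hft : tsupport f ⊆ tube Ω T Ωp) (ε : ℝ) (q : ℝ × E n) :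
    dt (fun p => f p * step ε (levelFn Ωp p)) q = step ε (levelFn Ωp q) * transported Ωp f q
      + ∑ i, dx i (fun p => f p * (dt (levelFn Ωp) p * dx i (levelFn Ωp) p)
        * step ε (levelFn Ωp p)) q := by
  by_cases hq : q ∈ tsupport f
  · have hD := differentiableAt_levelFn (hft hq)
    set c := deriv Real.smoothTransition (levelFn Ωp q / ε) / ε
    have hs : HasFDerivAt (fun p => step ε (levelFn Ωp p)) (c • fderiv ℝ (levelFn Ωp) q) q :=
      (hasDerivAt_step ε (levelFn Ωp q)).comp_hasFDerivAt q hD.hasFDerivAt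
    have h1 := ((hf.differentiable (by norm_num) q).hasFDerivAt.mul hs).fderiv
    have h2 : ∀ i, dx i (fun p => f p * (dt (levelFn Ωp) p * dx i (levelFn Ωp) p)
        * step ε (levelFn Ωp p)) q
        = f q * (dt (levelFn Ωp) q * dx i (levelFn Ωp) q) * (c * dx i (levelFn Ωp) q)
          + step ε (levelFn Ωp q)
            * dx i (fun p => f p * (dt (levelFn Ωp) p * dx i (levelFn Ωp) p)) q := by
      intro i
      have h3 := (((contDiff_mul_velocity hf hft i).differentiable
        (by norm_num) q).hasFDerivAt.mul hs).fderiv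
      rw [dx]
      erw [h3]
      simp [dx]
    simp only [h2, Finset.sum_add_distrib, transported]
    rw [dt]
    erw [h1]
    have h4 : ∑ i, f q * (dt (levelFn Ωp) q * dx i (levelFn Ωp) q) * (c * dx i (levelFn Ωp) q)
        = f q * dt (levelFn Ωp) q * c := by
      calc _ = ∑ i, f q * dt (levelFn Ωp) q * c * dx i (levelFn Ωp) q ^ 2 :=
            Finset.sum_congr rfl fun i _ => by ring
        _ = _ := by rw [← Finset.mul_sum, sum_dx_levelFn_sq (hft hq), mul_one]
    rw [h4, ← Finset.mul_sum]
    simp [dt]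
    ring
  · have h0 := notMem_tsupport_iff_eventuallyEq.1 hq
    have h1 : (fun p => f p * step ε (levelFn Ωp p)) =ᶠ[𝓝 q] fun _ => 0 := by
      filter_upwards [h0] with p hp
      simp [hp]
    have h2 : ∀ i, (fun p => f p * (dt (levelFn Ωp) p * dx i (levelFn Ωp) p)
        * step ε (levelFn Ωp p)) =ᶠ[𝓝 q] fun _ => 0 := fun i => by
      filter_upwards [h0] with p hp
      simp [hp]
    rw [transported_eq_zero hq, dt, h1.fderiv_eq, Finset.sum_eq_zero fun i _ => dx_eq_zero (h2 i) i]
    simp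

/-- Replace the indicator of d > 0 by a smooth step. The derivative is then the step times the
transported rate, because the divergence integrates to zero. As ε → 0 these derivatives converge
uniformly in time, by the layer bound, and uniform convergence permits the exchange of limit and
derivative. -/
theorem hasDerivAt_integral_pos (hΩ : IsOpen Ω) {f : ℝ × E n → ℝ} (hf : ContDiff ℝ 1 f)
    (hc : HasCompactSupport f) (hft : tsupport f ⊆ tube Ω T Ωp) (t : ℝ) :
    HasDerivAt (fun s => ∫ x, if 0 < levelFn Ωp (s, x) then f (s, x) else 0)
      (∫ x, if 0 < levelFn Ωp (t, x) then transported Ωp f (t, x) else 0) t := by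
  have hm := continuous_transported hf hft
  have hmc : HasCompactSupport (transported Ωp f) := hasCompactSupport_transported hc
  have hsl : ∀ s : ℝ, Continuous fun x : E n => (s, x) := fun s => by fun_prop
  have hmi : ∀ s, Integrable fun x => transported Ωp f (s, x) := fun s =>
    (hm.comp (hsl s)).integrable_of_hasCompactSupport (hasCompactSupport_slice hmc s)
  have hfi : ∀ s, Integrable fun x => f (s, x) := fun s =>
    (hf.continuous.comp (hsl s)).integrable_of_hasCompactSupport (hasCompactSupport_slice hc s)
  have hstep : ∀ ε q, q ∈ tube Ω T Ωp → ContDiffAt ℝ 1 (fun p => step ε (levelFn Ωp p)) q :=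
    fun ε q hq => (by exact_mod_cast (contDiff_step ε 1).contDiffAt :
      ContDiffAt ℝ 1 (step ε) (levelFn Ωp q)).comp q
        ((contDiffAt_levelFn hq).of_le (by norm_num))
  have hk : ∀ ε, ContDiff ℝ 1 fun p => f p * step ε (levelFn Ωp p) := fun ε =>
    contDiff_mul_of_tsupport hf fun q hq => hstep ε q (hft hq)
  have hv : ∀ ε i, ContDiff ℝ 1 fun p => f p * (dt (levelFn Ωp) p * dx i (levelFn Ωp) p)
      * step ε (levelFn Ωp p) := fun ε i =>
    contDiff_mul_of_tsupport (contDiff_mul_velocity hf hft i) fun q hq =>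
      hstep ε q (hft (closure_mono (Function.support_mul_subset_left _ _) hq))
  have hvz : ∀ ε q, q ∉ tsupport f → ∀ i, f q * (dt (levelFn Ωp) q * dx i (levelFn Ωp) q)
      * step ε (levelFn Ωp q) = 0 := fun ε q hq i => by
    rw [image_eq_zero_of_notMem_tsupport hq, zero_mul, zero_mul]
  have hder : ∀ ε s, HasDerivAt (fun s => ∫ x, f (s, x) * step ε (levelFn Ωp (s, x)))
      (∫ x, step ε (levelFn Ωp (s, x)) * transported Ωp f (s, x)) s := by
    intro ε s
    have h1 := hasDerivAt_integral_slice (μ := volume) (hk ε) hc.mul_right s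
    have h2 : ∫ x, dt (fun p => f p * step ε (levelFn Ωp p)) (s, x)
        = ∫ x, step ε (levelFn Ωp (s, x)) * transported Ωp f (s, x) := by
      simp only [dt_step_mul hf hft]
      set v : E n → E n := fun y => WithLp.toLp 2 fun i =>
        f (s, y) * (dt (levelFn Ωp) (s, y) * dx i (levelFn Ωp) (s, y))
          * step ε (levelFn Ωp (s, y)) with hvdef
      have hvC : ContDiff ℝ 1 v := by
        rw [contDiff_piLp]
        exact fun i => (hv ε i).comp (contDiff_const.prodMk contDiff_id)
      have hvc : HasCompactSupport v :=
        HasCompactSupport.intro (hc.isCompact.image continuous_snd) fun x hx => by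
          have hx' : (s, x) ∉ tsupport f := fun h => hx (mem_image_of_mem Prod.snd h)
          ext i
          exact hvz ε (s, x) hx' i
      have h3 : ∀ x, ∑ i, dx i (fun p => f p * (dt (levelFn Ωp) p * dx i (levelFn Ωp) p)
          * step ε (levelFn Ωp p)) (s, x) = div v x := fun x =>
        (div_slice (f := fun i p => f p * (dt (levelFn Ωp) p * dx i (levelFn Ωp) p)
          * step ε (levelFn Ωp p)) fun i => (hv ε i).differentiable (by norm_num) _).symm
      simp only [h3]
      rw [integral_add _ (integrable_div hvC hvc), integral_div_eq_zero hvC hvc, add_zero]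
      refine (hmi s).bdd_mul (c := 1) ?_ (Eventually.of_forall fun x => ?_)
      · exact ((contDiff_step ε 0).continuous.comp
          (lipschitzWith_levelFn s).continuous).aestronglyMeasurable
      · rw [Real.norm_of_nonneg (step_mem_Icc _ _).1]
        exact (step_mem_Icc _ _).2
    rw [← h2]
    exact h1
  refine hasDerivAt_of_tendstoUniformly (l := 𝓝[>] (0 : ℝ))
    (f := fun ε s => ∫ x, f (s, x) * step ε (levelFn Ωp (s, x)))
    (f' := fun ε s => ∫ x, step ε (levelFn Ωp (s, x)) * transported Ωp f (s, x))
    (g' := fun s => ∫ x, if 0 < levelFn Ωp (s, x) then transported Ωp f (s, x) else 0)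
    ?_ (Eventually.of_forall hder) (fun s => ?_) t
  · obtain ⟨ζ, hζ, hζc, hζO, hζ1, hζ01⟩ := exists_cutoff hc.isCompact
      (isOpen_tube (T := T) (Ωp := Ωp) hΩ) hft
    obtain ⟨C, hC⟩ := exists_bound_layer (hζ.of_le (by norm_cast)) hζc (fun q => (hζ01 q).1) hζO
    obtain ⟨M, hM⟩ := hm.bounded_above_of_compact_support hmc
    have hM0 : 0 ≤ M := (norm_nonneg _).trans (hM (0, 0))
    have hbound : ∀ ε > 0, ∀ s,
        dist (∫ x, if 0 < levelFn Ωp (s, x) then transported Ωp f (s, x) else 0)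
          (∫ x, step ε (levelFn Ωp (s, x)) * transported Ωp f (s, x)) ≤ M * (C * ε) := by
      intro ε hε s
      have hmeas : MeasurableSet {x : E n | |levelFn Ωp (s, x)| ≤ ε} :=
        measurableSet_le (lipschitzWith_levelFn s).continuous.abs.measurable measurable_const
      have hmeas' : MeasurableSet {x : E n | 0 < levelFn Ωp (s, x)} :=
        measurableSet_lt measurable_const (lipschitzWith_levelFn s).continuous.measurable
      have hi1 : Integrable fun x => if 0 < levelFn Ωp (s, x) then transported Ωp f (s, x)
          else 0 := (hmi s).indicator hmeas'
      have hi2 : Integrable fun x => step ε (levelFn Ωp (s, x)) * transported Ωp f (s, x) := by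
        refine (hmi s).bdd_mul (c := 1) ?_ (Eventually.of_forall fun x => ?_)
        · exact ((contDiff_step ε 0).continuous.comp
            (lipschitzWith_levelFn s).continuous).aestronglyMeasurable
        · rw [Real.norm_of_nonneg (step_mem_Icc _ _).1]
          exact (step_mem_Icc _ _).2
      rw [dist_eq_norm, ← integral_sub hi1 hi2]
      -- Indicator and step differ only for 0 < d < ε, and there by at most one.
      calc _ ≤ ∫ x, M * {x | |levelFn Ωp (s, x)| ≤ ε}.indicator (fun x => ζ (s, x)) x := by
            refine norm_integral_le_of_norm_le ?_ (Eventually.of_forall fun x => ?_)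
            · refine (Integrable.indicator ?_ hmeas).const_mul M
              exact (hζ.continuous.comp (hsl s)).integrable_of_hasCompactSupport
                (hasCompactSupport_slice hζc s)
            · have hrhs : 0 ≤ M * {x | |levelFn Ωp (s, x)| ≤ ε}.indicator
                  (fun x => ζ (s, x)) x :=
                mul_nonneg hM0 (indicator_nonneg (fun _ _ => (hζ01 _).1) x)
              by_cases hx : (s, x) ∈ tsupport f
              · rcases le_or_gt (levelFn Ωp (s, x)) 0 with h0 | h0
                · rw [if_neg (not_lt.2 h0), step_of_nonpos hε h0]
                  simpa using hrhs
                · rcases le_or_gt ε (levelFn Ωp (s, x)) with h1 | h1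
                  · rw [if_pos h0, step_of_le hε h1]
                    simpa using hrhs
                  · have hx' : x ∈ {x : E n | |levelFn Ωp (s, x)| ≤ ε} := by
                      rw [mem_ofPred_eq, abs_of_pos h0]; exact h1.le
                    rw [if_pos h0, indicator_of_mem hx', (hζ1 _ hx).self_of_nhds, mul_one]
                    have h2 := step_mem_Icc ε (levelFn Ωp (s, x))
                    calc _ = ‖(1 - step ε (levelFn Ωp (s, x))) * transported Ωp f (s, x)‖ := by
                          congr 1; ring
                      _ ≤ 1 * ‖transported Ωp f (s, x)‖ := by
                          rw [norm_mul, Real.norm_of_nonneg (by linarith [h2.2])]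
                          gcongr
                          linarith [h2.1]
                      _ ≤ M := by rw [one_mul]; exact hM _
              · rw [transported_eq_zero hx]
                simpa using hrhs
        _ = M * ∫ x, {x | |levelFn Ωp (s, x)| ≤ ε}.indicator (fun x => ζ (s, x)) x :=
            integral_const_mul _ _
        _ ≤ M * (C * ε) := by
            have := hC s ε hε
            gcongr
    rw [Metric.tendstoUniformly_iff]
    intro δ hδ
    have ht0 : Tendsto (fun ε : ℝ => M * (C * ε)) (𝓝[>] 0) (𝓝 0) := by
      have : Continuous fun ε : ℝ => M * (C * ε) := by fun_prop
      have := (this.tendsto 0).mono_left (nhdsWithin_le_nhds (s := Ioi (0 : ℝ)))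
      simpa using this
    filter_upwards [self_mem_nhdsWithin, ht0.eventually (gt_mem_nhds hδ)] with ε hε hlt s
    exact (hbound ε hε s).trans_lt hlt
  · have := tendsto_integral_step (lipschitzWith_levelFn
      (Ωp := Ωp) s).continuous.aestronglyMeasurable (hfi s)
    simpa only [mul_comm] using this

/-- The transport theorem for the inner phase. -/
theorem IsEvolvingInterface.hasDerivAt_integral (hΩ : IsOpen Ω)
    (h : IsEvolvingInterface Ω T Ωp) {f : ℝ × E n → ℝ} (hf : ContDiff ℝ 1 f)
    (hc : HasCompactSupport f) (hft : tsupport f ⊆ tube Ω T Ωp) {t : ℝ} (ht : t ∈ Ioo 0 T) :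
    HasDerivAt (fun s => ∫ x in Ωp s, f (s, x)) (∫ x in Ωp t, transported Ωp f (t, x)) t := by
  -- Inside the tube, positivity of the level function is the same as membership in the inner phase;
  -- outside it the integrand vanishes.
  have key : ∀ g : ℝ × E n → ℝ, (∀ q ∉ tsupport f, g q = 0) → ∀ s ∈ Ioo 0 T,
      ∫ x in Ωp s, g (s, x) = ∫ x, if 0 < levelFn Ωp (s, x) then g (s, x) else 0 := by
    intro g hg s hs
    rw [← integral_indicator (h.isOpen_phase hs).measurableSet]
    congr 1
    ext x
    by_cases hx : (s, x) ∈ tsupport f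
    · have hiff := h.levelFn_pos_iff (hft hx)
      by_cases hxΩ : x ∈ Ωp s
      · rw [indicator_of_mem hxΩ, if_pos (hiff.2 hxΩ)]
      · rw [indicator_of_notMem hxΩ, if_neg fun h' => hxΩ (hiff.1 h')]
    · simp [indicator, hg _ hx]
  rw [key _ (fun q hq => transported_eq_zero hq) t ht]
  refine (hasDerivAt_integral_pos hΩ hf hc hft t).congr_of_eventuallyEq ?_
  filter_upwards [isOpen_Ioo.mem_nhds ht] with s hs
  exact key f (fun q hq => image_eq_zero_of_notMem_tsupport hq) s hs

end


end

section

variable {n : ℕ}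

/-! ### Concentration of layers on a hyperplane -/

theorem integral_deriv_smoothTransition : ∫ s, deriv Real.smoothTransition s = 1 := by
  have h1 : ∫ s, deriv Real.smoothTransition s
      = ∫ s in (0 : ℝ)..1, deriv Real.smoothTransition s := by
    rw [intervalIntegral.integral_of_le zero_le_one, setIntegral_eq_integral_of_eq_zero]
    exact fun s hs => deriv_smoothTransition_of_notMem fun h => hs (Ioo_subset_Ioc_self h)
  rw [h1, intervalIntegral.integral_deriv_eq_sub
    (fun s _ => (Real.smoothTransition.contDiff (n := 1)).differentiable (by norm_num) s)
    (((Real.smoothTransition.contDiff (n := 1)).continuous_deriv (by norm_num)).intervalIntegrable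
      _ _)]
  simp

/-- The kernels form an approximate identity: nonnegative, of total mass one, and supported in [0,
ε]. The scaling parameter of the general peak theorem is ε⁻¹. -/
theorem tendsto_integral_step_deriv {G : ℝ → ℝ} (hG : Continuous G) (hGi : Integrable G) :
    Tendsto (fun ε => ∫ s, deriv Real.smoothTransition (s / ε) / ε * G s) (𝓝[>] 0)
      (𝓝 (G 0)) := by
  have hlim : Tendsto (fun x : ℝ => ‖x‖ ^ Module.finrank ℝ ℝ * deriv Real.smoothTransition x)
      (Bornology.cobounded ℝ) (𝓝 0) := by
    refine tendsto_const_nhds.congr' ?_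
    have : ∀ᶠ x : ℝ in Bornology.cobounded ℝ, x ∈ (Metric.closedBall (0 : ℝ) 1)ᶜ :=
      Bornology.isBounded_def.1 Metric.isBounded_closedBall
    filter_upwards [this] with x hx
    rw [deriv_smoothTransition_of_notMem, mul_zero]
    intro h
    refine hx ?_
    rw [Metric.mem_closedBall, dist_zero_right, Real.norm_of_nonneg h.1.le]
    exact h.2.le
  have := tendsto_integral_comp_smul_smul_of_integrable (μ := volume)
    deriv_smoothTransition_nonneg integral_deriv_smoothTransition hlim hGi hG.continuousAt
  have h2 := this.comp (tendsto_inv_nhdsGT_zero (𝕜 := ℝ))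
  refine h2.congr' ?_
  filter_upwards [self_mem_nhdsWithin] with ε hε
  simp only [Function.comp_apply, Module.finrank_self, pow_one, smul_eq_mul]
  congr 1
  ext s
  rw [div_eq_mul_inv, div_eq_mul_inv]
  ring_nf

section
open Module

/-- Splitting of Euclidean space along a unit vector. -/
def lineSplit (e : E n) (he : ‖e‖ = 1) :
    ℝ × (Submodule.span ℝ {e})ᗮ ≃ᵐ E n :=
  (MeasurableEquiv.prodCongr
    (LinearIsometryEquiv.toSpanUnitSingleton (𝕜 := ℝ) e he).toHomeomorph.toMeasurableEquiv
    (MeasurableEquiv.refl _)).trans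
    ((Submodule.span ℝ {e}).measurableEquivProd (0 : E n)).symm

theorem lineSplit_apply (e : E n) (he : ‖e‖ = 1) (p : ℝ × (Submodule.span ℝ {e})ᗮ) :
    lineSplit e he p = p.1 • e + p.2 := by
  have h1 : lineSplit e he p = ((Submodule.span ℝ {e}).measurableEquivProd (0 : E n)).symm
    (LinearIsometryEquiv.toSpanUnitSingleton (𝕜 := ℝ) e he p.1, p.2) := rfl
  rw [h1, Submodule.measurableEquivProd_symm_apply]
  simp

theorem measurePreserving_lineSplit (e : E n) (he : ‖e‖ = 1) :
    MeasurePreserving (lineSplit e he) (volume.prod volume) volume := by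
  have h1 := ((Submodule.span ℝ {e}).measurePreserving_measurableEquivProd (0 : E n)).symm
  rw [InnerProductSpace.euclideanHausdorffMeasure_eq_volume] at h1
  have h2 := (LinearIsometryEquiv.toSpanUnitSingleton (𝕜 := ℝ) e he).measurePreserving.prod
    (MeasurePreserving.id (volume : Measure (Submodule.span ℝ {e})ᗮ))
  exact h1.comp h2

/-- The inclusion of the hyperplane is an isometry, and on a Euclidean space of dimension n - 1 the
normalised Hausdorff measure is the volume. -/
theorem euclideanHausdorffMeasure_hyperplane (e : E n) (he : ‖e‖ = 1) :
    (μHE[n - 1] : Measure (E n)).restrict {z | ⟪e, z⟫_ℝ = 0}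
      = (volume : Measure (Submodule.span ℝ {e})ᗮ).map Subtype.val := by
  have he0 : e ≠ 0 := by rintro rfl; simp at he
  have hrank : finrank ℝ (Submodule.span ℝ {e})ᗮ = n - 1 := by
    have := (Submodule.span ℝ {e}).finrank_add_finrank_orthogonal
    rw [finrank_span_singleton he0, finrank_euclideanSpace_fin] at this
    omega
  have h1 := (isometry_subtype_coe
    (s := ((Submodule.span ℝ {e})ᗮ : Set (E n)))).map_euclideanHausdorffMeasure (d := n - 1)
  rw [Subtype.range_coe] at h1
  have h2 : ({z | ⟪e, z⟫_ℝ = 0} : Set (E n)) = ((Submodule.span ℝ {e})ᗮ : Set (E n)) := by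
    ext z
    exact Submodule.mem_orthogonal_singleton_iff_inner_right.symm
  rw [h2, ← h1, ← hrank]
  congr 1
  exact InnerProductSpace.euclideanHausdorffMeasure_eq_volume

/-- By Fubini along `e` the layer integral becomes one-dimensional, against the function `G` of
slice integrals. This function is continuous, so the approximate identity yields its value at 0. -/
theorem tendsto_integral_layer_hyperplane {e : E n} (he : ‖e‖ = 1) {g : E n → ℝ}
    (hg : Continuous g) (hc : HasCompactSupport g) :
    IntegrableOn g {z | ⟪e, z⟫_ℝ = 0} μHE[n - 1] ∧
    Tendsto (fun ε => ∫ z, deriv Real.smoothTransition (⟪e, z⟫_ℝ / ε) / ε * g z) (𝓝[>] 0)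
      (𝓝 (∫ z in {z | ⟪e, z⟫_ℝ = 0}, g z ∂μHE[n - 1])) := by
  set S := (Submodule.span ℝ {e})ᗮ with hS
  have hee : ⟪e, e⟫_ℝ = 1 := by rw [real_inner_self_eq_norm_sq, he]; norm_num
  have hemb : MeasurableEmbedding (Subtype.val : S → E n) :=
    MeasurableEmbedding.subtype_coe S.closed_of_finiteDimensional.measurableSet
  have hcl : IsClosedEmbedding (Subtype.val : S → E n) :=
    S.closed_of_finiteDimensional.isClosedEmbedding_subtypeVal
  have hgS : Integrable (fun y : S => g y) :=
    (hg.comp continuous_subtype_val).integrable_of_hasCompactSupport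
      (hc.comp_isClosedEmbedding hcl)
  have hcS : HasCompactSupport (fun p : ℝ × S => g (p.1 • e + p.2)) := by
    refine HasCompactSupport.intro ((hc.isCompact.image (f := fun z => ⟪e, z⟫_ℝ)
      (by fun_prop)).prod (hc.isCompact.image (f := S.orthogonalProjectionOnto)
        (by fun_prop))) fun p hp => ?_
    refine image_eq_zero_of_notMem_tsupport fun h => hp ?_
    refine ⟨⟨_, h, ?_⟩, ⟨_, h, ?_⟩⟩
    · have : ⟪e, (p.2 : E n)⟫_ℝ = 0 := Submodule.mem_orthogonal_singleton_iff_inner_right.1 p.2.2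
      beta_reduce
      rw [inner_add_right, inner_smul_right, hee, this]
      simp
    · rw [map_add, map_smul, Submodule.orthogonalProjectionOnto_mem_subspace_eq_self,
        Submodule.orthogonalProjectionOnto_orthogonalComplement_singleton_eq_zero]
      simp
  have hgp : Continuous fun p : ℝ × S => g (p.1 • e + p.2) := hg.comp (by fun_prop)
  have hgpi : Integrable (fun p : ℝ × S => g (p.1 • e + p.2)) (volume.prod volume) :=
    hgp.integrable_of_hasCompactSupport hcS
  set G : ℝ → ℝ := fun s => ∫ y : S, g (s • e + y) with hGdef
  have hGi : Integrable G := hgpi.integral_prod_left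
  have hGc : Continuous G := by
    obtain ⟨M, hM⟩ := hgp.bounded_above_of_compact_support hcS
    have hK : IsCompact (Prod.snd '' tsupport (fun p : ℝ × S => g (p.1 • e + p.2))) :=
      hcS.isCompact.image continuous_snd
    refine continuous_of_dominated (bound := (Prod.snd '' tsupport
      (fun p : ℝ × S => g (p.1 • e + p.2))).indicator fun _ => M) ?_ ?_ ?_ ?_
    · exact fun s => (hg.comp (by fun_prop)).aestronglyMeasurable
    · refine fun s => Eventually.of_forall fun y => ?_
      by_cases hy : (s, y) ∈ tsupport (fun p : ℝ × S => g (p.1 • e + p.2))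
      · rw [indicator_of_mem (mem_image_of_mem Prod.snd hy)]
        exact hM (s, y)
      · have h0 := image_eq_zero_of_notMem_tsupport hy
        simp only at h0
        rw [h0, norm_zero]
        exact indicator_nonneg (fun _ _ => (norm_nonneg _).trans (hM (s, y))) y
    · exact (integrable_indicator_iff hK.measurableSet).2
        (integrableOn_const hK.measure_lt_top.ne)
    · exact Eventually.of_forall fun y => hg.comp (by fun_prop)
  rw [IntegrableOn, euclideanHausdorffMeasure_hyperplane e he, hemb.integrable_map_iff,
    hemb.integral_map]
  refine ⟨hgS, ?_⟩
  have h0 : G 0 = ∫ y : S, g y := by simp [hGdef]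
  rw [← h0]
  refine (tendsto_integral_step_deriv hGc hGi).congr fun ε => ?_
  rw [← (measurePreserving_lineSplit e he).integral_comp (lineSplit e he).measurableEmbedding]
  have hpt : ∀ p : ℝ × S, deriv Real.smoothTransition (⟪e, lineSplit e he p⟫_ℝ / ε) / ε
      * g (lineSplit e he p)
      = deriv Real.smoothTransition (p.1 / ε) / ε * g (p.1 • e + p.2) := by
    intro p
    have : ⟪e, (p.2 : E n)⟫_ℝ = 0 := Submodule.mem_orthogonal_singleton_iff_inner_right.1 p.2.2
    rw [lineSplit_apply, inner_add_right, inner_smul_right, hee, this, mul_one, add_zero]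
  simp only [hpt]
  rw [integral_prod]
  · simp only [integral_const_mul, hGdef]
    rfl
  · have hcd : Continuous (deriv Real.smoothTransition) :=
      (Real.smoothTransition.contDiff (n := 1)).continuous_deriv (by norm_num)
    refine Continuous.integrable_of_hasCompactSupport ?_ hcS.mul_left
    exact ((hcd.comp (continuous_fst.div_const ε)).div_const ε).mul hgp

end


end

section

variable {n : ℕ}

/-! ### Bi-Lipschitz comparison of Hausdorff measures -/

open scoped ENNReal

theorem euclideanHausdorffMeasure_image_le {K : ℝ≥0} {f : E n → E n} {s : Set (E n)}
    (h : LipschitzOnWith K f s) (d : ℕ) : μHE[d] (f '' s) ≤ (K : ℝ≥0∞) ^ d * μHE[d] s := by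
  simp only [Measure.euclideanHausdorffMeasure_def, Measure.smul_apply]
  have := h.hausdorffMeasure_image_le (d := (d : ℝ)) (by positivity)
  rw [ENNReal.rpow_natCast] at this
  simp only [ENNReal.smul_def, smul_eq_mul]
  rw [mul_left_comm]
  gcongr

/-- On the image of `s` the inverse map is K-Lipschitz, so the pushed-forward Hausdorff measure is
at most K^d times the measure on the image. -/
theorem lintegral_comp_le_of_antilipschitz {K : ℝ≥0} {f : E n → E n} (hf : Measurable f)
    {s : Set (E n)} (hK : ∀ x ∈ s, ∀ y ∈ s, dist x y ≤ K * dist (f x) (f y)) (d : ℕ)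
    {k : E n → ℝ≥0∞} (hk : Measurable k) :
    ∫⁻ x in s, k (f x) ∂μHE[d] ≤ (K : ℝ≥0∞) ^ d * ∫⁻ z in f '' s, k z ∂μHE[d] := by
  have hle : (((μHE[d] : Measure (E n)).restrict s).map f)
      ≤ ((K : ℝ≥0∞) ^ d) • (μHE[d] : Measure (E n)).restrict (f '' s) := by
    refine Measure.le_iff.2 fun B hB => ?_
    rw [Measure.map_apply hf hB, Measure.restrict_apply (hf hB), Measure.smul_apply,
      Measure.restrict_apply hB, smul_eq_mul]
    set g := Function.invFunOn f s with hg
    have hinj : InjOn f s := fun x hx y hy hxy => by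
      have := hK x hx y hy
      rw [hxy, dist_self, mul_zero] at this
      exact dist_le_zero.1 this
    have hgf : ∀ x ∈ s, g (f x) = x := fun x hx => hinj.leftInvOn_invFunOn hx
    have hlip : LipschitzOnWith K g (f '' (s ∩ f ⁻¹' B)) := by
      refine LipschitzOnWith.of_dist_le_mul ?_
      rintro _ ⟨x, hx, rfl⟩ _ ⟨y, hy, rfl⟩
      rw [hgf x hx.1, hgf y hy.1]
      exact hK x hx.1 y hy.1
    have h1 := euclideanHausdorffMeasure_image_le hlip d
    have h2 : g '' (f '' (s ∩ f ⁻¹' B)) = f ⁻¹' B ∩ s := by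
      rw [← image_comp, inter_comm]
      refine (image_congr fun x hx => ?_).trans (image_id _)
      exact hgf x hx.2
    rw [h2] at h1
    refine h1.trans ?_
    gcongr
    rintro _ ⟨x, hx, rfl⟩
    exact ⟨hx.2, x, hx.1, rfl⟩
  rw [← lintegral_map hk hf]
  refine (lintegral_mono' hle le_rfl).trans ?_
  rw [lintegral_smul_measure, smul_eq_mul]

theorem lintegral_image_le_of_lipschitzOn {K : ℝ≥0} {f : E n → E n} (hf : Measurable f)
    {s : Set (E n)} (hK : LipschitzOnWith K f s) (d : ℕ)
    {k : E n → ℝ≥0∞} (hk : Measurable k) :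
    ∫⁻ z in f '' s, k z ∂μHE[d] ≤ (K : ℝ≥0∞) ^ d * ∫⁻ x in s, k (f x) ∂μHE[d] := by
  have hle : (μHE[d] : Measure (E n)).restrict (f '' s)
      ≤ ((K : ℝ≥0∞) ^ d) • (((μHE[d] : Measure (E n)).restrict s).map f) := by
    refine Measure.le_iff.2 fun B hB => ?_
    rw [Measure.smul_apply, Measure.map_apply hf hB, Measure.restrict_apply (hf hB),
      Measure.restrict_apply hB, smul_eq_mul]
    have h1 := euclideanHausdorffMeasure_image_le (hK.mono (inter_subset_right (s := f ⁻¹' B))) d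
    refine le_trans (measure_mono ?_) h1
    rintro _ ⟨hx, x, hxs, rfl⟩
    exact ⟨x, ⟨hx, hxs⟩, rfl⟩
  rw [← lintegral_map hk hf, ← smul_eq_mul, ← lintegral_smul_measure]
  exact lintegral_mono' hle le_rfl

/-- The kernel of a thin layer. -/
def layer (ε s : ℝ) : ℝ := deriv Real.smoothTransition (s / ε) / ε

theorem layer_nonneg {ε : ℝ} (hε : 0 < ε) (s : ℝ) : 0 ≤ layer ε s :=
  div_nonneg (deriv_smoothTransition_nonneg _) hε.le

theorem continuous_layer (ε : ℝ) : Continuous (layer ε) :=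
  (((Real.smoothTransition.contDiff (n := 1)).continuous_deriv (by norm_num)).comp
    (continuous_id.div_const ε)).div_const ε

/-- Near a point where the gradient is a unit vector, thin layers and the surface measure of the
level set are comparable, with constants close to one. -/
theorem exists_nhds_layer_comparison {ρ : E n → ℝ} (hρ : Continuous ρ) {x₀ : E n}
    (hd : ContDiffAt ℝ 1 ρ x₀) (h1 : ‖fderiv ℝ ρ x₀‖ = 1) {K : ℝ≥0} (hK : 1 < K) :
    ∃ U ∈ 𝓝 x₀, ∀ ζ : E n → ℝ, Continuous ζ → HasCompactSupport ζ → (∀ x, 0 ≤ ζ x) →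
      tsupport ζ ⊆ U → ∀ a, Tendsto (fun ε => ∫ x, layer ε (ρ x) * ζ x) (𝓝[>] 0) (𝓝 a) →
        ENNReal.ofReal a ≤ (K : ℝ≥0∞) ^ (2 * n)
          * ∫⁻ x in {x | ρ x = 0}, ENNReal.ofReal (ζ x) ∂μHE[n - 1] ∧
        ∫⁻ x in {x | ρ x = 0}, ENNReal.ofReal (ζ x) ∂μHE[n - 1]
          ≤ (K : ℝ≥0∞) ^ (2 * n) * ENNReal.ofReal a := by
  set e := gradient ρ x₀ with he_def
  have he : ‖e‖ = 1 := by rw [he_def, ← h1]; simp [gradient]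
  have hee : ⟪e, e⟫_ℝ = 1 := by rw [real_inner_self_eq_norm_sq, he]; norm_num
  -- Replacing the coordinate along `e` by ρ sends {ρ = 0} into the hyperplane orthogonal to `e`.
  -- With `e` the gradient at x₀, the differential of Ψ at x₀ is the identity, so Ψ is nearly an
  -- isometry close to x₀.
  set Ψ : E n → E n := fun x => x + (ρ x - ⟪e, x⟫_ℝ) • e with hΨ
  have hΨc : Continuous Ψ := by fun_prop
  have hΨe : ∀ x, ⟪e, Ψ x⟫_ℝ = ρ x := fun x => by
    rw [hΨ]
    beta_reduce
    rw [inner_add_right, inner_smul_right, hee]; ring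
  have hstrict : HasStrictFDerivAt Ψ
      ((ContinuousLinearEquiv.refl ℝ (E n) : E n ≃L[ℝ] E n) : E n →L[ℝ] E n) x₀ := by
    have h2 : HasStrictFDerivAt ρ (fderiv ℝ ρ x₀) x₀ := hd.hasStrictFDerivAt (by norm_num)
    have h3 : HasStrictFDerivAt (fun x => ρ x - ⟪e, x⟫_ℝ) (fderiv ℝ ρ x₀ - innerSL ℝ e) x₀ :=
      h2.sub (innerSL ℝ e).hasStrictFDerivAt
    have h4 : fderiv ℝ ρ x₀ - innerSL ℝ e = 0 := by
      ext z
      simp [he_def]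
    rw [h4] at h3
    convert! (hasStrictFDerivAt_id x₀).add (h3.smul_const e) using 1
    ext z
    simp
  have hK0 : 0 < K := zero_lt_one.trans hK
  -- With this defect, 1 - c = 1/K gives the antilipschitz bound, and 1 + c = 2 - 1/K ≤ K the
  -- Lipschitz bound.
  set c : ℝ≥0 := 1 - K⁻¹ with hc_def
  have hKi : K⁻¹ < 1 := inv_lt_one_of_one_lt₀ hK
  have hcK : (c : ℝ) = 1 - (K : ℝ)⁻¹ := by
    rw [hc_def, NNReal.coe_sub hKi.le]; simp
  have hc0 : 0 < c := tsub_pos_of_lt hKi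
  have hK0' : (0 : ℝ) < K := by exact_mod_cast hK0
  have hK1' : (1 : ℝ) < K := by exact_mod_cast hK
  obtain ⟨s, hs, happ⟩ := hstrict.approximates_deriv_on_nhds (Or.inr hc0)
  obtain ⟨U, hUs, hU, hxU⟩ := mem_nhds_iff.1 hs
  have happ := happ.mono_set hUs
  have hdist : ∀ x ∈ U, ∀ y ∈ U, ‖Ψ x - Ψ y - (x - y)‖ ≤ c * ‖x - y‖ := fun x hx y hy =>
    happ x hx y hy
  have hanti : ∀ x ∈ U, ∀ y ∈ U, dist x y ≤ K * dist (Ψ x) (Ψ y) := by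
    intro x hx y hy
    have h2 := hdist x hx y hy
    have h3 : ‖x - y‖ ≤ ‖Ψ x - Ψ y‖ + ‖Ψ x - Ψ y - (x - y)‖ := by
      have := norm_sub_le (Ψ x - Ψ y) (Ψ x - Ψ y - (x - y))
      rwa [sub_sub_cancel] at this
    rw [dist_eq_norm, dist_eq_norm]
    have h4 : (K : ℝ)⁻¹ * ‖x - y‖ ≤ ‖Ψ x - Ψ y‖ := by
      rw [hcK] at h2
      linarith
    rwa [inv_mul_le_iff₀ hK0'] at h4
  have hlip : LipschitzOnWith K Ψ U := by
    refine LipschitzOnWith.of_dist_le_mul fun x hx y hy => ?_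
    have h2 := hdist x hx y hy
    have h3 : ‖Ψ x - Ψ y‖ ≤ ‖Ψ x - Ψ y - (x - y)‖ + ‖x - y‖ := by
      have := norm_add_le (Ψ x - Ψ y - (x - y)) (x - y)
      rwa [sub_add_cancel] at this
    rw [dist_eq_norm, dist_eq_norm]
    have h5 : (c : ℝ) + 1 ≤ K := by
      rw [hcK]
      have h6 : (K : ℝ) * (K : ℝ)⁻¹ = 1 := mul_inv_cancel₀ hK0'.ne'
      have h7 : 0 < (K : ℝ)⁻¹ := inv_pos.2 hK0'
      nlinarith
    calc ‖Ψ x - Ψ y‖ ≤ (c + 1) * ‖x - y‖ := by linarith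
      _ ≤ K * ‖x - y‖ := by gcongr
  have hinj : InjOn Ψ U := fun x hx y hy hxy => by
    have := hanti x hx y hy
    rw [hxy, dist_self, mul_zero] at this
    exact dist_le_zero.1 this
  have hc1 : Subsingleton (E n) ∨
      c < ‖((ContinuousLinearEquiv.refl ℝ (E n)).symm : E n →L[ℝ] E n)‖₊⁻¹ := by
    right
    have h2 : ‖((ContinuousLinearEquiv.refl ℝ (E n)).symm : E n →L[ℝ] E n)‖₊ ≤ 1 :=
      ContinuousLinearMap.norm_id_le
    have h3 : c < 1 := tsub_lt_self zero_lt_one (inv_pos.2 hK0)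
    refine h3.trans_le ?_
    rcases eq_or_ne ‖((ContinuousLinearEquiv.refl ℝ (E n)).symm : E n →L[ℝ] E n)‖₊ 0 with h0 | h0
    · exfalso
      have h4 : ((ContinuousLinearEquiv.refl ℝ (E n)).symm : E n →L[ℝ] E n) e = 0 := by
        rw [nnnorm_eq_zero.1 h0]; rfl
      have h5 : e = 0 := h4
      rw [h5, norm_zero] at he
      exact zero_ne_one he
    · exact (one_le_inv₀ (pos_iff_ne_zero.2 h0)).2 h2
  set h := happ.toOpenPartialHomeomorph Ψ U hc1 hU with hh
  have hsource : h.source = U := rfl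
  have htarget : h.target = Ψ '' U := rfl
  have hcoe : ∀ x, h x = Ψ x := fun x => rfl
  refine ⟨U, hU.mem_nhds hxU, fun ζ hζ hζc hζ0 hζU a ha => ?_⟩
  classical
  -- The weight ζ in the straightened coordinates. It is continuous on all of space because the
  -- image of the support of ζ is compact inside the open image of `U`.
  set g : E n → ℝ := fun z => if z ∈ Ψ '' U then ζ (h.symm z) else 0 with hg
  have hgΨ : ∀ x ∈ U, g (Ψ x) = ζ x := by
    intro x hx
    have : h.symm (Ψ x) = x := h.left_inv hx
    simp only [hg, if_pos (mem_image_of_mem Ψ hx), this]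
  have hgz : ∀ z ∉ Ψ '' tsupport ζ, g z = 0 := by
    intro z hz
    by_cases hzU : z ∈ Ψ '' U
    · obtain ⟨x, hx, rfl⟩ := hzU
      rw [hgΨ x hx]
      exact image_eq_zero_of_notMem_tsupport fun hxs => hz (mem_image_of_mem Ψ hxs)
    · simp only [hg, if_neg hzU]
  have hg0 : ∀ z, 0 ≤ g z := fun z => by
    simp only [hg]
    split_ifs
    · exact hζ0 _
    · exact le_rfl
  have hgK : IsCompact (Ψ '' tsupport ζ) := hζc.isCompact.image hΨc
  have hgcs : HasCompactSupport g := HasCompactSupport.intro hgK hgz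
  have hgc : Continuous g := by
    rw [continuous_iff_continuousAt]
    intro z
    by_cases hz : z ∈ Ψ '' U
    · have hopen : IsOpen (Ψ '' U) := h.open_target
      have h2 : ContinuousAt (fun z => ζ (h.symm z)) z :=
        hζ.continuousAt.comp (h.continuousAt_symm hz)
      refine h2.congr ?_
      filter_upwards [hopen.mem_nhds hz] with y hy
      simp only [hg, if_pos hy]
    · have hz' : z ∉ Ψ '' tsupport ζ := fun h' => hz (image_mono hζU h')
      refine continuousAt_const.congr (f := fun _ => (0 : ℝ)) ?_
      filter_upwards [hgK.isClosed.isOpen_compl.mem_nhds hz'] with y hy using (hgz y hy).symm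
  obtain ⟨hI, hlim⟩ := tendsto_integral_layer_hyperplane he hgc hgcs
  set I := ∫ z in {z | ⟪e, z⟫_ℝ = 0}, g z ∂μHE[n - 1] with hIdef
  have hvol : (μHE[n] : Measure (E n)) = volume :=
    EuclideanSpace.euclideanHausdorffMeasure_eq_volume n
  have hIeq : ENNReal.ofReal I
      = ∫⁻ z in {z | ⟪e, z⟫_ℝ = 0}, ENNReal.ofReal (g z) ∂μHE[n - 1] :=
    ofReal_integral_eq_lintegral_ofReal hI (Eventually.of_forall hg0)
  have hk : ∀ ε, Measurable fun z => ENNReal.ofReal (layer ε ⟪e, z⟫_ℝ * g z) := fun ε =>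
    (((continuous_layer ε).comp (by fun_prop)).mul hgc).measurable.ennreal_ofReal
  have hA : ∀ ε > 0, ENNReal.ofReal (∫ x, layer ε (ρ x) * ζ x)
      = ∫⁻ x in U, ENNReal.ofReal (layer ε ⟪e, Ψ x⟫_ℝ * g (Ψ x)) ∂μHE[n] := by
    intro ε hε
    rw [hvol, ofReal_integral_eq_lintegral_ofReal, ← lintegral_indicator hU.measurableSet]
    · congr 1
      ext x
      by_cases hx : x ∈ U
      · rw [indicator_of_mem hx, hΨe, hgΨ x hx]
      · rw [indicator_of_notMem hx, image_eq_zero_of_notMem_tsupport fun h' => hx (hζU h')]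
        simp
    · exact (((continuous_layer ε).comp hρ).mul hζ).integrable_of_hasCompactSupport hζc.mul_left
    · exact Eventually.of_forall fun x => mul_nonneg (layer_nonneg hε _) (hζ0 x)
  have hB : ∀ ε > 0, ENNReal.ofReal (∫ z, layer ε ⟪e, z⟫_ℝ * g z)
      = ∫⁻ z in Ψ '' U, ENNReal.ofReal (layer ε ⟪e, z⟫_ℝ * g z) ∂μHE[n] := by
    intro ε hε
    have hopen : IsOpen (Ψ '' U) := h.open_target
    rw [hvol, ofReal_integral_eq_lintegral_ofReal, ← lintegral_indicator hopen.measurableSet]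
    · congr 1
      ext z
      by_cases hz : z ∈ Ψ '' U
      · rw [indicator_of_mem hz]
      · rw [indicator_of_notMem hz, hgz z fun h' => hz (image_mono hζU h')]
        simp
    · exact (((continuous_layer ε).comp (by fun_prop)).mul hgc).integrable_of_hasCompactSupport
        hgcs.mul_left
    · exact Eventually.of_forall fun z => mul_nonneg (layer_nonneg hε _) (hg0 z)
  have hofa := (ENNReal.continuous_ofReal.tendsto a).comp ha
  have hofI := (ENNReal.continuous_ofReal.tendsto I).comp hlim
  have hKtop : ∀ m : ℕ, (K : ℝ≥0∞) ^ m ≠ ⊤ := fun m => ENNReal.pow_ne_top ENNReal.coe_ne_top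
  have h1K : (1 : ℝ≥0∞) ≤ K := by exact_mod_cast hK.le
  -- For each ε the two layer integrals are comparable by the n-dimensional estimates for Ψ; the
  -- comparison survives in the limit.
  have haI : ENNReal.ofReal a ≤ (K : ℝ≥0∞) ^ n * ENNReal.ofReal I := by
    refine le_of_tendsto_of_tendsto hofa
      (ENNReal.Tendsto.const_mul hofI (Or.inr (hKtop n))) ?_
    filter_upwards [self_mem_nhdsWithin] with ε hε
    have h2 := lintegral_comp_le_of_antilipschitz hΨc.measurable hanti n (hk ε)
    rw [← hA ε hε, ← hB ε hε] at h2
    exact h2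
  have hIa : ENNReal.ofReal I ≤ (K : ℝ≥0∞) ^ n * ENNReal.ofReal a := by
    refine le_of_tendsto_of_tendsto hofI
      (ENNReal.Tendsto.const_mul hofa (Or.inr (hKtop n))) ?_
    filter_upwards [self_mem_nhdsWithin] with ε hε
    have h2 := lintegral_image_le_of_lipschitzOn hΨc.measurable hlip n (hk ε)
    rw [← hA ε hε, ← hB ε hε] at h2
    exact h2
  have hHU : ∫⁻ x in {x | ρ x = 0}, ENNReal.ofReal (ζ x) ∂μHE[n - 1]
      = ∫⁻ x in {x | ρ x = 0} ∩ U, ENNReal.ofReal (g (Ψ x)) ∂μHE[n - 1] := by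
    have hm : MeasurableSet {x | ρ x = 0} := (isClosed_eq hρ continuous_const).measurableSet
    rw [← lintegral_indicator hm, ← lintegral_indicator (hm.inter hU.measurableSet)]
    congr 1
    ext x
    by_cases hx : x ∈ {x | ρ x = 0}
    · by_cases hxU : x ∈ U
      · rw [indicator_of_mem hx, indicator_of_mem (mem_inter hx hxU), hgΨ x hxU]
      · rw [indicator_of_mem hx, indicator_of_notMem fun h' => hxU h'.2,
          image_eq_zero_of_notMem_tsupport fun h' => hxU (hζU h')]
        simp
    · rw [indicator_of_notMem hx, indicator_of_notMem fun h' => hx h'.1]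
  have himg : Ψ '' ({x | ρ x = 0} ∩ U) = {z | ⟪e, z⟫_ℝ = 0} ∩ Ψ '' U := by
    ext z
    constructor
    · rintro ⟨x, ⟨hx, hxU⟩, rfl⟩
      exact ⟨(hΨe x).trans hx, x, hxU, rfl⟩
    · rintro ⟨hz, x, hxU, rfl⟩
      exact ⟨x, ⟨(hΨe x).symm.trans hz, hxU⟩, rfl⟩
  have hIU : ENNReal.ofReal I
      = ∫⁻ z in Ψ '' ({x | ρ x = 0} ∩ U), ENNReal.ofReal (g z) ∂μHE[n - 1] := by
    have hopen : IsOpen (Ψ '' U) := h.open_target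
    have hm : MeasurableSet {z : E n | ⟪e, z⟫_ℝ = 0} :=
      (isClosed_eq (by fun_prop) continuous_const).measurableSet
    rw [hIeq, himg, ← lintegral_indicator hm,
      ← lintegral_indicator (hm.inter hopen.measurableSet)]
    congr 1
    ext z
    by_cases hz : z ∈ {z : E n | ⟪e, z⟫_ℝ = 0}
    · by_cases hzU : z ∈ Ψ '' U
      · rw [indicator_of_mem hz, indicator_of_mem (mem_inter hz hzU)]
      · rw [indicator_of_mem hz, indicator_of_notMem fun h' => hzU h'.2,
          hgz z fun h' => hzU (image_mono hζU h')]
        simp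
    · rw [indicator_of_notMem hz, indicator_of_notMem fun h' => hz h'.1]
  have hgm : Measurable fun z => ENNReal.ofReal (g z) := hgc.measurable.ennreal_ofReal
  have hH1 := lintegral_comp_le_of_antilipschitz hΨc.measurable
    (s := {x | ρ x = 0} ∩ U) (fun x hx y hy => hanti x hx.2 y hy.2) (n - 1) hgm
  have hH2 := lintegral_image_le_of_lipschitzOn hΨc.measurable
    (hlip.mono (inter_subset_right (s := {x | ρ x = 0}))) (n - 1) hgm
  rw [← hHU, ← hIU] at hH1 hH2
  -- Comparing surface measures costs only the power n - 1, raised to n so that the two bounds have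
  -- the same constant.
  have hpow : (K : ℝ≥0∞) ^ (n - 1) ≤ (K : ℝ≥0∞) ^ n := pow_le_pow_right₀ h1K (Nat.sub_le n 1)
  constructor
  · calc ENNReal.ofReal a ≤ (K : ℝ≥0∞) ^ n * ENNReal.ofReal I := haI
      _ ≤ (K : ℝ≥0∞) ^ n * ((K : ℝ≥0∞) ^ n
          * ∫⁻ x in {x | ρ x = 0}, ENNReal.ofReal (ζ x) ∂μHE[n - 1]) := by
        gcongr
        exact hH2.trans (by gcongr)
      _ = _ := by rw [← mul_assoc, ← pow_add, two_mul]
  · calc _ ≤ (K : ℝ≥0∞) ^ (n - 1) * ENNReal.ofReal I := hH1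
      _ ≤ (K : ℝ≥0∞) ^ n * ((K : ℝ≥0∞) ^ n * ENNReal.ofReal a) := by gcongr
      _ = _ := by rw [← mul_assoc, ← pow_add, two_mul]


end

section

variable {n : ℕ}

/-! ### The area of a level set of a distance function -/

open scoped ENNReal

/-- Since |∇ρ| = 1, the layer integral is the integral of ζ∇ρ against the gradient of the smooth
step of ρ. By parts it equals minus the step against `div (ζ∇ρ)`, and the step tends to the
indicator of ρ > 0. -/
theorem tendsto_integral_layer {ρ : E n → ℝ} {K : ℝ≥0} (hρ : LipschitzWith K ρ) {ζ : E n → ℝ}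
    (hζ : ContDiff ℝ 1 ζ) (hc : HasCompactSupport ζ)
    (hρC : ∀ x ∈ tsupport ζ, ContDiffAt ℝ 2 ρ x)
    (hρ1 : ∀ x ∈ tsupport ζ, ‖fderiv ℝ ρ x‖ = 1) :
    Tendsto (fun ε => ∫ x, layer ε (ρ x) * ζ x) (𝓝[>] 0)
      (𝓝 (-∫ x in {x | 0 < ρ x}, div (fun y => ζ y • gradient ρ y) x)) := by
  have hv : ContDiff ℝ 1 fun y => ζ y • gradient ρ y :=
    contDiff_cutoff_smul hζ fun x hx => contDiffAt_gradient (hρC x hx) (by norm_num)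
  have hvc : HasCompactSupport fun y => ζ y • gradient ρ y := hc.smul_right
  have hlim := (tendsto_integral_step hρ.continuous.aestronglyMeasurable
    (integrable_div hv hvc)).neg
  have hm : MeasurableSet {x | 0 < ρ x} := (isOpen_lt continuous_const hρ.continuous).measurableSet
  have hset : ∫ x in {x | 0 < ρ x}, div (fun y => ζ y • gradient ρ y) x
      = ∫ x, if 0 < ρ x then div (fun y => ζ y • gradient ρ y) x else 0 := by
    rw [← integral_indicator hm]
    rfl
  rw [hset]
  refine hlim.congr' ?_
  filter_upwards [self_mem_nhdsWithin] with ε hε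
  obtain ⟨C, hC⟩ := lipschitzWith_step hε
  have hibp := integral_lipschitz_mul_div (hC.comp hρ) hv hvc
  have hder : ∀ x, fderiv ℝ (step ε ∘ ρ) x (ζ x • gradient ρ x) = layer ε (ρ x) * ζ x := by
    intro x
    by_cases hx : x ∈ tsupport ζ
    · have hd := ((hρC x hx).differentiableAt (by norm_num)).hasFDerivAt
      rw [((hasDerivAt_step ε (ρ x)).comp_hasFDerivAt x hd).fderiv, smul_apply, map_smul,
        ← inner_gradient, real_inner_self_eq_norm_sq]
      have : ‖gradient ρ x‖ = 1 := by rw [← hρ1 x hx]; simp [gradient]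
      rw [this]
      simp [layer]
    · rw [image_eq_zero_of_notMem_tsupport hx]; simp
  simp only [hder] at hibp
  simp only [Function.comp_apply] at hibp
  rw [hibp, neg_neg]

theorem tendsto_one_add_pow_mul (m : ℕ) {A : ℝ≥0∞} :
    Tendsto (fun K : ℝ≥0 => (K : ℝ≥0∞) ^ m * A) (𝓝[>] 1) (𝓝 A) := by
  have h1 : Tendsto (fun K : ℝ≥0 => ((K ^ m : ℝ≥0) : ℝ≥0∞)) (𝓝[>] 1) (𝓝 ((1 ^ m : ℝ≥0) : ℝ≥0∞)) :=
    ENNReal.tendsto_coe.2 (((continuous_pow m).tendsto (1 : ℝ≥0)).mono_left nhdsWithin_le_nhds)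
  have h2 := ENNReal.Tendsto.mul_const (b := A) h1 (Or.inl (by simp))
  simpa using h2

/-- For each K > 1, a partition of unity splits ζ into pieces to which the local comparison applies.
Both sides are additive over the pieces and agree up to the factor K^(2n). Letting K decrease to 1
gives equality, so almost isometric charts do the work of an area formula. -/
theorem lintegral_levelSet {ρ : E n → ℝ} {C : ℝ≥0} (hρ : LipschitzWith C ρ) {ζ : E n → ℝ}
    (hζ : ContDiff ℝ 1 ζ) (hc : HasCompactSupport ζ) (h0 : ∀ x, 0 ≤ ζ x)
    (hρC : ∀ x ∈ tsupport ζ, ContDiffAt ℝ 2 ρ x)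
    (hρ1 : ∀ x ∈ tsupport ζ, ‖fderiv ℝ ρ x‖ = 1) :
    0 ≤ -∫ x in {x | 0 < ρ x}, div (fun y => ζ y • gradient ρ y) x ∧
    ∫⁻ x in {x | ρ x = 0}, ENNReal.ofReal (ζ x) ∂μHE[n - 1]
      = ENNReal.ofReal (-∫ x in {x | 0 < ρ x}, div (fun y => ζ y • gradient ρ y) x) := by
  have hnonneg : ∀ ξ : E n → ℝ, (∀ x, 0 ≤ ξ x) → ∀ a,
      Tendsto (fun ε => ∫ x, layer ε (ρ x) * ξ x) (𝓝[>] 0) (𝓝 a) → 0 ≤ a := by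
    intro ξ hξ a ha
    refine ge_of_tendsto ha ?_
    filter_upwards [self_mem_nhdsWithin] with ε hε
    exact integral_nonneg fun x => mul_nonneg (layer_nonneg hε _) (hξ x)
  have hlim := tendsto_integral_layer hρ hζ hc hρC hρ1
  set A := -∫ x in {x | 0 < ρ x}, div (fun y => ζ y • gradient ρ y) x with hA
  set M := ∫⁻ x in {x | ρ x = 0}, ENNReal.ofReal (ζ x) ∂μHE[n - 1] with hM
  have key : ∀ K : ℝ≥0, 1 < K → ENNReal.ofReal A ≤ (K : ℝ≥0∞) ^ (2 * n) * M ∧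
      M ≤ (K : ℝ≥0∞) ^ (2 * n) * ENNReal.ofReal A := by
    intro K hK
    choose U hU hcomp using fun x : tsupport ζ => exists_nhds_layer_comparison hρ.continuous
      ((hρC x x.2).of_le (by norm_num)) (hρ1 x x.2) hK
    obtain ⟨s, χ, hχ, hχU, hχ0, hχ1⟩ := exists_partition hc.isCompact U hU
    have hξC : ∀ i, ContDiff ℝ 1 fun x => χ i x * ζ x := fun i =>
      ((hχ i).of_le (by norm_cast)).mul hζ
    have hξc : ∀ i, HasCompactSupport fun x => χ i x * ζ x := fun i => hc.mul_left
    have hξ0 : ∀ i x, 0 ≤ χ i x * ζ x := fun i x => mul_nonneg (hχ0 i x) (h0 x)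
    have hξζ : ∀ i, tsupport (fun x => χ i x * ζ x) ⊆ tsupport ζ := fun i =>
      tsupport_mul_subset_right
    have hξU : ∀ i, tsupport (fun x => χ i x * ζ x) ⊆ U i := fun i =>
      tsupport_mul_subset_left.trans (hχU i)
    have hsum : ∀ x, ∑ i ∈ s, χ i x * ζ x = ζ x := by
      intro x
      rw [← Finset.sum_mul]
      by_cases hx : x ∈ tsupport ζ
      · rw [hχ1 x hx, one_mul]
      · rw [image_eq_zero_of_notMem_tsupport hx, mul_zero]
    have hlimi := fun i => tendsto_integral_layer hρ (hξC i) (hξc i)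
      (fun x hx => hρC x (hξζ i hx)) (fun x hx => hρ1 x (hξζ i hx))
    set a : tsupport ζ → ℝ := fun i =>
      -∫ x in {x | 0 < ρ x}, div (fun y => (χ i y * ζ y) • gradient ρ y) x with ha
    have hAa : A = ∑ i ∈ s, a i := by
      refine tendsto_nhds_unique hlim ?_
      refine (tendsto_finsetSum s fun i _ => hlimi i).congr fun ε => ?_
      rw [← integral_finsetSum]
      · congr 1
        ext x
        rw [← Finset.mul_sum, hsum]
      · intro i _
        exact (((continuous_layer ε).comp hρ.continuous).mul
          (hξC i).continuous).integrable_of_hasCompactSupport (hξc i).mul_left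
    have hMa : M = ∑ i ∈ s, ∫⁻ x in {x | ρ x = 0}, ENNReal.ofReal (χ i x * ζ x) ∂μHE[n - 1] := by
      rw [← lintegral_finsetSum']
      · rw [hM]
        congr 1
        ext x
        rw [← ENNReal.ofReal_sum_of_nonneg fun i _ => hξ0 i x, hsum]
      · intro i _
        exact (hξC i).continuous.measurable.ennreal_ofReal.aemeasurable
    have hAa' : ENNReal.ofReal A = ∑ i ∈ s, ENNReal.ofReal (a i) := by
      rw [hAa, ENNReal.ofReal_sum_of_nonneg fun i _ => hnonneg _ (hξ0 i) _ (hlimi i)]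
    have hc' := fun i => hcomp i _ (hξC i).continuous (hξc i) (hξ0 i) (hξU i) _ (hlimi i)
    rw [hAa', hMa, Finset.mul_sum, Finset.mul_sum]
    exact ⟨Finset.sum_le_sum fun i _ => (hc' i).1, Finset.sum_le_sum fun i _ => (hc' i).2⟩
  refine ⟨hnonneg ζ h0 _ hlim, le_antisymm ?_ ?_⟩
  · refine ge_of_tendsto (tendsto_one_add_pow_mul (2 * n)) ?_
    filter_upwards [self_mem_nhdsWithin] with K hK using (key K hK).2
  · refine ge_of_tendsto (tendsto_one_add_pow_mul (2 * n)) ?_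
    filter_upwards [self_mem_nhdsWithin] with K hK using (key K hK).1

/-- With a weight equal to one on the interface, the area becomes a volume integral over Ω₊(t),
which can be differentiated in time. -/
theorem IsEvolvingInterface.measure_interface {Ω : Set (E n)} {T : ℝ} {Ωp : ℝ → Set (E n)}
    (h : IsEvolvingInterface Ω T Ωp) {t : ℝ} (ht : t ∈ Ioo 0 T)
    {θ : E n → ℝ} (hθ : ContDiff ℝ 1 θ) (hc : HasCompactSupport θ) (h0 : ∀ x, 0 ≤ θ x)
    (hθt : ∀ x ∈ tsupport θ, (t, x) ∈ tube Ω T Ωp) (h1 : ∀ x ∈ interface Ωp t, θ x = 1) :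
    0 ≤ -∫ x in Ωp t, div (fun y => θ y • normal Ωp t y) x ∧
    μHE[n - 1] (interface Ωp t)
      = ENNReal.ofReal (-∫ x in Ωp t, div (fun y => θ y • normal Ωp t y) x) := by
  have hρC : ∀ x ∈ tsupport θ, ContDiffAt ℝ 2 (signedDistance (Ωp t)) x := fun x hx =>
    (contDiffAt_slice (contDiffAt_levelFn (hθt x hx))).of_le (by norm_num)
  have hρ1 : ∀ x ∈ tsupport θ, ‖fderiv ℝ (signedDistance (Ωp t)) x‖ = 1 := fun x hx =>
    norm_fderiv_signedDistance (h.isOpen_phase ht) (nonempty_interface_of_tube (hθt x hx))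
      ((hρC x hx).of_le (by norm_num))
  have hmain := lintegral_levelSet (lipschitzWith_signedDistance (Ωp t)) hθ hc h0 hρC hρ1
  have hpos : ∫ x in {x | 0 < signedDistance (Ωp t) x},
        div (fun y => θ y • gradient (signedDistance (Ωp t)) y) x
      = ∫ x in Ωp t, div (fun y => θ y • normal Ωp t y) x := by
    have hm : MeasurableSet {x | 0 < signedDistance (Ωp t) x} :=
      (isOpen_lt continuous_const (lipschitzWith_signedDistance (Ωp t)).continuous).measurableSet
    rw [← integral_indicator hm, ← integral_indicator (h.isOpen_phase ht).measurableSet]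
    congr 1
    ext x
    by_cases hx : x ∈ tsupport θ
    · have hiff : x ∈ {x | 0 < signedDistance (Ωp t) x} ↔ x ∈ Ωp t :=
        h.levelFn_pos_iff (hθt x hx)
      by_cases hp : x ∈ Ωp t
      · rw [indicator_of_mem hp, indicator_of_mem (hiff.2 hp)]
        rfl
      · rw [indicator_of_notMem hp, indicator_of_notMem fun h' => hp (hiff.1 h')]
    · have hx' : x ∉ tsupport fun y => θ y • normal Ωp t y := fun h' =>
        hx (tsupport_smul_subset_left _ _ h')
      have hz : div (fun y => θ y • normal Ωp t y) x = 0 := div_eq_zero_of_notMem_tsupport hx'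
      have hz' : div (fun y => θ y • gradient (signedDistance (Ωp t)) y) x = 0 := hz
      classical
      rw [indicator_apply, indicator_apply, hz, hz']
      split_ifs <;> rfl
  have hzero : ∫⁻ x in {x | signedDistance (Ωp t) x = 0}, ENNReal.ofReal (θ x) ∂μHE[n - 1]
      = μHE[n - 1] (interface Ωp t) := by
    have hm : MeasurableSet {x | signedDistance (Ωp t) x = 0} :=
      (isClosed_eq (lipschitzWith_signedDistance (Ωp t)).continuous
        continuous_const).measurableSet
    have hmΓ : MeasurableSet (interface Ωp t) := isClosed_frontier.measurableSet
    rw [← lintegral_indicator_one hmΓ, ← lintegral_indicator hm]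
    congr 1
    ext x
    by_cases hx : x ∈ interface Ωp t
    · have hz : x ∈ {x | signedDistance (Ωp t) x = 0} :=
        (levelFn_eq_zero_iff (h.mem_tube ht hx)).2 hx
      rw [indicator_of_mem hx, indicator_of_mem hz, h1 x hx]
      simp
    · rw [indicator_of_notMem hx]
      by_cases hxt : x ∈ tsupport θ
      · have hz : x ∉ {x | signedDistance (Ωp t) x = 0} := fun h' =>
          hx ((levelFn_eq_zero_iff (hθt x hxt)).1 h')
        exact indicator_of_notMem hz _
      · simp [indicator_apply, image_eq_zero_of_notMem_tsupport hxt]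
  rw [hpos, hzero] at hmain
  exact hmain

end

section

variable {n : ℕ}

/-! ### The divergence theorem in the two phases -/

section
variable {Ω : Set (E n)} {T : ℝ} {Ωp : ℝ → Set (E n)} {t : ℝ}

/-- For the outer phase: if Ω₋ stayed away from an interface point, then d ≥ 0 nearby, and the point
would be a local minimum of d, contradicting |∇d| = 1. -/
theorem IsEvolvingInterface.interface_subset_closure_region (h : IsEvolvingInterface Ω T Ωp)
    (hΩ : IsOpen Ω) (ht : t ∈ Ioo 0 T) (s : Phase) :
    interface Ωp t ⊆ closure (region Ω Ωp t s) := by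
  cases s with
  | plus => exact frontier_subset_closure
  | minus =>
    intro x hx
    by_contra hcl
    have htube := h.mem_tube ht hx
    have hmin : IsLocalMin (signedDistance (Ωp t)) x := by
      have hzero : signedDistance (Ωp t) x = 0 := (levelFn_eq_zero_iff htube).2 hx
      filter_upwards [isClosed_closure.isOpen_compl.mem_nhds hcl,
        hΩ.mem_nhds (h.interface_subset ht hx), (isOpen_tube_slice hΩ t).mem_nhds htube]
        with y hy hyΩ hyt
      rw [hzero]
      by_contra! hneg
      refine hy (subset_closure ⟨hyΩ, fun hyc => ?_⟩)
      rw [closure_eq_self_union_frontier] at hyc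
      rcases hyc with hyp | hyf
      · exact hneg.not_gt ((h.levelFn_pos_iff hyt).2 hyp)
      · exact hneg.ne ((levelFn_eq_zero_iff hyt).2 hyf)
    have h1 : ‖fderiv ℝ (signedDistance (Ωp t)) x‖ = 1 :=
      norm_fderiv_signedDistance (h.isOpen_phase ht) ⟨x, hx⟩
        ((contDiffAt_slice (contDiffAt_levelFn htube)).of_le (by norm_num))
    rw [hmin.fderiv_eq_zero, norm_zero] at h1
    exact zero_ne_one h1

theorem IsEvolvingInterface.region_subset (h : IsEvolvingInterface Ω T Ωp) (ht : t ∈ Ioo 0 T)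
    (s : Phase) : region Ω Ωp t s ⊆ Ω := by
  cases s with
  | plus => exact subset_closure.trans (h.inside t ht)
  | minus => exact sdiff_subset

theorem IsEvolvingInterface.isOpen_region (h : IsEvolvingInterface Ω T Ωp) (hΩ : IsOpen Ω)
    (ht : t ∈ Ioo 0 T) (s : Phase) : IsOpen (region Ω Ωp t s) := by
  cases s with
  | plus => exact h.isOpen_phase ht
  | minus => exact hΩ.sdiff isClosed_closure

theorem mem_closure_region_minus {x : E n} (hx : x ∈ closure Ω) (hxp : x ∉ closure (Ωp t)) :
    x ∈ closure (region Ω Ωp t .minus) := by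
  have h1 := isClosed_closure.isOpen_compl.closure_inter ⟨hx, hxp⟩
  exact h1

theorem IsEvolvingInterface.phaseIntegrable (h : IsEvolvingInterface Ω T Ωp)
    (hΩb : Bornology.IsBounded Ω) (ht : t ∈ Ioo 0 T) {f : Phase → E n → ℝ}
    (hf : ∀ s, ContinuousOn (f s) (closure (region Ω Ωp t s))) : PhaseIntegrable Ω Ωp t f :=
  fun s => ((hf s).integrableOn_compact
    (hΩb.subset (h.region_subset ht s)).isCompact_closure).mono_set subset_closure

theorem IsEvolvingInterface.setIntegral_eq_phaseIntegral (h : IsEvolvingInterface Ω T Ωp)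
    (hΩ : IsOpen Ω) (hΩb : Bornology.IsBounded Ω) (ht : t ∈ Ioo 0 T) {f : E n → ℝ}
    (hf : IntegrableOn f Ω) : ∫ x in Ω, f x = phaseIntegral Ω Ωp t fun _ => f := by
  have hsub : Ωp t ⊆ Ω := h.region_subset ht .plus
  have hm : MeasurableSet (Ωp t) := (h.isOpen_phase ht).measurableSet
  have h1 := integral_inter_add_sdiff hm hf
  rw [inter_eq_self_of_subset_right hsub] at h1
  have h2 : ∫ x in Ω \ closure (Ωp t), f x = ∫ x in Ω \ Ωp t, f x := by
    refine setIntegral_congr_set ?_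
    have h0 := volume_interface_eq_zero hΩ hΩb h ht
    have h3 : ∀ᵐ x, x ∉ interface Ωp t := measure_eq_zero_iff_ae_notMem.1 h0
    filter_upwards [h3] with x hx
    have h4 : x ∈ closure (Ωp t) ↔ x ∈ Ωp t := by
      rw [closure_eq_self_union_frontier]
      exact or_iff_left hx
    exact propext (and_congr_right fun _ => not_congr h4)
  rw [← h1, ← h2]
  rfl

/-- The divergence theorem in both phases for a field without flux through the outer boundary;
`Y` extends the jump of its normal component. -/
theorem IsEvolvingInterface.phaseIntegral_div (h : IsEvolvingInterface Ω T Ωp)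
    (hΩ : IsBoundedLipschitzDomain Ω) (ht : t ∈ Ioo 0 T) {F : Phase → E n → E n}
    (hF : ∀ s, ∀ x ∈ closure (region Ω Ωp t s), ContDiffAt ℝ 1 (F s) x)
    (hn : ∀ x m, IsOuterUnitNormal Ω x m → ⟪F .minus x, m⟫_ℝ = 0)
    {Y : E n → E n} (hY : ContDiff ℝ 1 Y) (hYc : HasCompactSupport Y)
    (hYt : ∀ x ∈ tsupport Y, (t, x) ∈ tube Ω T Ωp)
    (hjump : ∀ x ∈ interface Ωp t,
      ⟪F .plus x - F .minus x, normal Ωp t x⟫_ℝ = ⟪Y x, normal Ωp t x⟫_ℝ) :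
    phaseIntegral Ω Ωp t (fun s => div (F s)) = ∫ x in Ωp t, div Y x := by
  set O : Set (E n) := {x | (t, x) ∈ tube Ω T Ωp} ∩
    ({x | ContDiffAt ℝ 1 (F .plus) x} ∩ {x | ContDiffAt ℝ 1 (F .minus) x}) with hOdef
  have hO : IsOpen O := (isOpen_tube_slice hΩ.isOpen t).inter
    ((isOpen_contDiffAt (by norm_cast) _).inter (isOpen_contDiffAt (by norm_cast) _))
  have hΓO : interface Ωp t ⊆ O := fun x hx => ⟨h.mem_tube ht hx,
    hF _ x (h.interface_subset_closure_region hΩ.isOpen ht _ hx),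
    hF _ x (h.interface_subset_closure_region hΩ.isOpen ht _ hx)⟩
  obtain ⟨θ, hθ', hθc, hθO, hθ1, -⟩ :=
    exists_cutoff (h.isCompact_interface hΩ.isBounded ht) hO hΓO
  have hθ : ContDiff ℝ 1 θ := hθ'.of_le (by norm_cast)
  have hp : IsOpen (Ωp t) := h.isOpen_phase ht
  -- The difference of the two fields, which are both smooth in a full neighbourhood of the
  -- interface, cut off there.
  set I : E n → E n := fun x => θ x • (F .plus x - F .minus x) with hI
  have hIC : ContDiff ℝ 1 I := contDiff_cutoff_smul hθ fun x hx =>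
    ContDiffAt.sub (f := F .plus) (g := F .minus) (hθO hx).2.1 (hθO hx).2.2
  have hIc : HasCompactSupport I := hθc.smul_right
  have hIt : tsupport I ⊆ tsupport θ := tsupport_smul_subset_left _ _
  classical
  -- Near the interface θ = 1, so `G` coincides with `F .minus` on both sides and is therefore C¹
  -- across it.
  set G : E n → E n := fun x => if x ∈ closure (Ωp t) then F .plus x - I x else F .minus x with hG
  have hGp : ∀ x ∈ Ωp t, G =ᶠ[𝓝 x] fun y => F .plus y - I y := fun x hx => by
    filter_upwards [hp.mem_nhds hx] with y hy
    exact if_pos (subset_closure hy)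
  have hGm : ∀ x ∉ closure (Ωp t), G =ᶠ[𝓝 x] F .minus := fun x hx => by
    filter_upwards [isClosed_closure.isOpen_compl.mem_nhds hx] with y hy
    exact if_neg hy
  have hGC : ∀ x ∈ closure Ω, ContDiffAt ℝ 1 G x := by
    intro x hx
    by_cases hxp : x ∈ closure (Ωp t)
    · by_cases hxi : x ∈ Ωp t
      · exact ((hF .plus x (subset_closure hxi)).sub hIC.contDiffAt).congr_of_eventuallyEq
          (hGp x hxi)
      · have hxΓ : x ∈ interface Ωp t := by
          rw [closure_eq_self_union_frontier] at hxp
          exact hxp.resolve_left hxi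
        have hmC : ContDiffAt ℝ 1 (F .minus) x := (hΓO hxΓ).2.2
        refine hmC.congr_of_eventuallyEq ?_
        filter_upwards [hθ1 x hxΓ] with y hy
        simp only [hG, hI, hy, one_smul, sub_sub_cancel, ite_self]
    · exact (hF .minus x (mem_closure_region_minus hx hxp)).congr_of_eventuallyEq (hGm x hxp)
  have hGn : ∀ x m, IsOuterUnitNormal Ω x m → ⟪G x, m⟫_ℝ = 0 := by
    intro x m hm
    have hx : x ∉ closure (Ωp t) := fun hx' => by
      have := hm.1
      rw [hΩ.isOpen.frontier_eq] at this
      exact this.2 (h.inside t ht hx')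
    rw [(hGm x hx).eq_of_nhds]
    exact hn x m hm
  have hL := integral_div_lipschitzDomain_eq_zero hΩ hGC hGn
  have hGc : ContinuousOn (div G) (closure Ω) := fun x hx =>
    (continuousAt_div (hGC x hx)).continuousWithinAt
  have hGi : IntegrableOn (div G) Ω :=
    (hGc.integrableOn_compact hΩ.isBounded.isCompact_closure).mono_set subset_closure
  rw [h.setIntegral_eq_phaseIntegral hΩ.isOpen hΩ.isBounded ht hGi] at hL
  -- On the interface `I` is the jump of `F`, so `I - Y` is tangential and `Y` may replace `I`.
  have hZ : ∫ x in Ωp t, div (fun y => I y - Y y) x = 0 := by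
    refine h.integral_div_eq_zero hΩ.isOpen ht (hIC.sub hY) (hIc.sub hYc) (fun x hx => ?_) ?_
    · rcases tsupport_sub _ _ hx with hx | hx
      · exact (hθO (hIt hx)).1
      · exact hYt x hx
    · intro x hx
      rw [inner_sub_left, ← hjump x hx, hI]
      simp only [(hθ1 x hx).self_of_nhds, one_smul, sub_self]
  have hdI : ∀ x, DifferentiableAt ℝ I x := hIC.differentiable (by norm_num)
  have hdY : ∀ x, DifferentiableAt ℝ Y x := hY.differentiable (by norm_num)
  have hiI := (integrable_div hIC hIc).integrableOn (s := Ωp t)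
  have hiY := (integrable_div hY hYc).integrableOn (s := Ωp t)
  have hiF : IntegrableOn (div (F .plus)) (Ωp t) :=
    h.phaseIntegrable hΩ.isBounded ht (f := fun s => div (F s))
      (fun s x hx => (continuousAt_div (hF s x hx)).continuousWithinAt) .plus
  have hZ' : ∫ x in Ωp t, div I x = ∫ x in Ωp t, div Y x := by
    simp only [div_sub (hdI _) (hdY _)] at hZ
    rw [integral_sub hiI hiY] at hZ
    linarith
  have hp1 : ∫ x in Ωp t, div G x = ∫ x in Ωp t, (div (F .plus) x - div I x) :=
    setIntegral_congr_fun hp.measurableSet fun x hx => by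
      rw [div_congr (hGp x hx), div_sub ((hF .plus x (subset_closure hx)).differentiableAt
        (by norm_num)) (hdI x)]
  have hm1 : ∫ x in Ω \ closure (Ωp t), div G x = ∫ x in Ω \ closure (Ωp t), div (F .minus) x :=
    setIntegral_congr_fun (hΩ.isOpen.sdiff isClosed_closure).measurableSet fun x hx =>
      div_congr (hGm x hx.2)
  rw [integral_sub hiF hiI, hZ'] at hp1
  simp only [phaseIntegral, region] at hL ⊢
  linarith

end

end

section

variable {n : ℕ}

/-! ### Time derivatives of integrals over the phases -/

section
variable {Ω : Set (E n)} {T : ℝ} {Ωp : ℝ → Set (E n)} {t : ℝ}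

/-- The track of the interface is compact over compact subintervals of (0, T) only, so the cutoff is
built over the window from t/2 to (t + T)/2 around t. -/
theorem IsEvolvingInterface.exists_track_cutoff (h : IsEvolvingInterface Ω T Ωp)
    (hΩb : Bornology.IsBounded Ω) (ht : t ∈ Ioo 0 T) {O : Set (ℝ × E n)} (hO : IsOpen O)
    (hΓ : ∀ s ∈ Ioo 0 T, ∀ x ∈ interface Ωp s, (s, x) ∈ O) :
    ∃ (Θ : ℝ × E n → ℝ) (a b : ℝ), ContDiff ℝ (⊤ : ℕ∞) Θ ∧ HasCompactSupport Θ ∧ tsupport Θ ⊆ O ∧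
      (∀ q, 0 ≤ Θ q) ∧ t ∈ Ioo a b ∧ Icc a b ⊆ Ioo 0 T ∧
      ∀ s ∈ Ioo a b, ∀ x ∈ interface Ωp s, ∀ᶠ q in 𝓝 (s, x), Θ q = 1 := by
  have ha : 0 < t / 2 := half_pos ht.1
  have hb : (t + T) / 2 < T := by linarith [ht.2]
  have hab : Icc (t / 2) ((t + T) / 2) ⊆ Ioo 0 T := fun s hs =>
    ⟨ha.trans_le hs.1, hs.2.trans_lt hb⟩
  obtain ⟨Θ, hΘ, hΘc, hΘO, hΘ1, hΘ0⟩ := exists_cutoff (h.isCompact_track hΩb hab) hO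
    fun q hq => hΓ q.1 (hab hq.1) q.2 hq.2
  exact ⟨Θ, t / 2, (t + T) / 2, hΘ, hΘc, hΘO, fun q => (hΘ0 q).1,
    ⟨half_lt_self ht.1, by linarith [ht.2]⟩, hab,
    fun s hs x hx => hΘ1 (s, x) ⟨Ioo_subset_Icc_self hs, hx⟩⟩

theorem transported_eq_sub {f : ℝ × E n → ℝ} (hf : ContDiff ℝ 1 f) (hft : tsupport f ⊆ tube Ω T Ωp) (x : E n) :
    transported Ωp f (t, x) = dt f (t, x) - div (fun y => WithLp.toLp 2 fun i =>
      f (t, y) * (dt (levelFn Ωp) (t, y) * dx i (levelFn Ωp) (t, y))) x := by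
  rw [transported, div_slice (f := fun i p => f p * (dt (levelFn Ωp) p * dx i (levelFn Ωp) p))
    fun i => (contDiff_mul_velocity hf hft i).differentiable (by norm_num) _]

/-- The transport theorem adds the divergence of f·Vν. This field vanishes on the interface along
with f, so its divergence integrates to zero. -/
theorem IsEvolvingInterface.hasDerivAt_integral_of_eq_zero (h : IsEvolvingInterface Ω T Ωp)
    (hΩ : IsOpen Ω) (ht : t ∈ Ioo 0 T) {f : ℝ × E n → ℝ} (hf : ContDiff ℝ 1 f)
    (hc : HasCompactSupport f) (hft : tsupport f ⊆ tube Ω T Ωp)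
    (h0 : ∀ x ∈ interface Ωp t, f (t, x) = 0) :
    HasDerivAt (fun s => ∫ x in Ωp s, f (s, x)) (∫ x in Ωp t, dt f (t, x)) t := by
  set v : E n → E n := fun y => WithLp.toLp 2 fun i =>
    f (t, y) * (dt (levelFn Ωp) (t, y) * dx i (levelFn Ωp) (t, y)) with hv
  have hvC : ContDiff ℝ 1 v := by
    rw [contDiff_piLp]
    exact fun i => (contDiff_mul_velocity hf hft i).comp (contDiff_const.prodMk contDiff_id)
  have hv0 : ∀ x, (t, x) ∉ tsupport f → v x = 0 := fun x hx => by
    ext i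
    simp [hv, image_eq_zero_of_notMem_tsupport hx]
  have hK : IsClosed {x | (t, x) ∈ tsupport f} :=
    (isClosed_tsupport f).preimage (by fun_prop)
  have hvs : tsupport v ⊆ {x | (t, x) ∈ tsupport f} := closure_minimal
    (fun x hx => by by_contra hx'; exact hx (hv0 x hx')) hK
  have hvc : HasCompactSupport v :=
    HasCompactSupport.intro (hc.isCompact.image continuous_snd) fun x hx =>
      hv0 x fun h' => hx (mem_image_of_mem Prod.snd h')
  have hZ := h.integral_div_eq_zero hΩ ht hvC hvc (fun x hx => hft (hvs hx)) fun x hx => by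
    have : v x = 0 := by
      ext i
      simp [hv, h0 x hx]
    rw [this, inner_zero_left]
  have hder := h.hasDerivAt_integral hΩ hf hc hft ht
  have hdt : Continuous (dt f) := continuous_iff_continuousAt.2 fun q =>
    (contDiffAt_dt (m := 0) hf.contDiffAt (by norm_num)).continuousAt
  have hdti : Integrable fun x => dt f (t, x) :=
    (hdt.comp (by fun_prop)).integrable_of_hasCompactSupport
      (hasCompactSupport_slice (hasCompactSupport_dt hc) t)
  simp only [transported_eq_sub hf hft] at hder
  rw [integral_sub hdti.integrableOn (integrable_div hvC hvc).integrableOn, hZ, sub_zero] at hder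
  exact hder

theorem IsEvolvingInterface.phaseIntegral_eq_add (h : IsEvolvingInterface Ω T Ωp)
    (hΩ : IsOpen Ω) (hΩb : Bornology.IsBounded Ω) (ht : t ∈ Ioo 0 T) {g k : E n → ℝ}
    {f : Phase → E n → ℝ} (hg : ContinuousOn g (closure Ω)) (hk : Continuous k)
    (hkc : HasCompactSupport k) (hp : ∀ x ∈ Ωp t, g x = f .plus x - k x)
    (hm : ∀ x ∈ Ω \ closure (Ωp t), g x = f .minus x) :
    phaseIntegral Ω Ωp t f = (∫ x in Ω, g x) + ∫ x in Ωp t, k x := by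
  have hgi : IntegrableOn g Ω :=
    (hg.integrableOn_compact hΩb.isCompact_closure).mono_set subset_closure
  rw [h.setIntegral_eq_phaseIntegral hΩ hΩb ht hgi]
  have h1 : ∫ x in Ωp t, f .plus x = (∫ x in Ωp t, g x) + ∫ x in Ωp t, k x := by
    have hgp : IntegrableOn g (Ωp t) := hgi.mono_set (h.region_subset ht .plus)
    rw [← integral_add hgp
      (hk.integrable_of_hasCompactSupport hkc).integrableOn]
    exact setIntegral_congr_fun (h.isOpen_phase ht).measurableSet fun x hx => by
      simp only [hp x hx, sub_add_cancel]
  have h2 : ∫ x in Ω \ closure (Ωp t), f .minus x = ∫ x in Ω \ closure (Ωp t), g x :=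
    setIntegral_congr_fun (hΩ.sdiff isClosed_closure).measurableSet fun x hx => (hm x hx).symm
  simp only [phaseIntegral, region]
  rw [h1, h2]
  ring

/-- Smoothness is known only near {t} × closure A. A cutoff equal to one there makes the function
global, and compactness lets one time neighbourhood serve all points. -/
theorem hasDerivAt_setIntegral {A : Set (E n)} (hA : MeasurableSet A)
    (hAb : Bornology.IsBounded A) {f : ℝ × E n → ℝ}
    (hf : ∀ x ∈ closure A, ContDiffAt ℝ 1 f (t, x)) :
    HasDerivAt (fun s => ∫ x in A, f (s, x)) (∫ x in A, dt f (t, x)) t := by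
  have hK : IsCompact ({t} ×ˢ closure A) := isCompact_singleton.prod hAb.isCompact_closure
  obtain ⟨χ, hχ, hχc, hχO, hχ1, -⟩ := exists_cutoff hK
    (isOpen_contDiffAt (k := 1) (by norm_cast) f) fun q hq => by
      obtain ⟨q1, q2⟩ := q
      obtain ⟨rfl, hq2⟩ := hq
      exact hf q2 hq2
  have hχ1' : ∀ x ∈ closure A, ∀ᶠ q in 𝓝 (t, x), χ q = 1 := fun x hx => hχ1 (t, x) ⟨rfl, hx⟩
  have hder := hasDerivAt_integral_slice (μ := volume.restrict A)
    (contDiff_mul_of_tsupport (hχ.of_le (by norm_cast)) hχO) hχc.mul_right t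
  have h1 : ∫ x in A, dt (fun q => χ q * f q) (t, x) = ∫ x in A, dt f (t, x) :=
    setIntegral_congr_fun hA fun x hx => by
      have : (fun q => χ q * f q) =ᶠ[𝓝 (t, x)] f := by
        filter_upwards [hχ1' x (subset_closure hx)] with q hq
        rw [hq, one_mul]
      simp only [dt, this.fderiv_eq]
  rw [h1] at hder
  refine hder.congr_of_eventuallyEq ?_
  filter_upwards [hAb.isCompact_closure.eventually_forall_of_forall_eventually
    (P := fun s x => χ (s, x) = 1) hχ1'] with s hs
  refine setIntegral_congr_fun hA fun x hx => ?_
  simp only [hs x (subset_closure hx), one_mul]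

/-- Differentiation under the phase integral for a quantity which is continuous across the moving
interface. -/
theorem IsEvolvingInterface.hasDerivAt_phaseIntegral (h : IsEvolvingInterface Ω T Ωp)
    (hΩ : IsOpen Ω) (hΩb : Bornology.IsBounded Ω) (ht : t ∈ Ioo 0 T) {f : Phase → ℝ × E n → ℝ}
    (hf : ∀ s, ∀ τ ∈ Ioo 0 T, ∀ x ∈ closure (region Ω Ωp τ s), ContDiffAt ℝ 1 (f s) (τ, x))
    (hΓ : ∀ τ ∈ Ioo 0 T, ∀ x ∈ interface Ωp τ, f .plus (τ, x) = f .minus (τ, x)) :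
    HasDerivAt (fun τ => phaseIntegral Ω Ωp τ fun s x => f s (τ, x))
      (phaseIntegral Ω Ωp t fun s x => dt (f s) (t, x)) t := by
  set O : Set (ℝ × E n) := tube Ω T Ωp ∩
    ({q | ContDiffAt ℝ 1 (f .plus) q} ∩ {q | ContDiffAt ℝ 1 (f .minus) q}) with hOdef
  have hO : IsOpen O := (isOpen_tube hΩ).inter
    ((isOpen_contDiffAt (by norm_cast) _).inter (isOpen_contDiffAt (by norm_cast) _))
  obtain ⟨Θ, a, b, hΘ, hΘc, hΘO, -, htab, hab, hΘ1⟩ := h.exists_track_cutoff hΩb ht hO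
    fun s hs x hx => ⟨h.mem_tube hs hx,
      hf _ s hs x (h.interface_subset_closure_region hΩ hs _ hx),
      hf _ s hs x (h.interface_subset_closure_region hΩ hs _ hx)⟩
  set I : ℝ × E n → ℝ := fun q => Θ q * (f .plus q - f .minus q) with hI
  have hIC : ContDiff ℝ 1 I := contDiff_mul_of_tsupport (hΘ.of_le (by norm_cast)) fun q hq =>
    ContDiffAt.sub (f := f .plus) (g := f .minus) (hΘO hq).2.1 (hΘO hq).2.2
  have hIc : HasCompactSupport I := hΘc.mul_right
  have hIt : tsupport I ⊆ tube Ω T Ωp :=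
    (tsupport_mul_subset_left).trans (hΘO.trans inter_subset_left)
  classical
  -- The gluing of the two phases in space-time. The openness of the swept sets makes `G` agree with
  -- a single smooth expression near each point off the interface.
  set G : ℝ × E n → ℝ := fun q =>
    if q.2 ∈ closure (Ωp q.1) then f .plus q - I q else f .minus q with hG
  have hGp : ∀ s ∈ Ioo 0 T, ∀ x ∈ Ωp s, G =ᶠ[𝓝 (s, x)] fun q => f .plus q - I q :=
    fun s hs x hx => by
      filter_upwards [h.isOpen_inner.mem_nhds (show (s, x) ∈ _ from ⟨hs, hx⟩)] with q hq
      exact if_pos (subset_closure hq.2)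
  have hGm : ∀ s ∈ Ioo 0 T, ∀ x ∉ closure (Ωp s), G =ᶠ[𝓝 (s, x)] f .minus :=
    fun s hs x hx => by
      filter_upwards [h.isOpen_outer.mem_nhds (show (s, x) ∈ _ from ⟨hs, hx⟩)] with q hq
      exact if_neg hq.2
  have hsub : Ioo a b ⊆ Ioo 0 T := Ioo_subset_Icc_self.trans hab
  have hGC : ∀ s ∈ Ioo a b, ∀ x ∈ closure Ω, ContDiffAt ℝ 1 G (s, x) := by
    intro s hs x hx
    by_cases hxp : x ∈ closure (Ωp s)
    · by_cases hxi : x ∈ Ωp s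
      · exact ((hf .plus s (hsub hs) x (subset_closure hxi)).sub
          hIC.contDiffAt).congr_of_eventuallyEq (hGp s (hsub hs) x hxi)
      · have hxΓ : x ∈ interface Ωp s := by
          rw [closure_eq_self_union_frontier] at hxp
          exact hxp.resolve_left hxi
        refine (hf .minus s (hsub hs) x (h.interface_subset_closure_region hΩ (hsub hs) _
          hxΓ)).congr_of_eventuallyEq ?_
        filter_upwards [hΘ1 s hs x hxΓ] with q hq
        simp only [hG, hI, hq, one_mul, sub_sub_cancel, ite_self]
    · exact (hf .minus s (hsub hs) x (mem_closure_region_minus hx hxp)).congr_of_eventuallyEq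
        (hGm s (hsub hs) x hxp)
  have h1 := hasDerivAt_setIntegral hΩ.measurableSet hΩb fun x hx => hGC t htab x hx
  -- Continuity across the interface makes the correction vanish on it, so the motion of the
  -- interface leaves no boundary term.
  have h2 := h.hasDerivAt_integral_of_eq_zero hΩ ht hIC hIc hIt fun x hx => by
    simp only [hI, hΓ t ht x hx, sub_self, mul_zero]
  have hIdt : Continuous (dt I) := continuous_iff_continuousAt.2 fun q =>
    (contDiffAt_dt (m := 0) hIC.contDiffAt (by norm_num)).continuousAt
  have h3 : phaseIntegral Ω Ωp t (fun s x => dt (f s) (t, x))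
      = (∫ x in Ω, dt G (t, x)) + ∫ x in Ωp t, dt I (t, x) := by
    refine h.phaseIntegral_eq_add hΩ hΩb ht (fun x hx => ?_) (hIdt.comp (by fun_prop))
      (hasCompactSupport_slice (hasCompactSupport_dt hIc) t) (fun x hx => ?_) fun x hx => ?_
    · have hc : ContinuousAt (dt G) (t, x) :=
        (contDiffAt_dt (m := 0) (hGC t htab x hx) (by norm_num)).continuousAt
      exact (ContinuousAt.comp (f := fun x => (t, x)) hc (by fun_prop)).continuousWithinAt
    · have hd1 := (hf .plus t ht x (subset_closure hx)).differentiableAt (by norm_num)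
      have hd2 := hIC.differentiable (by norm_num) (t, x)
      rw [dt, (hGp t ht x hx).fderiv_eq, fderiv_fun_sub hd1 hd2]
      rfl
    · rw [dt, (hGm t ht x hx.2).fderiv_eq]
      rfl
  rw [h3]
  refine (h1.add h2).congr_of_eventuallyEq ?_
  filter_upwards [isOpen_Ioo.mem_nhds htab] with s hs
  refine h.phaseIntegral_eq_add hΩ hΩb (hsub hs) (fun x hx => ?_)
    (hIC.continuous.comp (by fun_prop)) (hasCompactSupport_slice hIc s)
    (fun x hx => (hGp s (hsub hs) x hx).eq_of_nhds)
    fun x hx => (hGm s (hsub hs) x hx.2).eq_of_nhds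
  exact (ContinuousAt.comp (f := fun x => (s, x)) (hGC s hs x hx).continuousAt
    (by fun_prop)).continuousWithinAt

/-- The first variation of area: the area of the interface changes at the rate given by the
integral of `-κ V`, written as the flux of the field `v`. -/
theorem IsEvolvingInterface.exists_hasDerivAt_area (h : IsEvolvingInterface Ω T Ωp)
    (hΩ : IsOpen Ω) (hΩb : Bornology.IsBounded Ω) (ht : t ∈ Ioo 0 T) :
    ∃ v : E n → E n, ContDiff ℝ 1 v ∧ HasCompactSupport v ∧
      (∀ x ∈ tsupport v, (t, x) ∈ tube Ω T Ωp) ∧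
      (∀ x ∈ interface Ωp t,
        ⟪v x, normal Ωp t x⟫_ℝ = curvature Ωp t x * normalVelocity Ωp t x) ∧
      μHE[n - 1] (interface Ωp t) < ⊤ ∧
      HasDerivAt (fun s => (μHE[n - 1]).real (interface Ωp s)) (∫ x in Ωp t, div v x) t := by
  obtain ⟨Θ, a, b, hΘ, hΘc, hΘO, hΘ0, htab, hab, hΘ1⟩ := h.exists_track_cutoff hΩb ht
    (isOpen_tube hΩ) fun s hs x hx => h.mem_tube hs hx
  have hsub : Ioo a b ⊆ Ioo 0 T := Ioo_subset_Icc_self.trans hab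
  -- The field Θ∇d extends ν, and the area is -∫_{Ω₊} of its divergence `f`. As d is C³, the field
  -- is C² and `f` is C¹, as the transport theorem requires.
  set X : Fin n → ℝ × E n → ℝ := fun i q => Θ q * dx i (levelFn Ωp) q with hX
  have hXC : ∀ i, ContDiff ℝ 2 (X i) := fun i =>
    contDiff_mul_of_tsupport (hΘ.of_le (by norm_cast)) fun q hq =>
      contDiffAt_dx (contDiffAt_levelFn (hΘO hq)) (by norm_num) i
  have hXs : ∀ i, tsupport (X i) ⊆ tsupport Θ := fun i => tsupport_mul_subset_left
  have hXc : ∀ i, HasCompactSupport (X i) := fun i => hΘc.mul_right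
  set f : ℝ × E n → ℝ := fun q => ∑ i, dx i (X i) q with hf
  have hfC : ContDiff ℝ 1 f := ContDiff.sum fun i _ => contDiff_iff_contDiffAt.2 fun q =>
    contDiffAt_dx (hXC i).contDiffAt (by norm_num) i
  have hf0 : ∀ q ∉ tsupport Θ, f q = 0 := fun q hq =>
    Finset.sum_eq_zero fun i _ => dx_eq_zero
      (notMem_tsupport_iff_eventuallyEq.1 fun h' => hq (hXs i h')) i
  have hfs : tsupport f ⊆ tsupport Θ := closure_minimal
    (fun q hq => by by_contra hq'; exact hq (hf0 q hq')) (isClosed_tsupport Θ)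
  have hfc : HasCompactSupport f := HasCompactSupport.intro hΘc.isCompact hf0
  have hft := hfs.trans hΘO
  have hdivX : ∀ s x, div (fun y => Θ (s, y) • normal Ωp s y) x = f (s, x) := by
    intro s x
    simp only [hf]
    rw [← div_slice fun i => (hXC i).differentiable (by norm_num) _]
    congr 1
    ext y i
    by_cases hy : (s, y) ∈ tsupport Θ
    · simp [hX, normal_apply (hΘO hy)]
    · simp [hX, image_eq_zero_of_notMem_tsupport hy]
  have harea : ∀ s ∈ Ioo a b, 0 ≤ -∫ x in Ωp s, f (s, x) ∧
      μHE[n - 1] (interface Ωp s) = ENNReal.ofReal (-∫ x in Ωp s, f (s, x)) := by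
    intro s hs
    have hsl : tsupport (fun x => Θ (s, x)) ⊆ {x | (s, x) ∈ tsupport Θ} := closure_minimal
      (fun x hx => subset_tsupport Θ hx) ((isClosed_tsupport Θ).preimage (by fun_prop))
    have := h.measure_interface (hsub hs) (θ := fun x => Θ (s, x))
      ((hΘ.of_le (by norm_cast)).comp (contDiff_const.prodMk contDiff_id))
      (hasCompactSupport_slice hΘc s) (fun x => hΘ0 _) (fun x hx => hΘO (hsl hx))
      fun x hx => (hΘ1 s hs x hx).self_of_nhds
    simpa only [hdivX] using this
  -- The rate of -∫_{Ω₊} f is -∫(∂ₜf + div(f Vν)). With f = div X and Vν = -∂ₜd ∇d the integrand is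
  -- the divergence of this field.
  set v : E n → E n := fun y => WithLp.toLp 2 fun i =>
    f (t, y) * (dt (levelFn Ωp) (t, y) * dx i (levelFn Ωp) (t, y)) - dt (X i) (t, y) with hv
  have hdtX : ∀ i, ContDiff ℝ 1 (dt (X i)) := fun i => contDiff_iff_contDiffAt.2 fun q =>
    contDiffAt_dt (hXC i).contDiffAt (by norm_num)
  have hcomp : ∀ i, ContDiff ℝ 1 fun q =>
      f q * (dt (levelFn Ωp) q * dx i (levelFn Ωp) q) - dt (X i) q := fun i =>
    (contDiff_mul_velocity hfC hft i).sub (hdtX i)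
  have hv0 : ∀ x, (t, x) ∉ tsupport Θ → v x = 0 := fun x hx => by
    ext i
    have h1 : dt (X i) (t, x) = 0 := by
      rw [dt, (notMem_tsupport_iff_eventuallyEq.1 fun h' => hx (hXs i h')).fderiv_eq]
      simp
    simp [hv, hf0 _ hx, h1]
  refine ⟨v, ?_, ?_, ?_, ?_, ?_, ?_⟩
  · rw [contDiff_piLp]
    exact fun i => (hcomp i).comp (contDiff_const.prodMk contDiff_id)
  · exact HasCompactSupport.intro (hΘc.isCompact.image continuous_snd) fun x hx =>
      hv0 x fun h' => hx (mem_image_of_mem Prod.snd h')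
  · have hvs : tsupport v ⊆ {x | (t, x) ∈ tsupport Θ} := closure_minimal
      (fun x hx => by by_contra hx'; exact hx (hv0 x hx'))
      ((isClosed_tsupport Θ).preimage (by fun_prop))
    exact fun x hx => hΘO (hvs hx)
  · intro x hx
    have hq := h.mem_tube ht hx
    have hXe : ∀ i, X i =ᶠ[𝓝 (t, x)] dx i (levelFn Ωp) := fun i => by
      filter_upwards [hΘ1 t htab x hx] with q hq
      simp only [hX, hq, one_mul]
    have hfx : f (t, x) = -curvature Ωp t x := by
      rw [curvature_eq hΩ hq, neg_neg]
      exact Finset.sum_congr rfl fun i _ => by rw [dx, (hXe i).fderiv_eq]; rfl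
    have hdtx : ∀ i, dt (X i) (t, x) = dx i (dt (levelFn Ωp)) (t, x) := fun i => by
      rw [← dt_dx_comm ((contDiffAt_levelFn hq).of_le (by norm_num)), dt, (hXe i).fderiv_eq]
      rfl
    rw [inner_eq_sum]
    simp only [hv, normal_apply hq, hfx, hdtx, sub_mul, Finset.sum_sub_distrib]
    -- The part ∂ₜ∇d of v is orthogonal to ν = ∇d; what is left is -κ ∂ₜd|∇d|² = κV.
    rw [sum_dx_dt_mul_dx hΩ hq, sub_zero, normalVelocity_eq hq]
    have h1 := sum_dx_levelFn_sq hq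
    calc _ = ∑ i, (-curvature Ωp t x * dt (levelFn Ωp) (t, x)) * dx i (levelFn Ωp) (t, x) ^ 2 :=
          Finset.sum_congr rfl fun i _ => by ring
      _ = _ := by rw [← Finset.mul_sum, h1]; ring
  · rw [(harea t htab).2]
    exact ENNReal.ofReal_lt_top
  · have hder := (h.hasDerivAt_integral hΩ hfC hfc hft ht).neg
    have hval : -∫ x in Ωp t, transported Ωp f (t, x) = ∫ x in Ωp t, div v x := by
      rw [← integral_neg]
      congr 1
      ext x
      rw [hv, div_slice (f := fun i q =>
        f q * (dt (levelFn Ωp) q * dx i (levelFn Ωp) q) - dt (X i) q) fun i =>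
          (hcomp i).differentiable (by norm_num) _, transported, neg_sub]
      have h1 : dt f (t, x) = ∑ i, dx i (dt (X i)) (t, x) := by
        have h2 : ∀ i, DifferentiableAt ℝ (dx i (X i)) (t, x) := fun i =>
          (contDiffAt_dx (m := 1) (hXC i).contDiffAt (by norm_num) i).differentiableAt
            (by norm_num)
        rw [dt, hf, fderiv_fun_sum fun i _ => h2 i, sum_apply]
        exact Finset.sum_congr rfl fun i _ => dt_dx_comm (hXC i).contDiffAt i
      rw [h1, ← Finset.sum_sub_distrib]
      refine Finset.sum_congr rfl fun i _ => ?_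
      rw [dx, dx, dx, fderiv_fun_sub ((contDiff_mul_velocity hfC hft i).differentiable
        (by norm_num) _) ((hdtX i).differentiable (by norm_num) _)]
      rfl
    rw [hval] at hder
    refine hder.congr_of_eventuallyEq ?_
    filter_upwards [isOpen_Ioo.mem_nhds htab] with s hs
    rw [Measure.real, (harea s hs).2, ENNReal.toReal_ofReal (harea s hs).1]
    rfl

end

end

section

variable {n : ℕ}

/-! ### Pointwise identities -/

section
variable {u J : E n → E n} {p φ : E n → ℝ} {x : E n}

theorem strain_symm (u : E n → E n) (x : E n) (i j : Fin n) :
    strain u x i j = strain u x j i := by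
  simp only [strain, Matrix.of_apply, add_comm]

theorem contDiffAt_strain (hu : ContDiffAt ℝ 2 u x) (i j : Fin n) :
    ContDiffAt ℝ 1 (fun y => strain u y i j) x := by
  have h : ∀ i j, ContDiffAt ℝ 1 (fun y => partialD i u y j) x := fun i j =>
    contDiffAt_coord (contDiffAt_partialD (k := 1) hu i) j
  simp only [strain, Matrix.of_apply]
  exact ((h j i).add (h i j)).div_const 2

theorem contDiffAt_strainApply (hu : ContDiffAt ℝ 2 u x) :
    ContDiffAt ℝ 1 (fun y => strainApply u y (u y)) x := by
  rw [contDiffAt_piLp]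
  intro i
  have h : ContDiffAt ℝ 1 (fun y => ∑ j, strain u y i j * u y j) x :=
    ContDiffAt.sum fun j _ => (contDiffAt_strain hu i j).mul
      (contDiffAt_coord (hu.of_le (by norm_num)) j)
  exact h

theorem inner_strainApply_comm (v w : E n) :
    ⟪strainApply u x v, w⟫_ℝ = ⟪strainApply u x w, v⟫_ℝ := by
  simp only [inner_eq_sum, strainApply, Finset.sum_mul]
  rw [Finset.sum_comm]
  refine Finset.sum_congr rfl fun i _ => Finset.sum_congr rfl fun j _ => ?_
  rw [strain_symm]
  ring

/-- By the product rule the second term is D(u) : ∇u, and the symmetry of D(u) replaces ∇u by its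
symmetric part. -/
theorem div_strainApply (hu : ContDiffAt ℝ 2 u x) :
    div (fun y => strainApply u y (u y)) x = ⟪divStrain u x, u x⟫_ℝ + strainSq u x := by
  have hS : ∀ i j, DifferentiableAt ℝ (fun y => strain u y i j) x := fun i j =>
    (contDiffAt_strain hu i j).differentiableAt (by norm_num)
  have hd : DifferentiableAt ℝ u x := hu.differentiableAt (by norm_num)
  have hU : ∀ j, DifferentiableAt ℝ (fun y => u y j) x := fun j =>
    (contDiffAt_coord hu j).differentiableAt (by norm_num)
  rw [div_eq_sum ((contDiffAt_strainApply hu).differentiableAt (by norm_num))]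
  have h1 : ∀ i, partialD i (fun y => strainApply u y (u y) i) x
      = ∑ j, (strain u x i j * partialD i u x j + partialD i (fun y => strain u y i j) x * u x j) := by
    intro i
    have h2 := partialD_sum (s := Finset.univ) (f := fun j y => strain u y i j * u y j)
      (fun j _ => (hS i j).mul (hU j)) i
    refine h2.trans (Finset.sum_congr rfl fun j _ => ?_)
    rw [partialD_mul (hS i j) (hU j), partialD_apply hd]
  simp only [h1, Finset.sum_add_distrib]
  rw [add_comm]
  congr 1
  · simp only [inner_eq_sum, divStrain, Finset.sum_mul]
    rw [Finset.sum_comm]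
    refine Finset.sum_congr rfl fun i _ => Finset.sum_congr rfl fun j _ => ?_
    simp only [strain_symm u _ j i]
  · have h3 : ∑ i, ∑ j, strain u x i j * partialD j u x i
        = ∑ i, ∑ j, strain u x i j * partialD i u x j := by
      rw [Finset.sum_comm]
      refine Finset.sum_congr rfl fun i _ => Finset.sum_congr rfl fun j _ => ?_
      rw [strain_symm]
    have h4 : strainSq u x = (∑ i, ∑ j, strain u x i j * partialD j u x i
        + ∑ i, ∑ j, strain u x i j * partialD i u x j) / 2 := by
      rw [strainSq, ← Finset.sum_add_distrib, Finset.sum_div]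
      refine Finset.sum_congr rfl fun i _ => ?_
      rw [← Finset.sum_add_distrib, Finset.sum_div]
      refine Finset.sum_congr rfl fun j _ => ?_
      have h5 : strain u x i j = (partialD j u x i + partialD i u x j) / 2 := rfl
      rw [sq]
      nth_rewrite 2 [h5]
      ring
    rw [h4, h3]
    ring

/-- Antisymmetry of the triple product; it makes the power of the Lorentz force cancel against the
induced term of Ohm's law. -/
theorem inner_crossB_comm (hn : n = 2 ∨ n = 3) (v w : E n) (B : Fin 3 → ℝ) :
    ⟪crossB v B, w⟫_ℝ = -⟪crossB w B, v⟫_ℝ := by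
  rcases hn with rfl | rfl
  · simp [inner_eq_sum, crossB, toSpace, crossProduct, Fin.sum_univ_succ]
    ring
  · simp [inner_eq_sum, crossB, toSpace, crossProduct, Fin.sum_univ_succ]
    ring

theorem hasFDerivAt_half_norm_sq (hu : DifferentiableAt ℝ u x) :
    HasFDerivAt (fun y => 1 / 2 * ‖u y‖ ^ 2) ((innerSL ℝ (u x)).comp (fderiv ℝ u x)) x := by
  have h := (hu.hasFDerivAt.norm_sq).const_mul (1 / 2 : ℝ)
  convert! h using 1
  ext v
  simp

/-- The energy flux of a phase: power of the stresses, electric and kinetic energy transport. -/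
def energyFlux (η : ℝ) (u J : E n → E n) (p φ : E n → ℝ) (y : E n) : E n :=
  (2 * η) • strainApply u y (u y) - p y • u y - φ y • J y - (1 / 2 * ‖u y‖ ^ 2) • u y

theorem contDiffAt_energyFlux (η : ℝ) (hu : ContDiffAt ℝ 2 u x) (hJ : ContDiffAt ℝ 1 J x)
    (hp : ContDiffAt ℝ 1 p x) (hφ : ContDiffAt ℝ 1 φ x) :
    ContDiffAt ℝ 1 (energyFlux η u J p φ) x := by
  have hu1 : ContDiffAt ℝ 1 u x := hu.of_le (by norm_num)
  exact ((((contDiffAt_strainApply hu).const_smul (2 * η)).sub (hp.smul hu1)).sub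
    (hφ.smul hJ)).sub ((contDiffAt_const.mul (hu1.norm_sq ℝ)).smul hu1)

/-- Product rule for each term. The constraints div u = 0 and div J = 0 remove the contributions in
which p, φ or ½|u|² remains undifferentiated. -/
theorem div_energyFlux (η : ℝ) (hu : ContDiffAt ℝ 2 u x) (hJ : ContDiffAt ℝ 1 J x)
    (hp : ContDiffAt ℝ 1 p x) (hφ : ContDiffAt ℝ 1 φ x) (hdu : div u x = 0) (hdJ : div J x = 0) :
    div (energyFlux η u J p φ) x = 2 * η * (⟪divStrain u x, u x⟫_ℝ + strainSq u x)
      - ⟪gradient p x, u x⟫_ℝ - ⟪gradient φ x, J x⟫_ℝ - ⟪u x, fderiv ℝ u x (u x)⟫_ℝ := by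
  have hu1 : DifferentiableAt ℝ u x := hu.differentiableAt (by norm_num)
  have hJ1 : DifferentiableAt ℝ J x := hJ.differentiableAt (by norm_num)
  have hp1 : DifferentiableAt ℝ p x := hp.differentiableAt (by norm_num)
  have hφ1 : DifferentiableAt ℝ φ x := hφ.differentiableAt (by norm_num)
  have hS1 : DifferentiableAt ℝ (fun y => strainApply u y (u y)) x :=
    (contDiffAt_strainApply hu).differentiableAt (by norm_num)
  have hk := hasFDerivAt_half_norm_sq hu1
  have e1 : DifferentiableAt ℝ (fun y => (2 * η) • strainApply u y (u y)) x := hS1.fun_const_smul _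
  have e2 : DifferentiableAt ℝ (fun y => p y • u y) x := hp1.smul hu1
  have e3 : DifferentiableAt ℝ (fun y => φ y • J y) x := hφ1.smul hJ1
  have e4 : DifferentiableAt ℝ (fun y => (1 / 2 * ‖u y‖ ^ 2) • u y) x :=
    hk.differentiableAt.smul hu1
  unfold energyFlux
  rw [div_sub ((e1.fun_sub e2).fun_sub e3) e4, div_sub (e1.fun_sub e2) e3, div_sub e1 e2,
    div_smul (differentiableAt_const _) hS1, div_smul hp1 hu1, div_smul hφ1 hJ1,
    div_smul hk.differentiableAt hu1, hk.fderiv, hdu, hdJ, div_strainApply hu,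
    inner_gradient, inner_gradient]
  simp

theorem laplacian_eq_div_gradient {f : E n → ℝ} (hf : ContDiffAt ℝ 2 f x) :
    Δ f x = div (gradient f) x := by
  rw [InnerProductSpace.laplacian_eq_iteratedFDeriv_orthonormalBasis f
    (EuclideanSpace.basisFun (Fin n) ℝ)]
  rw [div_eq_sum ((contDiffAt_gradient (m := 1) hf (by norm_num)).differentiableAt (by norm_num))]
  refine Finset.sum_congr rfl fun i _ => ?_
  have h1 : (fun y => gradient f y i)
      = fun y => fderiv ℝ f y (EuclideanSpace.single i 1) := by
    ext y
    exact gradient_apply f y i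
  rw [h1, iteratedFDeriv_two_apply, partialD]
  have hd : DifferentiableAt ℝ (fderiv ℝ f) x :=
    (hf.fderiv_right (m := 1) (by norm_num)).differentiableAt (by norm_num)
  rw [fderiv_clm_apply hd (differentiableAt_const _)]
  simp

theorem div_mul_gradient (c : ℝ) {f : E n → ℝ} (hf : ContDiffAt ℝ 2 f x) (hΔ : Δ f x = 0) :
    div (fun y => (c * f y) • gradient f y) x = c * ‖gradient f x‖ ^ 2 := by
  have hf1 : DifferentiableAt ℝ f x := hf.differentiableAt (by norm_num)
  have hg : DifferentiableAt ℝ (gradient f) x :=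
    (contDiffAt_gradient (m := 1) hf (by norm_num)).differentiableAt (by norm_num)
  rw [div_smul (hf1.const_mul c) hg, ← laplacian_eq_div_gradient hf, hΔ,
    fderiv_const_mul hf1, smul_apply, ← inner_gradient, real_inner_self_eq_norm_sq]
  simp

end

end

section

variable {n : ℕ}

/-! ### The energy balance -/

section
variable {Ω : Set (E n)} {T : ℝ} {Ωp : ℝ → Set (E n)} {t : ℝ}

theorem phaseIntegral_congr {f g : Phase → E n → ℝ} (hm : ∀ s, MeasurableSet (region Ω Ωp t s))
    (hfg : ∀ s, ∀ x ∈ region Ω Ωp t s, f s x = g s x) :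
    phaseIntegral Ω Ωp t f = phaseIntegral Ω Ωp t g := by
  rw [phaseIntegral, phaseIntegral, setIntegral_congr_fun (hm _) (hfg .plus),
    setIntegral_congr_fun (hm _) (hfg .minus)]

theorem phaseIntegral_add {f g : Phase → E n → ℝ} (hf : PhaseIntegrable Ω Ωp t f)
    (hg : PhaseIntegrable Ω Ωp t g) :
    phaseIntegral Ω Ωp t (fun s x => f s x + g s x)
      = phaseIntegral Ω Ωp t f + phaseIntegral Ω Ωp t g := by
  simp only [phaseIntegral]
  rw [integral_add (hf .plus) (hg .plus), integral_add (hf .minus) (hg .minus)]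
  ring

theorem phaseIntegral_neg (f : Phase → E n → ℝ) :
    phaseIntegral Ω Ωp t (fun s x => -f s x) = -phaseIntegral Ω Ωp t f := by
  simp only [phaseIntegral, integral_neg]
  ring

theorem phaseIntegral_nonneg {f : Phase → E n → ℝ} (hf : ∀ s x, 0 ≤ f s x) :
    0 ≤ phaseIntegral Ω Ωp t f :=
  add_nonneg (integral_nonneg (hf _)) (integral_nonneg (hf _))

theorem dissipation_nonneg {η σ : Phase → ℝ} (hη : ∀ s, 0 < η s) (hσ : ∀ s, 0 < σ s)
    (w : Fields n) : 0 ≤ dissipation Ω η σ Ωp w t := by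
  refine add_nonneg (phaseIntegral_nonneg fun s x => ?_) (phaseIntegral_nonneg fun s x => ?_)
  · have h1 := (hη s).le
    have h2 : 0 ≤ strainSq (w.u s t) x :=
      Finset.sum_nonneg fun i _ => Finset.sum_nonneg fun j _ => sq_nonneg _
    rw [viscousDensity]
    positivity
  · have h1 := (hσ s).le
    rw [ohmicDensity]
    positivity

variable {η σ : Phase → ℝ} {lam : ℝ} {B : ℝ → E n → Fin 3 → ℝ} {w : Fields n}

theorem IsTwoPhaseMHD.contDiffAt_energyFlux (hw : IsTwoPhaseMHD Ω T η σ lam B Ωp w)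
    (ht : t ∈ Ioo 0 T) (s : Phase) {x : E n} (hx : x ∈ closure (region Ω Ωp t s)) :
    ContDiffAt ℝ 1 (energyFlux (η s) (w.u s t) (w.J s t) (w.p s t) (w.φ s t)) x :=
  SharpInterface.contDiffAt_energyFlux _ (contDiffAt_slice (hw.smooth_u s t ht x hx))
    (contDiffAt_slice (hw.smooth_J s t ht x hx)) (contDiffAt_slice (hw.smooth_p s t ht x hx))
    (contDiffAt_slice (hw.smooth_φ s t ht x hx))

/-- Momentum equation times u, plus Ohm's law times J; the magnetic terms cancel. -/
theorem IsTwoPhaseMHD.div_energyFlux (hw : IsTwoPhaseMHD Ω T η σ lam B Ωp w)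
    (hn : n = 2 ∨ n = 3) (ht : t ∈ Ioo 0 T) (s : Phase) {x : E n} (hx : x ∈ region Ω Ωp t s) :
    div (energyFlux (η s) (w.u s t) (w.J s t) (w.p s t) (w.φ s t)) x
      = ⟪w.u s t x, deriv (fun τ => w.u s τ x) t⟫_ℝ + viscousDensity η w t s x
        + ohmicDensity σ w t s x := by
  have hx' := subset_closure hx
  rw [SharpInterface.div_energyFlux _ (contDiffAt_slice (hw.smooth_u s t ht x hx'))
    (contDiffAt_slice (hw.smooth_J s t ht x hx')) (contDiffAt_slice (hw.smooth_p s t ht x hx'))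
    (contDiffAt_slice (hw.smooth_φ s t ht x hx')) (hw.div_u s t ht x hx) (hw.div_J s t ht x hx)]
  have h1 := congrArg (fun v => ⟪v, w.u s t x⟫_ℝ) (hw.momentum s t ht x hx)
  have h2 := congrArg (fun v => ⟪v, w.J s t x⟫_ℝ) (hw.ohm s t ht x hx)
  have h3 := inner_crossB_comm hn (w.J s t x) (w.u s t x) (B t x)
  simp only [inner_sub_left, inner_add_left, inner_smul_left, inner_zero_left,
    RCLike.conj_to_real] at h1 h2
  rw [real_inner_self_eq_norm_sq] at h2
  rw [viscousDensity, ohmicDensity, real_inner_comm (deriv (fun τ => w.u s τ x) t),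
    real_inner_comm (fderiv ℝ (w.u s t) x (w.u s t x))]
  linarith

theorem inner_energyFlux (s : Phase) (x : E n) :
    ⟪energyFlux (η s) (w.u s t) (w.J s t) (w.p s t) (w.φ s t) x, normal Ωp t x⟫_ℝ
      = ⟪traction η Ωp w s t x, w.u s t x⟫_ℝ - w.φ s t x * ⟪w.J s t x, normal Ωp t x⟫_ℝ
        - 1 / 2 * ‖w.u s t x‖ ^ 2 * ⟪w.u s t x, normal Ωp t x⟫_ℝ := by
  simp only [energyFlux, traction, inner_sub_left, inner_smul_left, RCLike.conj_to_real]
  rw [inner_strainApply_comm, real_inner_comm (w.u s t x) (normal Ωp t x)]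

/-- Continuity of u, φ and J·ν cancels the transport terms, and the traction jump contributes the
power of surface tension. -/
theorem IsTwoPhaseMHD.jump_energyFlux (hw : IsTwoPhaseMHD Ω T η σ lam B Ωp w)
    (ht : t ∈ Ioo 0 T) {x : E n} (hx : x ∈ interface Ωp t) :
    ⟪energyFlux (η .plus) (w.u .plus t) (w.J .plus t) (w.p .plus t) (w.φ .plus t) x
      - energyFlux (η .minus) (w.u .minus t) (w.J .minus t) (w.p .minus t) (w.φ .minus t) x,
      normal Ωp t x⟫_ℝ = -(lam * curvature Ωp t x) * ⟪w.u .minus t x, normal Ωp t x⟫_ℝ := by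
  have h1 := congrArg (fun v => ⟪v, w.u .minus t x⟫_ℝ) (hw.jump_stress t ht x hx)
  simp only [inner_sub_left, inner_neg_left, inner_smul_left, RCLike.conj_to_real] at h1
  rw [inner_sub_left, inner_energyFlux, inner_energyFlux, hw.jump_u t ht x hx,
    hw.jump_J t ht x hx, hw.jump_φ t ht x hx]
  rw [real_inner_comm (w.u .minus t x) (normal Ωp t x)] at h1
  linarith

theorem continuousAt_strainSq {u : E n → E n} {x : E n} (hu : ContDiffAt ℝ 2 u x) :
    ContinuousAt (strainSq u) x := by
  unfold strainSq
  exact tendsto_finsetSum _ fun i _ => tendsto_finsetSum _ fun j _ =>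
    ((contDiffAt_strain hu i j).continuousAt).pow 2

theorem IsTwoPhaseMHD.phaseIntegrable (hw : IsTwoPhaseMHD Ω T η σ lam B Ωp w)
    (h : IsEvolvingInterface Ω T Ωp) (hΩb : Bornology.IsBounded Ω) (ht : t ∈ Ioo 0 T) :
    PhaseIntegrable Ω Ωp t (kineticDensity w t) ∧
      PhaseIntegrable Ω Ωp t (viscousDensity η w t) ∧
      PhaseIntegrable Ω Ωp t (ohmicDensity σ w t) := by
  refine ⟨h.phaseIntegrable hΩb ht fun s x hx => ?_, h.phaseIntegrable hΩb ht fun s x hx => ?_,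
    h.phaseIntegrable hΩb ht fun s x hx => ?_⟩
  · exact (((contDiffAt_slice (hw.smooth_u s t ht x hx)).continuousAt.norm.pow 2).const_mul
      (1 / 2)).continuousWithinAt
  · exact ((continuousAt_strainSq (contDiffAt_slice (hw.smooth_u s t ht x hx))).const_mul
      (2 * η s)).continuousWithinAt
  · exact (((contDiffAt_slice (hw.smooth_J s t ht x hx)).continuousAt.norm.pow 2).const_mul
      (σ s)⁻¹).continuousWithinAt

/-- The balance of the kinetic energy: the power of the surface tension is written as the flux of
the field `Y`. -/
theorem IsTwoPhaseMHD.exists_hasDerivAt_kinetic (hw : IsTwoPhaseMHD Ω T η σ lam B Ωp w)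
    (hn : n = 2 ∨ n = 3) (hΩ : IsBoundedLipschitzDomain Ω) (h : IsEvolvingInterface Ω T Ωp)
    (ht : t ∈ Ioo 0 T) :
    ∃ Y : E n → E n, ContDiff ℝ 1 Y ∧ HasCompactSupport Y ∧
      (∀ x ∈ tsupport Y, (t, x) ∈ tube Ω T Ωp) ∧
      (∀ x ∈ interface Ωp t, ⟪Y x, normal Ωp t x⟫_ℝ
        = -(lam * curvature Ωp t x) * ⟪w.u .minus t x, normal Ωp t x⟫_ℝ) ∧
      HasDerivAt (fun s => phaseIntegral Ω Ωp s (kineticDensity w s))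
        (-dissipation Ω η σ Ωp w t + ∫ x in Ωp t, div Y x) t := by
  obtain ⟨-, hiv, hio⟩ := hw.phaseIntegrable h hΩ.isBounded ht
  have hm : ∀ s, MeasurableSet (region Ω Ωp t s) := fun s =>
    (h.isOpen_region hΩ.isOpen ht s).measurableSet
  have hcl := h.interface_subset_closure_region hΩ.isOpen ht
  set O : Set (E n) := {x | (t, x) ∈ tube Ω T Ωp} ∩ {x | ContDiffAt ℝ 1 (w.u .minus t) x}
  have hO : IsOpen O := (isOpen_tube_slice hΩ.isOpen t).inter
    (isOpen_contDiffAt (by norm_cast) _)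
  obtain ⟨θ, hθ, hθc, hθO, hθ1, -⟩ := exists_cutoff (h.isCompact_interface hΩ.isBounded ht) hO
    fun x hx => by
      have hu : ContDiffAt ℝ 1 (w.u .minus t) x :=
        (contDiffAt_slice (hw.smooth_u .minus t ht x (hcl _ hx))).of_le (by norm_num)
      exact ⟨h.mem_tube ht hx, hu⟩
  -- An extension of the jump -λκ u off the interface; κ is C¹ because d is C³.
  set Y₁ : E n → E n := fun x => θ x • ((-(lam * curvature Ωp t x)) • w.u .minus t x) with hY₁
  have hY₁C : ContDiff ℝ 1 Y₁ := contDiff_cutoff_smul (hθ.of_le (by norm_cast)) fun x hx =>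
    ((contDiffAt_const.mul (contDiffAt_curvature hΩ.isOpen (hθO hx).1)).neg).smul
      (g := w.u .minus t) (hθO hx).2
  have hY₁c : HasCompactSupport Y₁ := hθc.smul_right
  have hY₁t : ∀ x ∈ tsupport Y₁, (t, x) ∈ tube Ω T Ωp := fun x hx =>
    (hθO (tsupport_smul_subset_left _ _ hx)).1
  have hY₁ν : ∀ x ∈ interface Ωp t, ⟪Y₁ x, normal Ωp t x⟫_ℝ
      = -(lam * curvature Ωp t x) * ⟪w.u .minus t x, normal Ωp t x⟫_ℝ := fun x hx => by
    simp only [hY₁, (hθ1 x hx).self_of_nhds, one_smul, inner_smul_left, RCLike.conj_to_real]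
  -- On the outer boundary no-slip removes every term carrying u, and the insulating condition
  -- removes φJ.
  have hflux := h.phaseIntegral_div hΩ ht
    (F := fun s => energyFlux (η s) (w.u s t) (w.J s t) (w.p s t) (w.φ s t))
    (fun s x hx => hw.contDiffAt_energyFlux ht s hx) (fun x m hm => by
      simp only [energyFlux, hw.no_slip t ht x hm.1, smul_zero, sub_zero, inner_sub_left,
        inner_smul_left, hw.insulating t ht x m hm, mul_zero]
      simp [inner_eq_sum, strainApply]) hY₁C hY₁c hY₁t fun x hx => by
        rw [hY₁ν x hx]; exact hw.jump_energyFlux ht hx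
  have hkin := h.hasDerivAt_phaseIntegral hΩ.isOpen hΩ.isBounded ht
    (f := fun s q => 1 / 2 * ‖w.u s q.1 q.2‖ ^ 2)
    (fun s τ hτ x hx => contDiffAt_const.mul
      (((hw.smooth_u s τ hτ x hx).of_le (by norm_num)).norm_sq ℝ))
    fun τ hτ x hx => by rw [hw.jump_u τ hτ x hx]
  have hdens : ∀ s, ∀ x ∈ closure (region Ω Ωp t s),
      dt (fun q : ℝ × E n => 1 / 2 * ‖w.u s q.1 q.2‖ ^ 2) (t, x)
        = ⟪w.u s t x, deriv (fun τ => w.u s τ x) t⟫_ℝ := by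
    intro s x hx
    have hd : DifferentiableAt ℝ (fun q : ℝ × E n => w.u s q.1 q.2) (t, x) :=
      (hw.smooth_u s t ht x hx).differentiableAt (by norm_num)
    have h1 := (hasDerivAt_slice hd).differentiableAt.hasDerivAt
    have h2 := (h1.norm_sq).const_mul (1 / 2 : ℝ)
    have h3 : DifferentiableAt ℝ (fun q : ℝ × E n => 1 / 2 * ‖w.u s q.1 q.2‖ ^ 2) (t, x) :=
      (hd.norm_sq ℝ).const_mul _
    rw [(hasDerivAt_slice h3).unique h2]
    ring
  have hbal : phaseIntegral Ω Ωp t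
        (fun s x => dt (fun q : ℝ × E n => 1 / 2 * ‖w.u s q.1 q.2‖ ^ 2) (t, x))
      = -dissipation Ω η σ Ωp w t + ∫ x in Ωp t, div Y₁ x := by
    have hint : PhaseIntegrable Ω Ωp t
        fun s x => dt (fun q : ℝ × E n => 1 / 2 * ‖w.u s q.1 q.2‖ ^ 2) (t, x) :=
      h.phaseIntegrable hΩ.isBounded ht fun s x hx => by
        have hc : ContinuousAt (dt fun q : ℝ × E n => 1 / 2 * ‖w.u s q.1 q.2‖ ^ 2) (t, x) :=
          (contDiffAt_dt (m := 0) (contDiffAt_const.mul ((hw.smooth_u s t ht x hx).norm_sq ℝ))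
            (by norm_num)).continuousAt
        exact (ContinuousAt.comp (f := fun x => (t, x)) hc (by fun_prop)).continuousWithinAt
    have hsum : PhaseIntegrable Ω Ωp t fun s x =>
        dt (fun q : ℝ × E n => 1 / 2 * ‖w.u s q.1 q.2‖ ^ 2) (t, x) + viscousDensity η w t s x :=
      fun s => (hint s).add (hiv s)
    have hpt : ∀ s, ∀ x ∈ region Ω Ωp t s,
        div (energyFlux (η s) (w.u s t) (w.J s t) (w.p s t) (w.φ s t)) x
          = dt (fun q : ℝ × E n => 1 / 2 * ‖w.u s q.1 q.2‖ ^ 2) (t, x) + viscousDensity η w t s x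
            + ohmicDensity σ w t s x := fun s x hx => by
      rw [hw.div_energyFlux hn ht s hx, hdens s x (subset_closure hx)]
    rw [phaseIntegral_congr hm hpt, phaseIntegral_add hsum hio, phaseIntegral_add hint hiv] at hflux
    rw [← hflux, dissipation]
    ring
  rw [hbal] at hkin
  exact ⟨Y₁, hY₁C, hY₁c, hY₁t, hY₁ν, hkin⟩

/-- The energy balance before the kinematics of the interface is used: besides the dissipation,
the energy changes by the integral of `lam κ (V - u · ν)` over the interface, written as the flux
of the field `Y`. -/
theorem IsTwoPhaseMHD.exists_hasDerivAt_energy (hw : IsTwoPhaseMHD Ω T η σ lam B Ωp w)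
    (hn : n = 2 ∨ n = 3) (hΩ : IsBoundedLipschitzDomain Ω) (h : IsEvolvingInterface Ω T Ωp)
    (ht : t ∈ Ioo 0 T) :
    FiniteEnergy Ω η σ Ωp w t ∧ ∃ Y : E n → E n, ContDiff ℝ 1 Y ∧ HasCompactSupport Y ∧
      (∀ x ∈ tsupport Y, (t, x) ∈ tube Ω T Ωp) ∧
      (∀ x ∈ interface Ωp t, ⟪Y x, normal Ωp t x⟫_ℝ
        = lam * curvature Ωp t x * (normalVelocity Ωp t x - ⟪w.u .minus t x, normal Ωp t x⟫_ℝ)) ∧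
      HasDerivAt (energy Ω lam Ωp w)
        (-dissipation Ω η σ Ωp w t + ∫ x in Ωp t, div Y x) t := by
  obtain ⟨v, hvC, hvc, hvt, hvν, hfin, hder⟩ := h.exists_hasDerivAt_area hΩ.isOpen hΩ.isBounded ht
  obtain ⟨Y₁, hY₁C, hY₁c, hY₁t, hY₁ν, hkin⟩ := hw.exists_hasDerivAt_kinetic hn hΩ h ht
  obtain ⟨hik, hiv, hio⟩ := hw.phaseIntegrable h hΩ.isBounded ht
  refine ⟨⟨hik, hfin, hiv, hio⟩, ?_⟩
  set v₁ : E n → E n := fun x => lam • v x with hv₁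
  have hv₁C : ContDiff ℝ 1 v₁ := hvC.const_smul lam
  have hv₁s : Function.support v₁ ⊆ Function.support v := Function.support_const_smul_subset lam v
  have hv₁c : HasCompactSupport v₁ := hvc.mono hv₁s
  have hdv : ∀ x, div v₁ x = lam * div v x := fun x => by
    rw [hv₁, div_smul (differentiableAt_const lam) (hvC.differentiable (by norm_num) x)]
    simp
  refine ⟨fun x => Y₁ x + v₁ x, hY₁C.add hv₁C, hY₁c.add hv₁c, fun x hx => ?_, fun x hx => ?_, ?_⟩
  · rcases tsupport_add _ _ hx with hx | hx
    · exact hY₁t x hx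
    · exact hvt x (closure_mono hv₁s hx)
  · rw [inner_add_left, hv₁, inner_smul_left, hY₁ν x hx, hvν x hx, RCLike.conj_to_real]
    ring
  · have hint : ∫ x in Ωp t, div (fun y => Y₁ y + v₁ y) x
        = (∫ x in Ωp t, div Y₁ x) + lam * ∫ x in Ωp t, div v x := by
      simp only [div_add (hY₁C.differentiable (by norm_num) _)
        (hv₁C.differentiable (by norm_num) _)]
      rw [integral_add (integrable_div hY₁C hY₁c).integrableOn
        (integrable_div hv₁C hv₁c).integrableOn]
      simp only [hdv, integral_const_mul]
    have hen : energy Ω lam Ωp w = fun s => phaseIntegral Ω Ωp s (kineticDensity w s)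
        + lam * (μHE[n - 1]).real (interface Ωp s) := by
      ext s
      rw [energy, setIntegral_const, smul_eq_mul, mul_comm lam]
    rw [hint, ← add_assoc, hen]
    exact hkin.add (hder.const_mul lam)

/-- Use the flux -m₀μ∇μ. Its divergence is -m₀|∇μ|² since μ is harmonic, it has no outer flux, and
its normal jump -m₀μ[∇μ]·ν equals 2μ(V - u·ν) = λκ(V - u·ν) by the Stefan and Gibbs-Thomson
conditions, where both traces of μ agree. This is the normal component of Y. -/
theorem IsStefanInterface.phaseIntegral_diffusiveDensity {m₀ : ℝ} {μ : Phase → ℝ → E n → ℝ}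
    (hμ : IsStefanInterface Ω T m₀ lam Ωp w μ) (hΩ : IsBoundedLipschitzDomain Ω)
    (h : IsEvolvingInterface Ω T Ωp) (ht : t ∈ Ioo 0 T) {Y : E n → E n} (hY : ContDiff ℝ 1 Y)
    (hYc : HasCompactSupport Y) (hYt : ∀ x ∈ tsupport Y, (t, x) ∈ tube Ω T Ωp)
    (hYν : ∀ x ∈ interface Ωp t, ⟪Y x, normal Ωp t x⟫_ℝ = lam * curvature Ωp t x *
      (normalVelocity Ωp t x - ⟪w.u .minus t x, normal Ωp t x⟫_ℝ)) :
    ∫ x in Ωp t, div Y x = -phaseIntegral Ω Ωp t (diffusiveDensity m₀ μ t) := by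
  have hC : ∀ s, ∀ x ∈ closure (region Ω Ωp t s), ContDiffAt ℝ 2 (μ s t) x := fun s x hx =>
    contDiffAt_slice (hμ.smooth_μ s t ht x hx)
  rw [← h.phaseIntegral_div hΩ ht (F := fun s x => (-m₀ * μ s t x) • gradient (μ s t) x)
    (fun s x hx => (contDiffAt_const.mul ((hC s x hx).of_le (by norm_num))).smul
      (contDiffAt_gradient (hC s x hx) (by norm_num)))
    (fun x m hm => by rw [inner_smul_left, hμ.no_flux t ht x m hm, mul_zero]) hY hYc hYt
    fun x hx => ?_, ← phaseIntegral_neg]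
  · refine phaseIntegral_congr (fun s => (h.isOpen_region hΩ.isOpen ht s).measurableSet)
      fun s x hx => ?_
    rw [div_mul_gradient _ (hC s x (subset_closure hx)) (hμ.harmonic s t ht x hx),
      diffusiveDensity]
    ring
  · have h1 := hμ.stefan .minus t ht x hx
    have h2 := hμ.gibbs_thomson .plus t ht x hx
    have h3 := hμ.gibbs_thomson .minus t ht x hx
    have h4 : μ .plus t x = μ .minus t x := by linarith
    rw [hYν x hx, ← h3, h4, ← smul_sub, inner_smul_left, RCLike.conj_to_real]
    linear_combination (μ .minus t x) * h1

theorem IsStefanInterface.phaseIntegrable {m₀ : ℝ} {μ : Phase → ℝ → E n → ℝ}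
    (hμ : IsStefanInterface Ω T m₀ lam Ωp w μ) (hΩb : Bornology.IsBounded Ω)
    (h : IsEvolvingInterface Ω T Ωp) (ht : t ∈ Ioo 0 T) :
    PhaseIntegrable Ω Ωp t (diffusiveDensity m₀ μ t) :=
  h.phaseIntegrable hΩb ht fun s x hx =>
    (((contDiffAt_gradient (m := 0) (contDiffAt_slice (hμ.smooth_μ s t ht x hx))
      (by norm_num)).continuousAt.norm.pow 2).const_mul m₀).continuousWithinAt

end

end

end SharpInterface

end

/-! ### The energy law under the two kinematic conditions -/

theorem mainTheorem2 (n : ℕ) (hn : n = 2 ∨ n = 3)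
    (Ω : Set (SharpInterface.E n)) (hΩ : SharpInterface.IsBoundedLipschitzDomain Ω)
    (T : ℝ) (η σ : SharpInterface.Phase → ℝ) (hη : ∀ s, 0 < η s) (hσ : ∀ s, 0 < σ s)
    (lam m₀ : ℝ) (hlam : 0 < lam) (hm₀ : 0 < m₀)
    (B : ℝ → SharpInterface.E n → Fin 3 → ℝ)
    (Ωp : ℝ → Set (SharpInterface.E n)) (hΩp : SharpInterface.IsEvolvingInterface Ω T Ωp)
    (w : SharpInterface.Fields n)
    (hw : SharpInterface.IsTwoPhaseMHD Ω T η σ lam B Ωp w) :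
    -- Case I: constant mobility
    (∀ μ : SharpInterface.Phase → ℝ → SharpInterface.E n → ℝ,
      SharpInterface.IsStefanInterface Ω T m₀ lam Ωp w μ →
      ∀ t ∈ Set.Ioo 0 T,
        SharpInterface.FiniteEnergy Ω η σ Ωp w t ∧
        SharpInterface.PhaseIntegrable Ω Ωp t (SharpInterface.diffusiveDensity m₀ μ t) ∧
        HasDerivAt (SharpInterface.energy Ω lam Ωp w)
          (-(SharpInterface.dissipation Ω η σ Ωp w t
            + SharpInterface.phaseIntegral Ω Ωp t (SharpInterface.diffusiveDensity m₀ μ t))) t ∧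
        -(SharpInterface.dissipation Ω η σ Ωp w t
            + SharpInterface.phaseIntegral Ω Ωp t (SharpInterface.diffusiveDensity m₀ μ t)) ≤ 0) ∧
    -- Cases II and III: vanishing or degenerate mobility
    (SharpInterface.IsMaterialInterface T Ωp w →
      ∀ t ∈ Set.Ioo 0 T,
        SharpInterface.FiniteEnergy Ω η σ Ωp w t ∧
        HasDerivAt (SharpInterface.energy Ω lam Ωp w)
          (-SharpInterface.dissipation Ω η σ Ωp w t) t ∧
        -SharpInterface.dissipation Ω η σ Ωp w t ≤ 0) := by
  refine ⟨fun μ hμ t ht => ?_, fun hV t ht => ?_⟩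
  · obtain ⟨hfin, Y, hY, hYc, hYt, hYν, hder⟩ := hw.exists_hasDerivAt_energy hn hΩ hΩp ht
    rw [hμ.phaseIntegral_diffusiveDensity hΩ hΩp ht hY hYc hYt hYν, ← neg_add] at hder
    refine ⟨hfin, hμ.phaseIntegrable hΩ.isBounded hΩp ht, hder, neg_nonpos.2 (add_nonneg
      (SharpInterface.dissipation_nonneg hη hσ w)
      (SharpInterface.phaseIntegral_nonneg fun s x => ?_))⟩
    exact mul_nonneg hm₀.le (sq_nonneg _)
  · obtain ⟨hfin, Y, hY, hYc, hYt, hYν, hder⟩ := hw.exists_hasDerivAt_energy hn hΩ hΩp ht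
    -- For a material interface Y is tangential, so the remaining interface term vanishes.
    rw [hΩp.integral_div_eq_zero hΩ.isOpen ht hY hYc hYt fun x hx => by
      rw [hYν x hx, hV .minus t ht x hx, sub_self, mul_zero], add_zero] at hder
    exact ⟨hfin, hder, neg_nonpos.2 (SharpInterface.dissipation_nonneg hη hσ w)⟩
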